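/- **Definitions.** Let $d\ge 1$. A cube is a set $\prod_{i=1}^d[a_i,a_i+\ell)$ with $\ell>0$. For $\alpha\in\{0,\frac13,\frac23\}^d$ let $\mathcal D^\alpha=\{2^{-j}([0,1)^d+(-1)^j\alpha+k): j\in\mathbf Z,\ k\in\mathbf Z^d\}$. A collection $\mathcal S$ of cubes is *sparse* if $\mathcal S=\bigcup_\alpha\mathcal S^\alpha$ with $\mathcal S^\alpha\subseteq\mathcal D^\alpha$ and $\sum_{Q'}|Q'|\le\frac12|Q|$ for every $\alpha$ and every $Q\in\mathcal S^\alpha$, where $Q'$ runs over the maximal cubes of $\mathcal S^\alpha$ properly contained in $Q$. Write $\langle f\rangle_{p,Q}=(|Q|^{-1}\int_Q|f|^p\,dx)^{1/p}$ for $0<p<\infty$, $\langle f\rangle_{\infty,Q}=\operatorname{ess\,sup}_Q|f|$, $L^\infty_0$ for the essentially bounded functions on $\mathbf R^d$ with compact support, and $\|f\|_{L^r_w}=\|fw\|_{L^r(\mathbf R^d)}$; a weight is a measurable function that is positive a.e. Let $0<r<s\le\infty$ and $0<q<s$, and let $(s/q)'$ be the Hölder conjugate of $s/q$. An operator $T$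 from $L^\infty_0$ to measurable functions satisfies *$(r,s)$ limited-range sparse domination of $\ell^q$-type with constant $K\ge0$* if for all $f\in L_0^\infty$ and $g\in L^1(\mathbf R^d)$ there is a sparse collection $\mathcal S$ with $$\Big(\int_{\mathbf R^d}|Tf|^q|g|\,dx\Big)^{1/q}\le K\Big(\sum_{Q\in\mathcal S}\langle f\rangle_{r,Q}^q\,\langle g\rangle_{(s/q)',Q}\,|Q|\Big)^{1/q}.$$ For a weight $w$ put $w_{r,s}=w^{1/(\frac1r-\frac1s)}$ and, with suprema over all cubes, $$[w]_{r,(r,s)}=\sup_Q\,\langle w\rangle_{\frac1{1/r-1/s},Q}\,\langle w^{-1}\rangle_{\infty,Q},\qquad [v]_{\mathrm{FW}}=\sup_Q\frac1{v(Q)}\int_Q M(v\mathbf 1_Q)\,dx,$$ where $v(A)=\int_A v\,dx$ and $Mh(x)=\sup_{Q\ni x}\langle h\rangle_{1,Q}$; $w\in A_{r,(r,s)}$ means $[w]_{r,(r,s)}<\infty$ (equivalently $w_{r,s}\in A_1$). Finally $\|h\|_{L^{r,\infty}(v)}=\sup_{\lambda>0}\lambda\, v(\{|h|>\lambda\})^{1/r}$.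 **Theorem.** Given $d$, $0<r<s\le\infty$ and $0<q<s$, there is a constant $C$ depending only on $d,r,s,q$ such that the following holds for every $T$ satisfying $(r,s)$ limited-range sparse domination of $\ell^q$-type with constant $K$ and every weight $w\in A_{r,(r,s)}$. Put $$B_w=\begin{cases}[w]_{r,(r,s)}\,[w_{r,s}]_{\mathrm{FW}}^{\frac1q-\frac1r}\,(1+\log[w_{r,s}]_{\mathrm{FW}})^{\frac1r}&\text{if }q\le r,\\ [w]_{r,(r,s)}&\text{if }q>r.\end{cases}$$ (i) For all $f\in L^\infty_0$, $$\|(Tf)\,w_{r,s}^{-1/s}\|_{L^{r,\infty}(w_{r,s})}\le C\,K\,B_w\,\|f\|_{L^r_w}.$$ (ii) If moreover $|Tf-Tg|\le|T(f-g)|$ a.e. for all $f,g\in L_0^\infty$ (for example, if $T$ is linear, or sublinear with nonnegative values), then $T$ extends to an operator from $L^r_w$ to measurable functions which satisfies $|Tf-Tg|\le|T(f-g)|$ a.e. for all $f,g\in L^r_w$ and the estimate in (i), with the same constant, for all $f\in L^r_w$. -/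

import Mathlib

open MeasureTheory
open scoped ENNReal NNReal

noncomputable section

/-! ### Cubes, shifted dyadic grids, sparse collections

Points of `ℝ^d` are functions `Fin d → ℝ`; only Lebesgue measure, cubes and compactness are used,
so the choice of norm on `ℝ^d` plays no role. -/

/-- The half-open cube `∏ [a_j, a_j + ℓ)`. -/
def cube {d : ℕ} (a : Fin d → ℝ) (ℓ : ℝ) : Set (Fin d → ℝ) :=
  Set.univ.pi fun i => Set.Ico (a i) (a i + ℓ)

/-- A cube of positive side length. -/
def IsCube {d : ℕ} (Q : Set (Fin d → ℝ)) : Prop :=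
  ∃ (a : Fin d → ℝ) (ℓ : ℝ), 0 < ℓ ∧ Q = cube a ℓ

/-- The dyadic grid `D^α` with shift `α/3`, `α ∈ {0,1,2}^d`: the cubes
`2^{-j} ([0,1)^d + (-1)^j α/3 + k)` with `j ∈ ℤ` and `k ∈ ℤ^d`.
The alternating sign is what makes the cubes of different sizes nested. -/
def dyadicGrid {d : ℕ} (α : Fin d → Fin 3) : Set (Set (Fin d → ℝ)) :=
  {Q | ∃ (j : ℤ) (k : Fin d → ℤ),
    Q = cube (fun i => (2 : ℝ) ^ (-j) * ((-1 : ℝ) ^ j * (((α i : ℕ) : ℝ) / 3) + (k i : ℝ)))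
      ((2 : ℝ) ^ (-j))}

/-- The maximal elements of `P` among those properly contained in `Q`. -/
def children {d : ℕ} (P : Set (Set (Fin d → ℝ))) (Q : Set (Fin d → ℝ)) :
    Set (Set (Fin d → ℝ)) :=
  {Q' | Maximal (fun R => R ∈ P ∧ R ⊂ Q) Q'}

/-- `S` is `η`-sparse: it is a union of subcollections of the dyadic grids `D^α`, in each of which
the children of any cube `Q` have total measure at most `(1 - η) |Q|`. -/
def IsSparse {d : ℕ} (η : ℝ) (S : Set (Set (Fin d → ℝ))) : Prop :=
  ∃ S' : (Fin d → Fin 3) → Set (Set (Fin d → ℝ)),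
    S = ⋃ α, S' α ∧
    ∀ α, S' α ⊆ dyadicGrid α ∧
      ∀ Q ∈ S' α, ∑' Q' : children (S' α) Q, volume (Q' : Set (Fin d → ℝ))
        ≤ ENNReal.ofReal (1 - η) * volume Q

/-! ### Averages, the maximal operator and weights -/

/-- The average `⟨f⟩_{p,Q} = (|Q|⁻¹ ∫_Q |f|^p)^{1/p}` for `0 < p < ∞`, and the essential supremum
of `|f|` over `Q` for `p = ∞`. -/
def cubeAvg {d : ℕ} {F : Type*} [NormedAddCommGroup F] (p : ℝ≥0∞) (f : (Fin d → ℝ) → F)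
    (Q : Set (Fin d → ℝ)) : ℝ≥0∞ :=
  eLpNorm f p ((volume Q)⁻¹ • volume.restrict Q)

/-- The (uncentred) Hardy-Littlewood maximal function over all cubes. -/
def cubeMaximal {d : ℕ} (f : (Fin d → ℝ) → ℝ) (x : Fin d → ℝ) : ℝ≥0∞ :=
  ⨆ (Q : Set (Fin d → ℝ)) (_ : IsCube Q) (_ : x ∈ Q), cubeAvg 1 f Q

/-- A weight: a measurable function which is positive almost everywhere. -/
def IsWeight {d : ℕ} (w : (Fin d → ℝ) → ℝ) : Prop :=
  AEMeasurable w volume ∧ ∀ᵐ x, 0 < w x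

/-- The measure `w dx`. -/
def weightMeasure {d : ℕ} (w : (Fin d → ℝ) → ℝ) : Measure (Fin d → ℝ) :=
  volume.withDensity fun x => ENNReal.ofReal (w x)

/-- The limited-range Muckenhoupt constant `[w]_{p,(r,s)}`, `r ≤ p ≤ s`: the supremum over all
cubes of `⟨w⟩_{1/(1/p-1/s),Q} ⟨w⁻¹⟩_{1/(1/r-1/p),Q}`. -/
def limitedRangeConst {d : ℕ} (p r s : ℝ≥0∞) (w : (Fin d → ℝ) → ℝ) : ℝ≥0∞ :=
  ⨆ (Q : Set (Fin d → ℝ)) (_ : IsCube Q),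
    cubeAvg (p⁻¹ - s⁻¹)⁻¹ w Q * cubeAvg (r⁻¹ - p⁻¹)⁻¹ (fun x => (w x)⁻¹) Q

/-- `w ∈ A_{p,(r,s)}`. -/
def LimitedRangeWeight {d : ℕ} (p r s : ℝ≥0∞) (w : (Fin d → ℝ) → ℝ) : Prop :=
  IsWeight w ∧ limitedRangeConst p r s w < ∞

/-- The Fujii-Wilson constant `[w]_FW = sup_Q w(Q)⁻¹ ∫_Q M(w 1_Q)`. -/
def fujiiWilsonConst {d : ℕ} (w : (Fin d → ℝ) → ℝ) : ℝ≥0∞ :=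
  ⨆ (Q : Set (Fin d → ℝ)) (_ : IsCube Q),
    (weightMeasure w Q)⁻¹ * ∫⁻ x in Q, cubeMaximal (Q.indicator w) x

/-- The weight `w_{r,s} = w^{1/(1/r-1/s)}`. -/
def rescaledWeight {d : ℕ} (r s : ℝ≥0∞) (w : (Fin d → ℝ) → ℝ) : (Fin d → ℝ) → ℝ :=
  fun x => w x ^ ((r⁻¹ - s⁻¹)⁻¹).toReal

/-! ### Function spaces and sparse domination -/

/-- The weak `L^p` quasinorm `sup_{λ > 0} λ μ{|f| > λ}^{1/p}`, `0 < p < ∞`. -/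
def weakLpNorm {Ω F : Type*} [MeasurableSpace Ω] [NormedAddCommGroup F] (f : Ω → F) (p : ℝ≥0∞)
    (μ : Measure Ω) : ℝ≥0∞ :=
  ⨆ (t : ℝ≥0) (_ : 0 < t), (t : ℝ≥0∞) * μ {x | (t : ℝ≥0∞) < ‖f x‖ₑ} ^ (p⁻¹).toReal

variable {d : ℕ} {𝕜 : Type*} [RCLike 𝕜]

/-- `L_0^∞`: essentially bounded functions with compact support. -/
def BddCompactSupp (f : (Fin d → ℝ) → 𝕜) : Prop :=
  MemLp f ∞ volume ∧ HasCompactSupport f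

/-- The norm `‖f‖_{L^p_w} = ‖f w‖_{L^p}`. -/
def weightedLpNorm (f : (Fin d → ℝ) → 𝕜) (p : ℝ≥0∞) (w : (Fin d → ℝ) → ℝ) : ℝ≥0∞ :=
  eLpNorm (fun x => w x • f x) p volume

/-- `f ∈ L^p_w`. -/
def MemWeightedLp (f : (Fin d → ℝ) → 𝕜) (p : ℝ≥0∞) (w : (Fin d → ℝ) → ℝ) : Prop :=
  AEStronglyMeasurable f volume ∧ weightedLpNorm f p w < ∞

/-- `T`, an operator from `L_0^∞` to measurable functions, satisfies `(r,s)` limited-range sparse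
domination of `ℓ^q`-type with implicit constant `K`. Here `(s/q)'` is the Hölder conjugate of
`s/q`. The values of `T` outside `L_0^∞` are irrelevant. -/
def SparseDominated (r s q : ℝ≥0∞) (K : ℝ≥0)
    (T : ((Fin d → ℝ) → 𝕜) → ((Fin d → ℝ) → 𝕜)) : Prop :=
  ∀ f, BddCompactSupp f → AEStronglyMeasurable (T f) volume ∧
    ∀ g : (Fin d → ℝ) → ℝ, Integrable g volume →
      ∃ S : Set (Set (Fin d → ℝ)), IsSparse (1 / 2) S ∧
        (∫⁻ x, ‖T f x‖ₑ ^ q.toReal * ‖g x‖ₑ) ^ (1 / q.toReal) ≤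
          K * (∑' Q : S, cubeAvg r f Q ^ q.toReal * cubeAvg (ENNReal.conjExponent (s / q)) g Q *
            volume (Q : Set (Fin d → ℝ))) ^ (1 / q.toReal)

/-- The quantity `‖h w_{r,s}^{-1/s}‖_{L^{r,∞}(w_{r,s})}`. -/
def endpointWeakNorm (r s : ℝ≥0∞) (w : (Fin d → ℝ) → ℝ) (h : (Fin d → ℝ) → 𝕜) : ℝ≥0∞ :=
  weakLpNorm (fun x => rescaledWeight r s w x ^ (-(s⁻¹).toReal) • h x) r
    (weightMeasure (rescaledWeight r s w))

/-- The dependence on the weight: `[w]_{r,(r,s)} [w_{r,s}]_FW^{1/q-1/r} (1 + log [w_{r,s}]_FW)^{1/r}`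
if `q ≤ r`, and `[w]_{r,(r,s)}` if `q > r`. -/
def weightFactor (r s q : ℝ≥0∞) (w : (Fin d → ℝ) → ℝ) : ℝ≥0∞ :=
  if q ≤ r then
    limitedRangeConst r r s w *
      fujiiWilsonConst (rescaledWeight r s w) ^ (1 / q.toReal - 1 / r.toReal) *
      ENNReal.ofReal (1 + Real.log (fujiiWilsonConst (rescaledWeight r s w)).toReal) ^
        (1 / r.toReal)
  else limitedRangeConst r r s w

end

/-!
Write `v = w_{r,s}`, `γ = 1 - r / s` and `κ = q / r`. The limited-range condition says that `v` is
an `A_1` weight, in the form `(v(Q) / |Q|) ^ γ ≤ [w] ^ r w ^ r` a.e. on `Q`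
(`LimitedRangeWeight.ae_average_rpow_le`).

*Reduction to the sparse form.* Let `E` be a bounded part of `{|T f| v ^ (-1/s) > t}`. Testing the
sparse domination on `v ^ (1 - q/s)` times the indicator of a set `E' ⊆ E` bounds `t ^ q v(E')` by a
sum over the sparse collection whose terms are
`β_Q ^ κ (v(E' ∩ Q) / v(Q)) ^ (1 - q/s) v(Q)`, where `β_Q = (⟨f⟩_{r,Q} ⟨v⟩_{1,Q} ^ (-1/s)) ^ r` is
the `mixedDensity`. Since `β_Q v(Q) ≤ [w] ^ r ∫_Q |f w| ^ r`, the cubes with `β_Q > L` cover a set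
of `v`-measure at most `3 ^ d L⁻¹ ([w] ‖f‖_{L ^ r_w}) ^ r`; for `L` a large multiple of
`([w] ‖f‖) ^ r / v(E)` this is at most half of `v(E)`, and `E'` is what it leaves of `E`. All cubes
that contribute then satisfy `β_Q ≤ L`.

*One level.* Among the cubes with `β_Q` about `2 ^ (-k) L` there are two estimates. The sum of
`β_Q v(Q)` is at most a constant times `([w] ‖f‖) ^ r`, with no dependence on the Fujii-Wilson
constant: by Hölder's inequality and sparseness for Lebesgue measure the cubes a fixed number of
generations below `Q` carry at most half of `∫_Q |f| ^ r`, so that the integral may be restricted to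
sets of bounded overlap (`DyadicFamily.sum_mixedDensity_mul_le`). On the other hand a sparse
collection satisfies the Carleson condition for `v dx` with constant `2 [v]_FW`, so the sum of
`(v(E' ∩ Q) / v(Q)) ^ p v(Q)` is at most a constant times `[v]_FW v(E')` for every `p > 1`
(`DyadicFamily.sum_rpow_mul_le`). Interpolating gives, up to constants and the common factor
`L ^ κ v(E)`, both `2 ^ (k (1 - κ))` and `[v]_FW ^ t 2 ^ (k (1 - κ - t))` as bounds for the level,
with a `t > 1 - κ` (`DyadicFamily.sum_level_le`).

*Summation.* The smaller of the two bounds is summable in `k`, with sum of order `1` for `κ > 1`,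
`[v]_FW ^ (1 - κ)` for `κ < 1` and `1 + log [v]_FW` for `κ = 1`
(`exists_tsum_min_le_packingFactor`); taking `q`-th roots gives the estimate for bounded functions
with compact support (`exists_endpointWeakNorm_le`).

*Extension.* If `u_n → f` in `L ^ r_w` at a geometric rate, the weak-type estimate and the
Borel-Cantelli lemma show that `T u_n` converges a.e., to a limit which does not depend on the
sequence (`exists_isExtensionValue`). The inequality `|T f - T g| ≤ |T (f - g)|` and the weak-type
estimate pass to the limit.
-/

/-! ### Nested families and the Carleson condition -/

/-- Hölder's inequality for the sum of geometric means. -/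
theorem sum_rpow_mul_rpow_le {ι : Type*} (s : Finset ι) (f g : ι → ℝ≥0∞) {γ : ℝ}
    (h0 : 0 < γ) (h1 : γ ≤ 1) :
    ∑ i ∈ s, f i ^ γ * g i ^ (1 - γ) ≤ (∑ i ∈ s, f i) ^ γ * (∑ i ∈ s, g i) ^ (1 - γ) := by
  rcases h1.eq_or_lt with rfl | h1
  · simp
  have hpq : (1 / γ).HolderConjugate (1 / (1 - γ)) := by
    rw [Real.holderConjugate_iff]
    refine ⟨by rw [lt_div_iff₀ h0]; linarith, by simp⟩
  have h := ENNReal.inner_le_Lp_mul_Lq s (fun i => f i ^ γ) (fun i => g i ^ (1 - γ)) hpq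
  have h2 : 1 - γ ≠ 0 := by linarith
  simpa only [← ENNReal.rpow_mul, mul_one_div_cancel h0.ne', mul_one_div_cancel h2,
    ENNReal.rpow_one, one_div_one_div] using h

section Nested

variable {Ω : Type*}

/-- A family of sets any two of which are either disjoint or contained one in the other. -/
def NestedFamily (D : Set (Set Ω)) : Prop :=
  ∀ Q ∈ D, ∀ R ∈ D, Q ⊆ R ∨ R ⊆ Q ∨ Disjoint Q R

theorem NestedFamily.mono {D D' : Set (Set Ω)} (h : NestedFamily D) (hD : D' ⊆ D) :
    NestedFamily D' := fun Q hQ R hR => h Q (hD hQ) R (hD hR)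

/-- The maximal members of a finite nested family are disjoint and cover all the others. -/
theorem NestedFamily.exists_maximal_subfamily {F : Finset (Set Ω)}
    (h : NestedFamily (F : Set (Set Ω))) :
    ∃ P ⊆ F, (P : Set (Set Ω)).PairwiseDisjoint id ∧ ∀ Q ∈ F, ∃ R ∈ P, Q ⊆ R := by
  classical
  refine ⟨F.filter (fun Q => Maximal (· ∈ F) Q), Finset.filter_subset _ _, ?_, fun Q hQ => ?_⟩
  · intro Q hQ R hR hne
    simp only [Finset.coe_filter, Set.mem_ofPred_eq] at hQ hR
    rcases h Q hQ.1 R hR.1 with h | h | h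
    · exact absurd (hQ.2.eq_of_le hR.1 h) hne
    · exact absurd (hR.2.eq_of_le hQ.1 h).symm hne
    · exact h
  · obtain ⟨R, hQR, hR⟩ := F.exists_le_maximal hQ
    exact ⟨R, by simp [hR.prop, hR], hQR⟩

variable [MeasurableSpace Ω]

theorem sum_measure_le_of_pairwiseDisjoint {P : Finset (Set Ω)} (τ : Measure Ω)
    (hd : (P : Set (Set Ω)).PairwiseDisjoint id) (hm : ∀ Q ∈ P, MeasurableSet Q) {R : Set Ω}
    (hR : ∀ Q ∈ P, Q ⊆ R) : ∑ Q ∈ P, τ Q ≤ τ R := by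
  have := measure_biUnion_finset (μ := τ) (f := id) hd hm
  simp only [id] at this
  rw [← this]
  exact measure_mono (Set.iUnion₂_subset hR)

/-- Weak-type estimate for the maximal function of a finite nested family. -/
theorem NestedFamily.mul_measure_sUnion_le {F : Finset (Set Ω)}
    (h : NestedFamily (F : Set (Set Ω))) (hm : ∀ Q ∈ F, MeasurableSet Q) {ν τ : Measure Ω}
    {t : ℝ≥0∞} (ht : ∀ Q ∈ F, t * ν Q ≤ τ Q) :
    t * ν (⋃ Q ∈ F, Q) ≤ τ Set.univ := by
  obtain ⟨P, hPF, hd, hc⟩ := h.exists_maximal_subfamily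
  calc t * ν (⋃ Q ∈ F, Q) ≤ t * ∑ Q ∈ P, ν Q := by
        gcongr
        refine (measure_mono ?_).trans (measure_biUnion_finset_le P id)
        refine Set.iUnion₂_subset fun Q hQ => ?_
        obtain ⟨R, hR, hQR⟩ := hc Q hQ
        exact hQR.trans (Set.subset_biUnion_of_mem (u := id) hR)
    _ ≤ ∑ Q ∈ P, τ Q := by
        rw [Finset.mul_sum]
        exact Finset.sum_le_sum fun Q hQ => ht Q (hPF hQ)
    _ ≤ τ Set.univ := sum_measure_le_of_pairwiseDisjoint τ hd (fun Q hQ => hm Q (hPF hQ))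
        fun Q _ => Set.subset_univ Q

/-- Weak-type estimate for the maximal function of a countable nested family. -/
theorem NestedFamily.mul_measure_sUnion_le_of_countable {D : Set (Set Ω)}
    (h : NestedFamily D) (hD : D.Countable) (hm : ∀ Q ∈ D, MeasurableSet Q) {ν τ : Measure Ω}
    {t : ℝ≥0∞} (ht : ∀ Q ∈ D, t * ν Q ≤ τ Q) :
    t * ν (⋃ Q ∈ D, Q) ≤ τ Set.univ := by
  classical
  have : Countable D := hD.to_subtype
  have key : ν (⋃ Q ∈ D, Q) = ⨆ F : Finset D, ν (⋃ Q ∈ F, (Q : Set Ω)) := by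
    rw [← Directed.measure_iUnion]
    · congr 1
      ext x
      simp only [Set.mem_iUnion]
      constructor
      · rintro ⟨Q, hQ, hx⟩
        exact ⟨{⟨Q, hQ⟩}, ⟨Q, hQ⟩, by simp, hx⟩
      · rintro ⟨F, Q, -, hx⟩
        exact ⟨Q, Q.2, hx⟩
    · refine Monotone.directed_le fun F G hFG => ?_
      exact Set.biUnion_subset_biUnion_left hFG
  rw [key, ENNReal.mul_iSup]
  refine iSup_le fun F => ?_
  have h' : NestedFamily ((F.image Subtype.val : Finset (Set Ω)) : Set (Set Ω)) :=
    h.mono (by intro Q hQ; simp at hQ; exact hQ.1)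
  have := h'.mul_measure_sUnion_le (ν := ν) (τ := τ) (t := t)
    (fun Q hQ => by simp at hQ; exact hm Q hQ.1) (fun Q hQ => by simp at hQ; exact ht Q hQ.1)
  simpa [Finset.set_biUnion_finset_image] using this

/-- The Carleson packing condition with constant `H`: the members of the family inside a given
member `R` have total measure at most `H * ν R`. -/
def IsCarleson (ν : Measure Ω) (H : ℝ≥0∞) (D : Set (Set Ω)) : Prop :=
  ∀ R ∈ D, ∀ G : Finset (Set Ω), (∀ Q ∈ G, Q ∈ D ∧ Q ⊆ R) → ∑ Q ∈ G, ν Q ≤ H * ν R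

theorem IsCarleson.mono {ν : Measure Ω} {H : ℝ≥0∞} {D D' : Set (Set Ω)} (h : IsCarleson ν H D)
    (hD : D' ⊆ D) : IsCarleson ν H D' :=
  fun R hR G hG => h R (hD hR) G fun Q hQ => ⟨hD (hG Q hQ).1, (hG Q hQ).2⟩

/-- For a Carleson family the weak-type estimate holds for the sum of the measures of its
members, not only for the measure of their union. -/
theorem NestedFamily.mul_sum_measure_le {F : Finset (Set Ω)}
    (h : NestedFamily (F : Set (Set Ω))) (hm : ∀ Q ∈ F, MeasurableSet Q) {ν τ : Measure Ω}
    {t H : ℝ≥0∞} (ht : ∀ Q ∈ F, t * ν Q ≤ τ Q) (hH : IsCarleson ν H (F : Set (Set Ω))) :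
    t * ∑ Q ∈ F, ν Q ≤ H * τ Set.univ := by
  classical
  obtain ⟨P, hPF, hd, hc⟩ := h.exists_maximal_subfamily
  choose! c hcP hc using hc
  calc t * ∑ Q ∈ F, ν Q = t * ∑ R ∈ P, ∑ Q ∈ F with c Q = R, ν Q := by
        rw [Finset.sum_fiberwise_of_maps_to hcP]
    _ ≤ t * ∑ R ∈ P, H * ν R := by
        gcongr with R hR
        refine hH R (hPF hR) _ fun Q hQ => ?_
        obtain ⟨hQF, rfl⟩ := Finset.mem_filter.1 hQ
        exact ⟨hQF, hc Q hQF⟩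
    _ = H * ∑ R ∈ P, t * ν R := by
        rw [Finset.mul_sum, Finset.mul_sum]
        exact Finset.sum_congr rfl fun R _ => by ring
    _ ≤ H * ∑ R ∈ P, τ R := by
        gcongr with R hR
        exact ht R (hPF hR)
    _ ≤ H * τ Set.univ := by
        gcongr
        exact sum_measure_le_of_pairwiseDisjoint τ hd (fun Q hQ => hm Q (hPF hQ))
          fun Q _ => Set.subset_univ Q

end Nested

/-! ### Generations of a finite nested family -/

section Depth

variable {Ω : Type*}

open scoped Classical in
/-- The depth of `Q` in a finite family: the number of members containing `Q`. -/
noncomputable def depth (G : Finset (Set Ω)) (Q : Set Ω) : ℕ :=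
  (G.filter (Q ⊆ ·)).card

theorem depth_lt_depth {G : Finset (Set Ω)} {Q R : Set Ω} (hQ : Q ∈ G) (h : Q ⊂ R) :
    depth G R < depth G Q := by
  classical
  refine Finset.card_lt_card (Finset.ssubset_iff_of_subset ?_ |>.2 ⟨Q, ?_, ?_⟩)
  · intro S hS
    simp only [Finset.mem_filter] at hS ⊢
    exact ⟨hS.1, h.subset.trans hS.2⟩
  · simp [hQ]
  · simp only [Finset.mem_filter, not_and]
    exact fun _ h' => h.not_subset h'

theorem NestedFamily.subset_or_subset_of_mem {D : Set (Set Ω)} (h : NestedFamily D) {Q R : Set Ω}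
    (hQ : Q ∈ D) (hR : R ∈ D) {x : Ω} (hxQ : x ∈ Q) (hxR : x ∈ R) : Q ⊆ R ∨ R ⊆ Q := by
  rcases h Q hQ R hR with h | h | h
  · exact Or.inl h
  · exact Or.inr h
  · exact absurd hxR (Set.disjoint_left.1 h hxQ)

theorem NestedFamily.eq_of_depth_eq {G : Finset (Set Ω)} (h : NestedFamily (G : Set (Set Ω)))
    {Q R : Set Ω} (hQ : Q ∈ G) (hR : R ∈ G) {x : Ω} (hxQ : x ∈ Q) (hxR : x ∈ R)
    (hd : depth G Q = depth G R) : Q = R := by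
  by_contra hne
  rcases h.subset_or_subset_of_mem hQ hR hxQ hxR with h | h
  · exact (depth_lt_depth hQ (h.ssubset_of_ne hne)).ne' hd
  · exact (depth_lt_depth hR (h.ssubset_of_ne (Ne.symm hne))).ne hd

open scoped Classical in
/-- The members of `G` lying `n` generations below `Q`. -/
noncomputable def descendants (G : Finset (Set Ω)) (n : ℕ) (Q : Set Ω) : Finset (Set Ω) :=
  G.filter fun R => R ⊆ Q ∧ depth G R = depth G Q + n

theorem mem_descendants {G : Finset (Set Ω)} {n : ℕ} {Q R : Set Ω} :
    R ∈ descendants G n Q ↔ R ∈ G ∧ R ⊆ Q ∧ depth G R = depth G Q + n := by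
  classical
  simp [descendants]

theorem NestedFamily.pairwiseDisjoint_descendants {G : Finset (Set Ω)}
    (h : NestedFamily (G : Set (Set Ω))) (n : ℕ) (Q : Set Ω) :
    (descendants G n Q : Set (Set Ω)).PairwiseDisjoint id := by
  intro R hR S hS hne
  simp only [Finset.mem_coe, mem_descendants] at hR hS
  refine Set.disjoint_left.2 fun x hxR hxS => hne ?_
  exact h.eq_of_depth_eq hR.1 hS.1 hxR hxS (hR.2.2.trans hS.2.2.symm)

open scoped Classical in
/-- At every point, at most `n` members `Q` of a finite nested family contain the point in the
part of `Q` left uncovered by the `n`-th generation below `Q`. -/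
theorem NestedFamily.card_filter_mem_le {G : Finset (Set Ω)}
    (h : NestedFamily (G : Set (Set Ω))) (n : ℕ) (x : Ω) :
    (G.filter fun Q => x ∈ Q \ ⋃ R ∈ descendants G n Q, R).card ≤ n := by
  set C := G.filter (x ∈ ·) with hC
  have hmap : ∀ Q ∈ C, depth G Q ∈ Finset.Icc 1 C.card := by
    intro Q hQ
    simp only [hC, Finset.mem_filter] at hQ
    refine Finset.mem_Icc.2 ⟨Finset.card_pos.2 ⟨Q, by simp [hQ.1]⟩, Finset.card_le_card ?_⟩
    intro R hR
    simp only [hC, Finset.mem_filter] at hR ⊢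
    exact ⟨hR.1, hR.2 hQ.2⟩
  have hinj : Set.InjOn (depth G) (C : Set (Set Ω)) := by
    intro Q hQ R hR hd
    simp only [hC, Finset.coe_filter, Set.mem_ofPred_eq] at hQ hR
    exact h.eq_of_depth_eq hQ.1 hR.1 hQ.2 hR.2 hd
  have himg : C.image (depth G) = Finset.Icc 1 C.card := by
    refine Finset.eq_of_subset_of_card_le ?_ ?_
    · intro m hm
      obtain ⟨Q, hQ, rfl⟩ := Finset.mem_image.1 hm
      exact hmap Q hQ
    · rw [Finset.card_image_of_injOn hinj, Nat.card_Icc]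
      omega
  set B := G.filter fun Q => x ∈ Q \ ⋃ R ∈ descendants G n Q, R with hB
  have hBC : B ⊆ C := by
    intro Q hQ
    simp only [hB, hC, Finset.mem_filter] at hQ ⊢
    exact ⟨hQ.1, hQ.2.1⟩
  have hBmap : ∀ Q ∈ B, depth G Q ∈ Finset.Ioc (C.card - n) C.card := by
    intro Q hQ
    have h1 := Finset.mem_Icc.1 (hmap Q (hBC hQ))
    refine Finset.mem_Ioc.2 ⟨?_, h1.2⟩
    by_contra hlt
    have hmem : depth G Q + n ∈ C.image (depth G) := by
      rw [himg, Finset.mem_Icc]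
      omega
    obtain ⟨R, hR, hRd⟩ := Finset.mem_image.1 hmem
    simp only [hB, Finset.mem_filter] at hQ
    simp only [hC, Finset.mem_filter] at hR
    refine hQ.2.2 (Set.mem_biUnion (x := R) ?_ hR.2)
    refine mem_descendants.2 ⟨hR.1, ?_, hRd⟩
    rcases h.subset_or_subset_of_mem hR.1 hQ.1 hR.2 hQ.2.1 with h' | h'
    · exact h'
    · rcases h'.eq_or_ssubset with h' | h'
      · exact h'.symm.subset
      · have := depth_lt_depth hQ.1 h'
        omega
  calc B.card ≤ (Finset.Ioc (C.card - n) C.card).card :=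
        Finset.card_le_card_of_injOn _ hBmap (hinj.mono (by exact_mod_cast hBC))
    _ ≤ n := by rw [Nat.card_Ioc]; omega

/-- The `n`-th generation below `Q` carries at most `1 / n` of the total mass inside `Q`, since
each of its members lies in at least `n` members of the family contained in `Q`. -/
theorem NestedFamily.mul_sum_descendants_le [MeasurableSpace Ω] {G : Finset (Set Ω)}
    (h : NestedFamily (G : Set (Set Ω))) (hne : ∀ Q ∈ G, Q.Nonempty)
    (hm : ∀ Q ∈ G, MeasurableSet Q) {μ : Measure Ω} {H : ℝ≥0∞}
    (hH : IsCarleson μ H (G : Set (Set Ω))) (n : ℕ) {Q : Set Ω} (hQ : Q ∈ G) :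
    n * ∑ R ∈ descendants G n Q, μ R ≤ H * μ Q := by
  classical
  have hcount : ∀ R ∈ descendants G n Q,
      n ≤ (G.filter fun S => R ⊆ S ∧ S ⊆ Q).card := by
    intro R hR
    rw [mem_descendants] at hR
    obtain ⟨x, hx⟩ := hne R hR.1
    have hsub : G.filter (R ⊆ ·) ⊆ (G.filter fun S => R ⊆ S ∧ S ⊆ Q) ∪ G.filter (Q ⊆ ·) := by
      intro S hS
      simp only [Finset.mem_union, Finset.mem_filter] at hS ⊢
      rcases h.subset_or_subset_of_mem hS.1 hQ (hS.2 hx) (hR.2.1 hx) with h' | h'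
      · exact Or.inl ⟨hS.1, hS.2, h'⟩
      · exact Or.inr ⟨hS.1, h'⟩
    have h1 := (Finset.card_le_card hsub).trans (Finset.card_union_le _ _)
    have h2 := hR.2.2
    simp only [depth] at h2
    omega
  calc (n : ℝ≥0∞) * ∑ R ∈ descendants G n Q, μ R
      ≤ ∑ R ∈ descendants G n Q, ∑ S ∈ G with R ⊆ S ∧ S ⊆ Q, μ R := by
        rw [Finset.mul_sum]
        refine Finset.sum_le_sum fun R hR => ?_
        rw [Finset.sum_const, nsmul_eq_mul]
        gcongr
        exact hcount R hR
    _ = ∑ S ∈ G with S ⊆ Q, ∑ R ∈ descendants G n Q with R ⊆ S, μ R := by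
        refine Finset.sum_comm' fun R S => ?_
        simp only [Finset.mem_filter]
        tauto
    _ ≤ ∑ S ∈ G with S ⊆ Q, μ S := by
        refine Finset.sum_le_sum fun S _ => ?_
        refine sum_measure_le_of_pairwiseDisjoint μ
          ((h.pairwiseDisjoint_descendants n Q).subset ?_) (fun R hR => ?_) (fun R hR => ?_)
        · exact_mod_cast Finset.filter_subset _ _
        · exact hm R (mem_descendants.1 (Finset.mem_filter.1 hR).1).1
        · exact (Finset.mem_filter.1 hR).2
    _ ≤ H * μ Q := hH Q hQ _ fun S hS => by simpa using hS

end Depth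

/-! ### The mixed density and its packing estimate -/

section Density

variable {Ω : Type*} [MeasurableSpace Ω]

/-- A nested family of measurable sets on which both `μ` and `ν` are positive and finite. -/
structure DyadicFamily (μ ν : Measure Ω) (D : Set (Set Ω)) : Prop where
  nested : NestedFamily D
  measurableSet : ∀ Q ∈ D, MeasurableSet Q
  left_ne_zero : ∀ Q ∈ D, μ Q ≠ 0
  left_ne_top : ∀ Q ∈ D, μ Q ≠ ∞
  right_ne_zero : ∀ Q ∈ D, ν Q ≠ 0
  right_ne_top : ∀ Q ∈ D, ν Q ≠ ∞

theorem DyadicFamily.mono {μ ν : Measure Ω} {D D' : Set (Set Ω)} (h : DyadicFamily μ ν D)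
    (hD : D' ⊆ D) : DyadicFamily μ ν D' where
  nested := h.nested.mono hD
  measurableSet Q hQ := h.measurableSet Q (hD hQ)
  left_ne_zero Q hQ := h.left_ne_zero Q (hD hQ)
  left_ne_top Q hQ := h.left_ne_top Q (hD hQ)
  right_ne_zero Q hQ := h.right_ne_zero Q (hD hQ)
  right_ne_top Q hQ := h.right_ne_top Q (hD hQ)

theorem DyadicFamily.nonempty {μ ν : Measure Ω} {D : Set (Set Ω)} (h : DyadicFamily μ ν D)
    {Q : Set Ω} (hQ : Q ∈ D) : Q.Nonempty :=
  nonempty_of_measure_ne_zero (h.left_ne_zero Q hQ)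

/-- The density of `Φ` on `Q` with respect to the geometric mean `μ ^ γ ν ^ (1 - γ)`. For
`Φ = |f| ^ r dx`, `ν = v dx` and `γ = 1 - r / s` it is the `r`-th power of
`⟨f⟩_{r,Q} ⟨v⟩_{1,Q} ^ (-1/s)`. -/
noncomputable def mixedDensity (μ ν Φ : Measure Ω) (γ : ℝ) (Q : Set Ω) : ℝ≥0∞ :=
  Φ Q * μ Q ^ (-γ) * ν Q ^ (γ - 1)

variable {μ ν Φ Ψ : Measure Ω} {γ : ℝ}

theorem mixedDensity_mul_rpow {Q : Set Ω} (h1 : μ Q ≠ 0) (h2 : μ Q ≠ ∞) (h3 : ν Q ≠ 0)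
    (h4 : ν Q ≠ ∞) : mixedDensity μ ν Φ γ Q * (μ Q ^ γ * ν Q ^ (1 - γ)) = Φ Q := by
  have e1 : μ Q ^ (-γ) * μ Q ^ γ = 1 := by
    rw [← ENNReal.rpow_add _ _ h1 h2]; simp
  have e2 : ν Q ^ (γ - 1) * ν Q ^ (1 - γ) = 1 := by
    rw [← ENNReal.rpow_add _ _ h3 h4]; simp
  calc _ = Φ Q * (μ Q ^ (-γ) * μ Q ^ γ) * (ν Q ^ (γ - 1) * ν Q ^ (1 - γ)) := by
        rw [mixedDensity]; ring
    _ = Φ Q := by rw [e1, e2]; simp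

theorem mixedDensity_mul_right {Q : Set Ω} (h0 : 0 ≤ γ) (h3 : ν Q ≠ 0) (h4 : ν Q ≠ ∞) :
    mixedDensity μ ν Φ γ Q * ν Q = (ν Q / μ Q) ^ γ * Φ Q := by
  have e2 : ν Q ^ (γ - 1) * ν Q = ν Q ^ γ := by
    conv_lhs => rw [← ENNReal.rpow_one (ν Q)]
    rw [← ENNReal.rpow_mul, one_mul, ← ENNReal.rpow_add _ _ h3 h4]; simp
  rw [ENNReal.div_rpow_of_nonneg _ _ h0, mixedDensity, mul_assoc, e2, ENNReal.rpow_neg,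
    div_eq_mul_inv]
  ring

/-- The packing estimate for a family on which the mixed density is constant up to a factor `2`.
By Hölder's inequality and the Carleson condition for `μ`, the `n`-th generation below `Q` carries
at most half of `Φ Q` once `n` is large, and the sets that remain have overlap at most `n`; no
packing condition on `ν` is needed. -/
theorem DyadicFamily.sum_mixedDensity_mul_le {G : Finset (Set Ω)}
    (h : DyadicFamily μ ν (G : Set (Set Ω))) (h0 : 0 < γ) (h1 : γ ≤ 1)
    (hΦ : ∀ Q ∈ G, Φ Q ≠ ∞) (hC : IsCarleson μ 2 (G : Set (Set Ω)))
    (hΨ : ∀ Q ∈ G, ∀ E ⊆ Q, MeasurableSet E → (ν Q / μ Q) ^ γ * Φ E ≤ Ψ E)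
    (hG : ∀ Q ∈ G, ∀ R ∈ G, mixedDensity μ ν Φ γ R ≤ 2 * mixedDensity μ ν Φ γ Q)
    {n : ℕ} (hn : 2 * (2 / n : ℝ≥0∞) ^ γ ≤ 2⁻¹) :
    ∑ Q ∈ G, mixedDensity μ ν Φ γ Q * ν Q ≤ 2 * n * Ψ Set.univ := by
  classical
  have hn0 : n ≠ 0 := by
    rintro rfl
    simp [ENNReal.div_zero, ENNReal.top_rpow_of_pos h0] at hn
  set U : Set Ω → Set Ω := fun Q => ⋃ R ∈ descendants G n Q, R with hU
  have hdesc : ∀ Q, ∀ R ∈ descendants G n Q, R ∈ G := fun Q R hR => (mem_descendants.1 hR).1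
  have hUm : ∀ Q, MeasurableSet (U Q) := fun Q =>
    Finset.measurableSet_biUnion _ fun R hR => h.measurableSet R (hdesc Q R hR)
  have half : ∀ Q ∈ G, Φ Q ≤ 2 * Φ (Q \ U Q) := by
    intro Q hQ
    have hμ : ∑ R ∈ descendants G n Q, μ R ≤ 2 / n * μ Q := by
      have := h.nested.mul_sum_descendants_le (fun Q hQ => h.nonempty hQ) h.measurableSet hC n hQ
      rw [← ENNReal.mul_div_right_comm, ENNReal.le_div_iff_mul_le (by simp [hn0]) (by simp)]
      rwa [mul_comm]
    have hν : ∑ R ∈ descendants G n Q, ν R ≤ ν Q :=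
      sum_measure_le_of_pairwiseDisjoint ν (h.nested.pairwiseDisjoint_descendants n Q)
        (fun R hR => h.measurableSet R (hdesc Q R hR)) fun R hR => (mem_descendants.1 hR).2.1
    have key : Φ (U Q) ≤ 2⁻¹ * Φ Q := by
      calc Φ (U Q) ≤ ∑ R ∈ descendants G n Q, Φ R := measure_biUnion_finset_le _ _
        _ ≤ ∑ R ∈ descendants G n Q,
            2 * mixedDensity μ ν Φ γ Q * (μ R ^ γ * ν R ^ (1 - γ)) := by
            refine Finset.sum_le_sum fun R hR => ?_
            have hR' := hdesc Q R hR
            rw [← mixedDensity_mul_rpow (Φ := Φ) (γ := γ) (h.left_ne_zero R hR')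
              (h.left_ne_top R hR') (h.right_ne_zero R hR') (h.right_ne_top R hR')]
            gcongr
            exact hG Q hQ R hR'
        _ ≤ 2 * mixedDensity μ ν Φ γ Q * ((2 / n * μ Q) ^ γ * ν Q ^ (1 - γ)) := by
            rw [← Finset.mul_sum]
            gcongr
            refine (sum_rpow_mul_rpow_le _ _ _ h0 h1).trans ?_
            gcongr
        _ = 2 * (2 / n) ^ γ * (mixedDensity μ ν Φ γ Q * (μ Q ^ γ * ν Q ^ (1 - γ))) := by
            rw [ENNReal.mul_rpow_of_nonneg _ _ h0.le]
            ring
        _ ≤ 2⁻¹ * Φ Q := by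
            rw [mixedDensity_mul_rpow (h.left_ne_zero Q hQ) (h.left_ne_top Q hQ)
              (h.right_ne_zero Q hQ) (h.right_ne_top Q hQ)]
            gcongr
    have hsplit : Φ Q ≤ Φ (Q \ U Q) + 2⁻¹ * Φ Q := by
      calc Φ Q ≤ Φ (Q \ U Q ∪ U Q) := measure_mono (by simp)
        _ ≤ Φ (Q \ U Q) + Φ (U Q) := measure_union_le _ _
        _ ≤ _ := by gcongr
    have hfin : 2⁻¹ * Φ Q ≠ ∞ := ENNReal.mul_ne_top (by simp) (hΦ Q hQ)
    have e : Φ Q = 2⁻¹ * Φ Q + 2⁻¹ * Φ Q := by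
      rw [← add_mul, ENNReal.inv_two_add_inv_two, one_mul]
    have : 2⁻¹ * Φ Q ≤ Φ (Q \ U Q) := by
      rw [e] at hsplit
      have : 2⁻¹ * (2⁻¹ * Φ Q + 2⁻¹ * Φ Q) = 2⁻¹ * Φ Q := by rw [← e]
      rw [this] at hsplit
      exact (ENNReal.add_le_add_iff_right hfin).1 hsplit
    calc Φ Q = 2 * (2⁻¹ * Φ Q) := by
          rw [← mul_assoc, ENNReal.mul_inv_cancel (by simp) (by simp), one_mul]
      _ ≤ _ := by gcongr
  calc ∑ Q ∈ G, mixedDensity μ ν Φ γ Q * ν Q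
      ≤ ∑ Q ∈ G, 2 * Ψ (Q \ U Q) := by
        refine Finset.sum_le_sum fun Q hQ => ?_
        rw [mixedDensity_mul_right h0.le (h.right_ne_zero Q hQ) (h.right_ne_top Q hQ)]
        calc (ν Q / μ Q) ^ γ * Φ Q ≤ (ν Q / μ Q) ^ γ * (2 * Φ (Q \ U Q)) := by
              gcongr; exact half Q hQ
          _ = 2 * ((ν Q / μ Q) ^ γ * Φ (Q \ U Q)) := by ring
          _ ≤ _ := by
              gcongr
              exact hΨ Q hQ _ Set.sdiff_subset ((h.measurableSet Q hQ).diff (hUm Q))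
    _ = 2 * ∫⁻ x, ∑ Q ∈ G, (Q \ U Q).indicator 1 x ∂Ψ := by
        rw [← Finset.mul_sum, lintegral_finsetSum']
        · congr 1
          refine Finset.sum_congr rfl fun Q hQ => ?_
          rw [lintegral_indicator_one ((h.measurableSet Q hQ).diff (hUm Q))]
        · intro Q hQ
          exact (measurable_one.indicator ((h.measurableSet Q hQ).diff (hUm Q))).aemeasurable
    _ ≤ 2 * ∫⁻ _, n ∂Ψ := by
        gcongr with x
        have := h.nested.card_filter_mem_le n x
        simp only [Set.indicator_apply, Pi.one_apply]
        rw [Finset.sum_boole]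
        exact_mod_cast this
    _ = 2 * n * Ψ Set.univ := by rw [lintegral_const, mul_assoc]

end Density

/-! ### Sums over levels and the Carleson embedding -/

theorem exists_pow_lt_le {a : ℝ≥0∞} (h0 : a ≠ 0) (h1 : a ≤ 1) :
    ∃ i : ℕ, (2⁻¹ : ℝ≥0∞) ^ (i + 1) < a ∧ a ≤ 2⁻¹ ^ i := by
  have htop : a ≠ ∞ := ne_top_of_le_ne_top (by simp) h1
  lift a to ℝ≥0 using htop
  have h0' : (0 : ℝ) < a := by
    have : a ≠ 0 := by exact_mod_cast h0
    positivity
  obtain ⟨n, h2, h3⟩ := exists_nat_pow_near_of_lt_one (x := (a : ℝ)) (y := 2⁻¹) h0'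
    (by exact_mod_cast h1) (by norm_num) (by norm_num)
  have e : (2⁻¹ : ℝ≥0∞) = ((2⁻¹ : ℝ≥0) : ℝ≥0∞) := by simp
  refine ⟨n, ?_, ?_⟩
  · rw [e]; exact_mod_cast h2
  · rw [e]; exact_mod_cast h3

theorem tsum_pow_ne_top {x : ℝ≥0∞} (hx : x < 1) : ∑' k : ℕ, x ^ k ≠ ∞ := by
  rw [ENNReal.tsum_geometric, ENNReal.inv_ne_top]
  exact (tsub_pos_of_lt hx).ne'

theorem two_rpow_neg_lt_one {e : ℝ} (he : 0 < e) : (2 : ℝ≥0∞) ^ (-e) < 1 :=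
  ENNReal.rpow_lt_one_of_one_lt_of_neg (by norm_num) (by linarith)

theorem two_rpow_natCast_mul (k : ℕ) (e : ℝ) : (2 : ℝ≥0∞) ^ (k * e) = (2 ^ e) ^ k := by
  rw [mul_comm, ENNReal.rpow_mul, ENNReal.rpow_natCast]

/-- A growing geometric sum is bounded by its last term. -/
theorem sum_pow_le_mul_tsum {x : ℝ≥0∞} (h0 : x ≠ 0) (ht : x ≠ ∞) (K : ℕ) :
    ∑ k ∈ Finset.range (K + 1), x ^ k ≤ x ^ K * ∑' k : ℕ, x⁻¹ ^ k := by
  calc ∑ k ∈ Finset.range (K + 1), x ^ k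
      = ∑ k ∈ Finset.range (K + 1), x ^ K * x⁻¹ ^ (K - k) := by
        refine Finset.sum_congr rfl fun k hk => ?_
        have hk : k ≤ K := by simpa [Nat.lt_succ_iff] using hk
        have : x ^ K = x ^ k * x ^ (K - k) := by rw [← pow_add]; congr 1; omega
        rw [this, mul_assoc, ← mul_pow, ENNReal.mul_inv_cancel h0 ht, one_pow, mul_one]
    _ = x ^ K * ∑ k ∈ Finset.range (K + 1), x⁻¹ ^ k := by
        rw [← Finset.mul_sum, Finset.sum_flip (fun k => x⁻¹ ^ k)]
    _ ≤ _ := by gcongr; exact ENNReal.sum_le_tsum _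

/-- The factor `H ^ (1 - κ) (1 + log H) ^ κ` for `κ ≤ 1`, and `1` for `κ > 1`. -/
noncomputable def packingFactor (κ : ℝ) (H : ℝ≥0∞) : ℝ≥0∞ :=
  if κ ≤ 1 then H ^ (1 - κ) * ENNReal.ofReal (1 + Real.log H.toReal) ^ κ else 1

theorem one_le_ofReal_one_add_log {H : ℝ≥0∞} (h1 : 1 ≤ H) (ht : H ≠ ∞) :
    1 ≤ ENNReal.ofReal (1 + Real.log H.toReal) := by
  have : 0 ≤ Real.log H.toReal := Real.log_nonneg (by
    rw [← ENNReal.toReal_one]; exact ENNReal.toReal_mono ht h1)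
  rw [ENNReal.one_le_ofReal]
  linarith

theorem rpow_le_packingFactor {κ : ℝ} (hκ : 0 < κ) (h1 : κ ≤ 1) {H : ℝ≥0∞} (hH : 1 ≤ H)
    (hHt : H ≠ ∞) : H ^ (1 - κ) ≤ packingFactor κ H := by
  rw [packingFactor, if_pos h1]
  exact le_mul_of_one_le_right' (ENNReal.one_le_rpow (one_le_ofReal_one_add_log hH hHt) hκ)

theorem two_rpow_pow_comm (e : ℝ) (K : ℕ) : ((2 : ℝ≥0∞) ^ e) ^ K = (2 ^ K) ^ e := by
  rw [← ENNReal.rpow_natCast, ← ENNReal.rpow_natCast, ← ENNReal.rpow_mul, ← ENNReal.rpow_mul,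
    mul_comm]

/-- The sum over the levels `k` with `2 ^ k ≤ H`; the logarithm is needed for `κ = 1` only. -/
theorem exists_sum_le_packingFactor {κ : ℝ} (hκ : 0 < κ) (h1 : κ ≤ 1) :
    ∃ A : ℝ≥0, ∀ (H : ℝ≥0∞) (K : ℕ), 1 ≤ H → H ≠ ∞ → 2 ^ K ≤ H →
      ∑ k ∈ Finset.range (K + 1), (2 : ℝ≥0∞) ^ (k * (1 - κ)) ≤ A * packingFactor κ H := by
  rcases h1.eq_or_lt with rfl | h1'
  · refine ⟨2, fun H K hH hHt hK => ?_⟩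
    have hlog : K * Real.log 2 ≤ Real.log H.toReal := by
      rw [← Real.log_pow]
      refine Real.log_le_log (by positivity) ?_
      have := ENNReal.toReal_mono hHt hK
      simpa using this
    have h2 := Real.log_two_gt_d9
    have hK0 : (0 : ℝ) ≤ K := by positivity
    have hreal : (K + 1 : ℝ) ≤ 2 * (1 + Real.log H.toReal) := by nlinarith
    have := ENNReal.ofReal_le_ofReal hreal
    rw [ENNReal.ofReal_mul (by norm_num), ENNReal.ofReal_add hK0 zero_le_one] at this
    simpa [packingFactor] using this
  · have he0 : 0 < 1 - κ := by linarith
    have hfin := tsum_pow_ne_top (two_rpow_neg_lt_one he0)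
    refine ⟨(∑' k : ℕ, ((2 : ℝ≥0∞) ^ (-(1 - κ))) ^ k).toNNReal, fun H K hH hHt hK => ?_⟩
    rw [ENNReal.coe_toNNReal hfin]
    simp only [two_rpow_natCast_mul]
    refine (sum_pow_le_mul_tsum (by simp) (by simp [ENNReal.rpow_eq_top_iff]) K).trans ?_
    rw [mul_comm]
    simp only [← ENNReal.rpow_neg]
    refine mul_le_mul_right ?_ _
    calc ((2 : ℝ≥0∞) ^ (1 - κ)) ^ K = (2 ^ K) ^ (1 - κ) := two_rpow_pow_comm _ _
      _ ≤ H ^ (1 - κ) := ENNReal.rpow_le_rpow hK he0.le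
      _ ≤ _ := rpow_le_packingFactor hκ h1 hH hHt

/-- The sum over the levels `k` with `2 ^ k > H`, where the packing bound decays. -/
theorem tsum_tail_le {e δ : ℝ} (hδ : 0 < δ) {H : ℝ≥0∞} (hH : 1 ≤ H) (hHt : H ≠ ∞) {K : ℕ}
    (hK : H < 2 ^ (K + 1)) :
    ∑' k : ℕ, H ^ (e + δ) * (2 : ℝ≥0∞) ^ (((k + (K + 1) : ℕ) : ℝ) * (-δ)) ≤
      (∑' k : ℕ, ((2 : ℝ≥0∞) ^ (-δ)) ^ k) * H ^ e := by
  have hH0 : H ≠ 0 := (zero_lt_one.trans_le hH).ne'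
  rw [← ENNReal.tsum_mul_right]
  refine ENNReal.tsum_le_tsum fun k => ?_
  rw [two_rpow_natCast_mul, pow_add, mul_left_comm, two_rpow_pow_comm _ (K + 1)]
  refine mul_le_mul_right ?_ _
  calc H ^ (e + δ) * (2 ^ (K + 1)) ^ (-δ) ≤ H ^ (e + δ) * H ^ (-δ) := by
        refine mul_le_mul_right ?_ _
        rw [ENNReal.rpow_neg, ENNReal.rpow_neg, ENNReal.inv_le_inv]
        exact ENNReal.rpow_le_rpow hK.le hδ.le
    _ = H ^ e := by
        rw [← ENNReal.rpow_add _ _ hH0 hHt]; congr 1; ring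

theorem exists_two_pow_le_lt {H : ℝ≥0∞} (hH : 1 ≤ H) (hHt : H ≠ ∞) :
    ∃ K : ℕ, 2 ^ K ≤ H ∧ H < 2 ^ (K + 1) := by
  lift H to ℝ≥0 using hHt
  obtain ⟨n, h2, h3⟩ := exists_nat_pow_near (x := H) (y := 2) (by exact_mod_cast hH) (by norm_num)
  exact ⟨n, by exact_mod_cast h2, by exact_mod_cast h3⟩

/-- The case `κ ≤ 1`, given a bound for the sum over the levels `k` with `2 ^ k ≤ H`. -/
theorem tsum_min_le_packingFactor {κ δ : ℝ} (hκ : 0 < κ) (h1 : κ ≤ 1) (hδ : 0 < δ) {A : ℝ≥0}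
    {H : ℝ≥0∞} (hH : 1 ≤ H) (hHt : H ≠ ∞)
    (hA : ∀ K : ℕ, 2 ^ K ≤ H →
      ∑ k ∈ Finset.range (K + 1), (2 : ℝ≥0∞) ^ (k * (1 - κ)) ≤ A * packingFactor κ H) :
    ∑' k : ℕ, min ((2 : ℝ≥0∞) ^ (k * (1 - κ))) (H ^ (1 - κ + δ) * 2 ^ (k * (-δ))) ≤
      (A + ∑' k : ℕ, ((2 : ℝ≥0∞) ^ (-δ)) ^ k) * packingFactor κ H := by
  obtain ⟨K, hK1, hK2⟩ := exists_two_pow_le_lt hH hHt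
  set f : ℕ → ℝ≥0∞ := fun k =>
    min ((2 : ℝ≥0∞) ^ (k * (1 - κ))) (H ^ (1 - κ + δ) * 2 ^ (k * (-δ))) with hf
  have hhead : ∑ k ∈ Finset.range (K + 1), f k ≤ A * packingFactor κ H :=
    (Finset.sum_le_sum fun k _ => min_le_left _ _).trans (hA K hK1)
  have htail : ∑' k, f (k + (K + 1)) ≤
      (∑' k : ℕ, ((2 : ℝ≥0∞) ^ (-δ)) ^ k) * packingFactor κ H := by
    refine (ENNReal.tsum_le_tsum fun k => min_le_right _ _).trans ?_
    refine (tsum_tail_le hδ hH hHt hK2).trans ?_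
    exact mul_le_mul_right (rpow_le_packingFactor hκ h1 hH hHt) _
  rw [← ENNReal.summable.sum_add_tsum_nat_add' (f := f) (k := K + 1), add_mul]
  exact add_le_add hhead htail

/-- The sum over the levels `2 ^ (-k)` of the smaller of the two available bounds. The bounds agree
when `2 ^ k` is about `H`; for larger `k` the second one decays geometrically. For smaller `k` the
first one grows geometrically unless `κ = 1`, when it is constant and summing it costs the
logarithm. -/
theorem exists_tsum_min_le_packingFactor {κ t : ℝ} (hκ : 0 < κ) (ht : 1 - κ < t) :
    ∃ C : ℝ≥0, ∀ H : ℝ≥0∞, 1 ≤ H → H ≠ ∞ →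
      ∑' k : ℕ, min ((2 : ℝ≥0∞) ^ (k * (1 - κ))) (H ^ t * 2 ^ (k * (1 - t - κ))) ≤
        C * packingFactor κ H := by
  rcases lt_or_ge 1 κ with h1 | h1
  · have hfin := tsum_pow_ne_top (two_rpow_neg_lt_one (sub_pos.2 h1))
    refine ⟨(∑' k : ℕ, ((2 : ℝ≥0∞) ^ (-(κ - 1))) ^ k).toNNReal, fun H _ _ => ?_⟩
    rw [ENNReal.coe_toNNReal hfin, packingFactor, if_neg (not_le.2 h1), mul_one]
    refine ENNReal.tsum_le_tsum fun k => (min_le_left _ _).trans (le_of_eq ?_)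
    rw [two_rpow_natCast_mul, neg_sub]
  · have hδ : 0 < t - (1 - κ) := by linarith
    have hfin := tsum_pow_ne_top (two_rpow_neg_lt_one hδ)
    obtain ⟨A, hA⟩ := exists_sum_le_packingFactor hκ h1
    refine ⟨A + (∑' k : ℕ, ((2 : ℝ≥0∞) ^ (-(t - (1 - κ)))) ^ k).toNNReal, fun H hH hHt => ?_⟩
    have := tsum_min_le_packingFactor hκ h1 hδ hH hHt fun K => hA H K hH hHt
    rw [ENNReal.coe_add, ENNReal.coe_toNNReal hfin]
    convert this using 6
    · ring
    · ring

section Embedding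

variable {Ω : Type*} [MeasurableSpace Ω] {μ ν : Measure Ω}

/-- Carleson embedding for the averages `τ Q / ν Q`, which are at most `1`: the weak-type estimate
bounds the total `ν`-measure of the members on which the average is about `2 ^ (-i)` by a multiple
of `2 ^ i`, which is summable against `2 ^ (-i p)` for `p > 1`. -/
theorem DyadicFamily.sum_rpow_mul_le {G : Finset (Set Ω)} {p : ℝ} (hp : 1 < p)
    (h : DyadicFamily μ ν (G : Set (Set Ω))) {H : ℝ≥0∞}
    (hC : IsCarleson ν H (G : Set (Set Ω))) {τ : Measure Ω} (hτ : τ ≤ ν) :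
    ∑ Q ∈ G, (τ Q / ν Q) ^ p * ν Q ≤
      2 * (∑' i : ℕ, ((2 : ℝ≥0∞) ^ (-(p - 1))) ^ i) * (H * τ Set.univ) := by
  classical
  have hp0 : 0 < p := by linarith
  have ha1 : ∀ Q ∈ G, τ Q / ν Q ≤ 1 := fun Q hQ => by
    rw [ENNReal.div_le_iff (h.right_ne_zero Q hQ) (h.right_ne_top Q hQ), one_mul]
    exact hτ Q
  set I : ℕ → Finset (Set Ω) := fun i => G.filter fun Q => (2⁻¹ : ℝ≥0∞) ^ (i + 1) < τ Q / ν Q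
  have hI : ∀ i, ∑ Q ∈ I i, ν Q ≤ 2 ^ (i + 1) * (H * τ Set.univ) := by
    intro i
    have hsub : I i ⊆ G := Finset.filter_subset _ _
    have := NestedFamily.mul_sum_measure_le (F := I i) (ν := ν) (τ := τ) (t := 2⁻¹ ^ (i + 1))
      (H := H) (h.nested.mono (by exact_mod_cast hsub))
      (fun Q hQ => h.measurableSet Q (hsub hQ)) (fun Q hQ => ?_)
      (hC.mono (by exact_mod_cast hsub))
    · rw [← ENNReal.inv_pow] at this
      exact (ENNReal.inv_mul_le_iff (by simp) (by simp)).1 this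
    · have h1 := (Finset.mem_filter.1 hQ).2.le
      have hQ := hsub hQ
      rwa [ENNReal.le_div_iff_mul_le (Or.inl (h.right_ne_zero Q hQ))
        (Or.inl (h.right_ne_top Q hQ))] at h1
  calc ∑ Q ∈ G, (τ Q / ν Q) ^ p * ν Q
      ≤ ∑ Q ∈ G, ∑' i : ℕ, if Q ∈ I i then (2⁻¹ ^ i) ^ p * ν Q else 0 := by
        refine Finset.sum_le_sum fun Q hQ => ?_
        rcases eq_or_ne (τ Q / ν Q) 0 with h0 | h0
        · simp [h0, ENNReal.zero_rpow_of_pos hp0]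
        · obtain ⟨i, hi1, hi2⟩ := exists_pow_lt_le h0 (ha1 Q hQ)
          refine le_trans ?_ (ENNReal.le_tsum i)
          rw [if_pos (Finset.mem_filter.2 ⟨hQ, hi1⟩)]
          gcongr
    _ = ∑' i : ℕ, ∑ Q ∈ I i, (2⁻¹ ^ i) ^ p * ν Q := by
        rw [← Summable.tsum_finsetSum fun _ _ => ENNReal.summable]
        refine tsum_congr fun i => ?_
        rw [← Finset.sum_filter]
        refine Finset.sum_congr ?_ fun _ _ => rfl
        ext Q
        simp +contextual [I]
    _ ≤ ∑' i : ℕ, 2 * ((2 : ℝ≥0∞) ^ (-(p - 1))) ^ i * (H * τ Set.univ) := by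
        refine ENNReal.tsum_le_tsum fun i => ?_
        rw [← Finset.mul_sum]
        have e1 : ((2⁻¹ : ℝ≥0∞) ^ i) ^ p = 2 ^ (i * (-p)) := by
          rw [← ENNReal.inv_pow, ENNReal.inv_rpow, ← ENNReal.rpow_natCast, ← ENNReal.rpow_mul,
            ← ENNReal.rpow_neg, mul_neg]
        calc ((2⁻¹ : ℝ≥0∞) ^ i) ^ p * ∑ Q ∈ I i, ν Q
            ≤ 2 ^ (i * (-p)) * (2 ^ (i + 1) * (H * τ Set.univ)) := by
              rw [e1]; gcongr; exact hI i
          _ = 2 * (2 ^ (i * (-p)) * 2 ^ i) * (H * τ Set.univ) := by rw [pow_succ]; ring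
          _ = _ := by
              rw [← two_rpow_natCast_mul]
              have : (2 : ℝ≥0∞) ^ (i * (-p)) * 2 ^ i = 2 ^ ((i : ℝ) * -(p - 1)) := by
                rw [← ENNReal.rpow_natCast 2 i, ← ENNReal.rpow_add _ _ (by simp) (by simp)]
                congr 1; ring
              rw [this]
    _ = _ := by rw [ENNReal.tsum_mul_right, ENNReal.tsum_mul_left]

end Embedding

/-! ### The sparse form of a nested family -/

/-- The number of generations after which at most half of the mass survives. -/
theorem exists_two_mul_rpow_le {γ : ℝ} (h0 : 0 < γ) :
    ∃ n : ℕ, 2 * (2 / n : ℝ≥0∞) ^ γ ≤ 2⁻¹ := by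
  set ε : ℝ≥0∞ := (4⁻¹ : ℝ≥0∞) ^ γ⁻¹ with hε
  have hε0 : ε ≠ 0 := by simp [hε, ENNReal.rpow_eq_zero_iff]
  have hεt : ε ≠ ∞ := by simp [hε, ENNReal.rpow_eq_top_iff]
  obtain ⟨n, hn⟩ := ENNReal.exists_nat_gt (r := 2 / ε) (ENNReal.div_ne_top (by simp) hε0)
  refine ⟨n, ?_⟩
  have h1 : (2 / n : ℝ≥0∞) ≤ ε := by
    have h2 := (ENNReal.div_le_iff hε0 hεt).1 hn.le
    refine ENNReal.div_le_of_le_mul ?_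
    rwa [mul_comm]
  calc 2 * (2 / n : ℝ≥0∞) ^ γ ≤ 2 * ε ^ γ := by gcongr
    _ = 2 * 4⁻¹ := by rw [hε, ← ENNReal.rpow_mul, inv_mul_cancel₀ h0.ne', ENNReal.rpow_one]
    _ ≤ 2⁻¹ := by
        rw [show (4 : ℝ≥0∞) = 2 * 2 by norm_num, ENNReal.mul_inv (by simp) (by simp), ← mul_assoc,
          ENNReal.mul_inv_cancel (by simp) (by simp), one_mul]

section Core

variable {Ω : Type*} [MeasurableSpace Ω] {μ ν Φ Ψ τ : Measure Ω} {γ κ : ℝ}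

/-- The total `ν`-measure of the members on which the mixed density is about `2 ^ (-k) L`. -/
theorem DyadicFamily.sum_measure_level_le {G : Finset (Set Ω)}
    (h : DyadicFamily μ ν (G : Set (Set Ω))) (h0 : 0 < γ) (h1 : γ ≤ 1)
    (hΦ : ∀ Q ∈ G, Φ Q ≠ ∞) (hC : IsCarleson μ 2 (G : Set (Set Ω)))
    (hΨ : ∀ Q ∈ G, ∀ E ⊆ Q, MeasurableSet E → (ν Q / μ Q) ^ γ * Φ E ≤ Ψ E)
    {L V : ℝ≥0∞} (hL0 : L ≠ 0) (hLt : L ≠ ∞) (hΨL : Ψ Set.univ ≤ L * V) {k : ℕ}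
    (hG : ∀ Q ∈ G, 2⁻¹ ^ (k + 1) * L ≤ mixedDensity μ ν Φ γ Q ∧
      mixedDensity μ ν Φ γ Q ≤ 2⁻¹ ^ k * L)
    {n : ℕ} (hn : 2 * (2 / n : ℝ≥0∞) ^ γ ≤ 2⁻¹) :
    ∑ Q ∈ G, ν Q ≤ 4 * n * (2 ^ k * V) := by
  have key : 2⁻¹ ^ (k + 1) * L * ∑ Q ∈ G, ν Q ≤ 2 * n * (L * V) := by
    calc 2⁻¹ ^ (k + 1) * L * ∑ Q ∈ G, ν Q ≤ ∑ Q ∈ G, mixedDensity μ ν Φ γ Q * ν Q := by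
          rw [Finset.mul_sum]
          gcongr with Q hQ
          exact (hG Q hQ).1
      _ ≤ 2 * n * Ψ Set.univ := by
          refine h.sum_mixedDensity_mul_le h0 h1 hΦ hC hΨ (fun Q hQ R hR => ?_) hn
          refine (hG R hR).2.trans ?_
          calc 2⁻¹ ^ k * L = 2 * (2⁻¹ ^ (k + 1) * L) := by
                rw [pow_succ', ← mul_assoc, ← mul_assoc,
                  ENNReal.mul_inv_cancel (by simp) (by simp), one_mul]
            _ ≤ _ := by gcongr; exact (hG Q hQ).1
      _ ≤ 2 * n * (L * V) := by gcongr
  rw [← ENNReal.inv_pow, mul_assoc, ENNReal.inv_mul_le_iff (by simp) (by simp)] at key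
  have : L * ∑ Q ∈ G, ν Q ≤ L * (4 * n * (2 ^ k * V)) := by
    refine key.trans (le_of_eq ?_)
    rw [pow_succ]; ring
  exact (ENNReal.mul_le_mul_iff_right hL0 hLt).1 this

/-- The contribution to the sparse form of the members on which the mixed density is about
`2 ^ (-k) L`: the first bound uses `τ Q ≤ ν Q`, the second interpolates with the Carleson embedding
by Hölder's inequality. -/
theorem DyadicFamily.sum_level_le {G : Finset (Set Ω)}
    (h : DyadicFamily μ ν (G : Set (Set Ω))) (h0 : 0 < γ) (h1 : γ ≤ 1) (hκ : 0 < κ)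
    (hΦ : ∀ Q ∈ G, Φ Q ≠ ∞) (hC : IsCarleson μ 2 (G : Set (Set Ω))) {H : ℝ≥0∞}
    (hH : IsCarleson ν H (G : Set (Set Ω)))
    (hΨ : ∀ Q ∈ G, ∀ E ⊆ Q, MeasurableSet E → (ν Q / μ Q) ^ γ * Φ E ≤ Ψ E) (hτ : τ ≤ ν)
    {L V : ℝ≥0∞} (hL0 : L ≠ 0) (hLt : L ≠ ∞) (hΨL : Ψ Set.univ ≤ L * V)
    (hτV : τ Set.univ ≤ V) {k : ℕ}
    (hG : ∀ Q ∈ G, 2⁻¹ ^ (k + 1) * L ≤ mixedDensity μ ν Φ γ Q ∧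
      mixedDensity μ ν Φ γ Q ≤ 2⁻¹ ^ k * L)
    {n : ℕ} (hn : 2 * (2 / n : ℝ≥0∞) ^ γ ≤ 2⁻¹) {t θ : ℝ} (ht0 : 0 < t) (htθ : t < θ)
    (ht1 : t ≤ 1) :
    ∑ Q ∈ G, mixedDensity μ ν Φ γ Q ^ κ * ((τ Q / ν Q) ^ θ * ν Q) ≤
      (4 * n + (2 * (∑' i : ℕ, ((2 : ℝ≥0∞) ^ (-(θ / t - 1))) ^ i)) ^ t * (4 * n) ^ (1 - t)) *
        (L ^ κ * V) * min ((2 : ℝ≥0∞) ^ (k * (1 - κ))) (H ^ t * 2 ^ (k * (1 - t - κ))) := by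
  set c : ℝ≥0∞ := 2 * (∑' i : ℕ, ((2 : ℝ≥0∞) ^ (-(θ / t - 1))) ^ i) with hc
  have hν := h.sum_measure_level_le h0 h1 hΦ hC hΨ hL0 hLt hΨL hG hn
  have hstart : ∑ Q ∈ G, mixedDensity μ ν Φ γ Q ^ κ * ((τ Q / ν Q) ^ θ * ν Q) ≤
      2 ^ (k * (-κ)) * L ^ κ * ∑ Q ∈ G, (τ Q / ν Q) ^ θ * ν Q := by
    have e : (2⁻¹ ^ k * L) ^ κ = 2 ^ (k * (-κ)) * L ^ κ := by
      rw [ENNReal.mul_rpow_of_nonneg _ _ hκ.le, ← ENNReal.inv_pow, ENNReal.inv_rpow,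
        ← ENNReal.rpow_natCast, ← ENNReal.rpow_mul, ← ENNReal.rpow_neg, mul_neg]
    rw [Finset.mul_sum, ← e]
    gcongr with Q hQ
    exact (hG Q hQ).2
  rw [mul_min_of_nonneg _ _ zero_le, le_min_iff]
  constructor
  · have ha : ∑ Q ∈ G, (τ Q / ν Q) ^ θ * ν Q ≤ 4 * n * (2 ^ k * V) := by
      refine le_trans (Finset.sum_le_sum fun Q hQ => ?_) hν
      refine mul_le_of_le_one_left' (ENNReal.rpow_le_one ?_ (ht0.trans htθ).le)
      rw [ENNReal.div_le_iff (h.right_ne_zero Q hQ) (h.right_ne_top Q hQ), one_mul]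
      exact hτ Q
    calc _ ≤ 2 ^ (k * (-κ)) * L ^ κ * (4 * n * (2 ^ k * V)) := hstart.trans (by gcongr)
      _ = 4 * n * (L ^ κ * V) * (2 ^ (k * (-κ)) * 2 ^ k) := by ring
      _ = 4 * n * (L ^ κ * V) * 2 ^ (k * (1 - κ)) := by
          rw [← ENNReal.rpow_natCast 2 k, ← ENNReal.rpow_add _ _ (by simp) (by simp)]
          congr 2; ring
      _ ≤ _ := by gcongr; exact le_self_add
  · have ha : ∑ Q ∈ G, (τ Q / ν Q) ^ θ * ν Q ≤
        (c * (H * V)) ^ t * (4 * n * (2 ^ k * V)) ^ (1 - t) := by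
      calc ∑ Q ∈ G, (τ Q / ν Q) ^ θ * ν Q
          = ∑ Q ∈ G, ((τ Q / ν Q) ^ (θ / t) * ν Q) ^ t * ν Q ^ (1 - t) := by
            refine Finset.sum_congr rfl fun Q hQ => ?_
            rw [ENNReal.mul_rpow_of_nonneg _ _ ht0.le, ← ENNReal.rpow_mul,
              div_mul_cancel₀ _ ht0.ne', mul_assoc,
              ← ENNReal.rpow_add _ _ (h.right_ne_zero Q hQ) (h.right_ne_top Q hQ)]
            simp
        _ ≤ (∑ Q ∈ G, (τ Q / ν Q) ^ (θ / t) * ν Q) ^ t * (∑ Q ∈ G, ν Q) ^ (1 - t) :=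
            sum_rpow_mul_rpow_le _ _ _ ht0 ht1
        _ ≤ _ := by
            have h1t : 0 ≤ 1 - t := by linarith
            gcongr
            refine (h.sum_rpow_mul_le ((one_lt_div ht0).2 htθ) hH hτ).trans ?_
            gcongr
    have h1t : 0 ≤ 1 - t := by linarith
    calc _ ≤ 2 ^ (k * (-κ)) * L ^ κ * ((c * (H * V)) ^ t * (4 * n * (2 ^ k * V)) ^ (1 - t)) :=
          hstart.trans (by gcongr)
      _ = c ^ t * (4 * n) ^ (1 - t) * (L ^ κ * (V ^ t * V ^ (1 - t))) *
            (H ^ t * (2 ^ (k * (-κ)) * (2 ^ k) ^ (1 - t))) := by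
          rw [ENNReal.mul_rpow_of_nonneg c _ ht0.le, ENNReal.mul_rpow_of_nonneg H _ ht0.le,
            ENNReal.mul_rpow_of_nonneg (4 * n) _ h1t, ENNReal.mul_rpow_of_nonneg (2 ^ k) _ h1t]
          ring
      _ = c ^ t * (4 * n) ^ (1 - t) * (L ^ κ * V) * (H ^ t * 2 ^ (k * (1 - t - κ))) := by
          rw [← ENNReal.rpow_add_of_nonneg _ _ ht0.le h1t, ← ENNReal.rpow_natCast 2 k,
            ← ENNReal.rpow_mul, ← ENNReal.rpow_add _ _ (by simp) (by simp)]
          congr 3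
          · simp
          · ring_nf
      _ ≤ _ := by gcongr; exact le_add_self

/-- The weighted sparse form over a finite Carleson family, restricted to the members on which the
mixed density is at most `L` or `τ` vanishes. -/
theorem exists_sum_mixedDensity_le (Ω : Type*) [MeasurableSpace Ω] (h0 : 0 < γ) (h1 : γ ≤ 1)
    (hκ : 0 < κ) (hθ : 0 < 1 - κ * (1 - γ)) :
    ∃ C : ℝ≥0, ∀ (μ ν Φ Ψ τ : Measure Ω) (F : Finset (Set Ω)) (H L V : ℝ≥0∞),
      DyadicFamily μ ν (F : Set (Set Ω)) → IsCarleson μ 2 (F : Set (Set Ω)) →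
      IsCarleson ν H (F : Set (Set Ω)) → 1 ≤ H → H ≠ ∞ → (∀ Q ∈ F, Φ Q ≠ ∞) →
      (∀ Q ∈ F, ∀ E ⊆ Q, MeasurableSet E → (ν Q / μ Q) ^ γ * Φ E ≤ Ψ E) → τ ≤ ν →
      L ≠ 0 → L ≠ ∞ → (∀ Q ∈ F, τ Q ≠ 0 → mixedDensity μ ν Φ γ Q ≤ L) →
      Ψ Set.univ ≤ L * V → τ Set.univ ≤ V →
      ∑ Q ∈ F, mixedDensity μ ν Φ γ Q ^ κ * ((τ Q / ν Q) ^ (1 - κ * (1 - γ)) * ν Q) ≤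
        C * (L ^ κ * V * packingFactor κ H) := by
  classical
  set θ := 1 - κ * (1 - γ) with hθdef
  have hκγ : 0 < κ * γ := mul_pos hκ h0
  have hκγ' : 0 ≤ κ * (1 - γ) := mul_nonneg hκ.le (by linarith)
  -- the exponent of interpolation lies strictly between `1 - κ` and `θ`
  obtain ⟨t, ht, htθ⟩ : ∃ t, max 0 (1 - κ) < t ∧ t < θ :=
    exists_between (max_lt hθ (by rw [hθdef]; linarith))
  obtain ⟨ht0, htκ⟩ := max_lt_iff.1 ht
  have ht1 : t ≤ 1 := by linarith
  obtain ⟨n, hn⟩ := exists_two_mul_rpow_le h0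
  obtain ⟨C, hC⟩ := exists_tsum_min_le_packingFactor hκ htκ
  set c : ℝ≥0∞ :=
    4 * n + (2 * (∑' i : ℕ, ((2 : ℝ≥0∞) ^ (-(θ / t - 1))) ^ i)) ^ t * (4 * n) ^ (1 - t) with hc
  have hct : c ≠ ∞ := by
    refine ENNReal.add_ne_top.2 ⟨ENNReal.mul_ne_top (by simp) (by simp), ENNReal.mul_ne_top ?_ ?_⟩
    · refine ENNReal.rpow_ne_top_of_nonneg ht0.le (ENNReal.mul_ne_top (by simp) ?_)
      exact tsum_pow_ne_top (two_rpow_neg_lt_one (sub_pos.2 ((one_lt_div ht0).2 htθ)))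
    · exact ENNReal.rpow_ne_top_of_nonneg (by linarith) (ENNReal.mul_ne_top (by simp) (by simp))
  refine ⟨c.toNNReal * C, fun μ ν Φ Ψ τ F H L V hF hCμ hCν hH1 hHt hΦ hΨ hτ hL0 hLt hL hΨL
    hτV => ?_⟩
  set f : Set Ω → ℝ≥0∞ := fun Q => mixedDensity μ ν Φ γ Q ^ κ * ((τ Q / ν Q) ^ θ * ν Q) with hf
  set G : ℕ → Finset (Set Ω) := fun k => F.filter fun Q =>
    2⁻¹ ^ (k + 1) * L ≤ mixedDensity μ ν Φ γ Q ∧ mixedDensity μ ν Φ γ Q ≤ 2⁻¹ ^ k * L with hGdef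
  have hGF : ∀ k, G k ⊆ F := fun k => Finset.filter_subset _ _
  calc ∑ Q ∈ F, f Q ≤ ∑ Q ∈ F, ∑' k : ℕ, if Q ∈ G k then f Q else 0 := by
        refine Finset.sum_le_sum fun Q hQ => ?_
        rcases eq_or_ne (mixedDensity μ ν Φ γ Q) 0 with hd | hd
        · simp [hf, hd, ENNReal.zero_rpow_of_pos hκ]
        rcases eq_or_ne (τ Q) 0 with hτ0 | hτ0
        · simp [hf, hτ0, ENNReal.zero_rpow_of_pos hθ]
        obtain ⟨k, hk1, hk2⟩ := exists_pow_lt_le (a := mixedDensity μ ν Φ γ Q / L)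
          (ENNReal.div_ne_zero.2 ⟨hd, hLt⟩) (by
            rw [ENNReal.div_le_iff hL0 hLt, one_mul]
            exact hL Q hQ hτ0)
        refine le_trans ?_ (ENNReal.le_tsum k)
        rw [if_pos]
        refine Finset.mem_filter.2 ⟨hQ, ?_, ?_⟩
        · exact (ENNReal.le_div_iff_mul_le (Or.inl hL0) (Or.inl hLt)).1 hk1.le
        · exact (ENNReal.div_le_iff hL0 hLt).1 hk2
    _ = ∑' k : ℕ, ∑ Q ∈ G k, f Q := by
        rw [← Summable.tsum_finsetSum fun _ _ => ENNReal.summable]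
        refine tsum_congr fun k => ?_
        rw [← Finset.sum_filter]
        refine Finset.sum_congr ?_ fun _ _ => rfl
        ext Q
        simp +contextual [hGdef]
    _ ≤ ∑' k : ℕ, c * (L ^ κ * V) *
          min ((2 : ℝ≥0∞) ^ (k * (1 - κ))) (H ^ t * 2 ^ (k * (1 - t - κ))) := by
        refine ENNReal.tsum_le_tsum fun k => ?_
        have hGF' : (G k : Set (Set Ω)) ⊆ (F : Set (Set Ω)) := by exact_mod_cast hGF k
        exact (hF.mono hGF').sum_level_le h0 h1 hκ (fun Q hQ => hΦ Q (hGF k hQ))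
          (hCμ.mono hGF') (hCν.mono hGF') (fun Q hQ => hΨ Q (hGF k hQ)) hτ hL0 hLt hΨL hτV
          (fun Q hQ => (Finset.mem_filter.1 hQ).2) hn ht0 htθ ht1
    _ ≤ c * (L ^ κ * V) * (C * packingFactor κ H) := by
        rw [ENNReal.tsum_mul_left]
        gcongr
        exact hC H hH1 hHt
    _ = _ := by
        rw [ENNReal.coe_mul, ENNReal.coe_toNNReal hct]
        ring

end Core

/-! ### Shifted dyadic grids and sparse collections -/

section Cubes

variable {d : ℕ}

theorem mem_cube {a : Fin d → ℝ} {ℓ : ℝ} {x : Fin d → ℝ} :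
    x ∈ cube a ℓ ↔ ∀ i, a i ≤ x i ∧ x i < a i + ℓ := by
  simp [cube, Set.mem_pi]

theorem measurableSet_cube (a : Fin d → ℝ) (ℓ : ℝ) : MeasurableSet (cube a ℓ) :=
  MeasurableSet.univ_pi fun _ => measurableSet_Ico

theorem volume_cube (a : Fin d → ℝ) (ℓ : ℝ) : volume (cube a ℓ) = ENNReal.ofReal ℓ ^ d := by
  simp [cube, Real.volume_pi_Ico]

theorem IsCube.measurableSet {Q : Set (Fin d → ℝ)} (h : IsCube Q) : MeasurableSet Q := by
  obtain ⟨a, ℓ, -, rfl⟩ := h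
  exact measurableSet_cube a ℓ

theorem IsCube.volume_ne_zero {Q : Set (Fin d → ℝ)} (h : IsCube Q) : volume Q ≠ 0 := by
  obtain ⟨a, ℓ, hℓ, rfl⟩ := h
  rw [volume_cube]
  exact pow_ne_zero _ (ENNReal.ofReal_pos.2 hℓ).ne'

theorem IsCube.volume_ne_top {Q : Set (Fin d → ℝ)} (h : IsCube Q) : volume Q ≠ ∞ := by
  obtain ⟨a, ℓ, -, rfl⟩ := h
  rw [volume_cube]
  exact ENNReal.pow_ne_top ENNReal.ofReal_ne_top

/-- The cube of generation `j` and position `k` in the grid with shift `α / 3`. -/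
noncomputable def gridCube (α : Fin d → Fin 3) (j : ℤ) (k : Fin d → ℤ) : Set (Fin d → ℝ) :=
  cube (fun i => (2 : ℝ) ^ (-j) * ((-1 : ℝ) ^ j * (((α i : ℕ) : ℝ) / 3) + (k i : ℝ)))
    ((2 : ℝ) ^ (-j))

theorem mem_dyadicGrid {α : Fin d → Fin 3} {Q : Set (Fin d → ℝ)} :
    Q ∈ dyadicGrid α ↔ ∃ j k, Q = gridCube α j k := Iff.rfl

theorem isCube_of_mem_dyadicGrid {α : Fin d → Fin 3} {Q : Set (Fin d → ℝ)}
    (h : Q ∈ dyadicGrid α) : IsCube Q := by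
  obtain ⟨j, k, rfl⟩ := h
  exact ⟨_, _, by positivity, rfl⟩

theorem countable_dyadicGrid (α : Fin d → Fin 3) : (dyadicGrid α).Countable := by
  have : dyadicGrid α = Set.range fun p : ℤ × (Fin d → ℤ) => gridCube α p.1 p.2 := by
    ext Q
    simp [mem_dyadicGrid, eq_comm]
  rw [this]
  exact Set.countable_range _

/-- The nesting of the shifted grids in dimension one. Measured in units of the smaller interval
the two left endpoints differ by an integer, because `2 ^ m - (-1) ^ m` is divisible by `3`. -/
theorem grid_endpoints_le (b : ℕ) (j : ℤ) (m : ℕ) (k k' : ℤ) {x : ℝ}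
    (h1 : (2 : ℝ) ^ (-j) * ((-1 : ℝ) ^ j * ((b : ℝ) / 3) + k) ≤ x)
    (h2 : x < (2 : ℝ) ^ (-j) * ((-1 : ℝ) ^ j * ((b : ℝ) / 3) + k) + (2 : ℝ) ^ (-j))
    (h3 : (2 : ℝ) ^ (-(j + m)) * ((-1 : ℝ) ^ (j + m) * ((b : ℝ) / 3) + k') ≤ x)
    (h4 : x < (2 : ℝ) ^ (-(j + m)) * ((-1 : ℝ) ^ (j + m) * ((b : ℝ) / 3) + k') +
      (2 : ℝ) ^ (-(j + m))) :
    (2 : ℝ) ^ (-j) * ((-1 : ℝ) ^ j * ((b : ℝ) / 3) + k) ≤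
      (2 : ℝ) ^ (-(j + m)) * ((-1 : ℝ) ^ (j + m) * ((b : ℝ) / 3) + k') ∧
    (2 : ℝ) ^ (-(j + m)) * ((-1 : ℝ) ^ (j + m) * ((b : ℝ) / 3) + k') + (2 : ℝ) ^ (-(j + m)) ≤
      (2 : ℝ) ^ (-j) * ((-1 : ℝ) ^ j * ((b : ℝ) / 3) + k) + (2 : ℝ) ^ (-j) := by
  obtain ⟨ε, hε⟩ : ∃ ε : ℤ, (-1 : ℝ) ^ j = ε := by
    rcases Int.even_or_odd j with h | h
    · exact ⟨1, by simp [h.neg_one_zpow]⟩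
    · exact ⟨-1, by simp [h.neg_one_zpow]⟩
  obtain ⟨c, hc⟩ : (2 - (-1) : ℤ) ∣ 2 ^ m - (-1) ^ m := sub_dvd_pow_sub_pow 2 (-1) m
  have hc' : (-1 : ℝ) ^ m = 2 ^ m - 3 * c := by
    have : ((2 ^ m - (-1) ^ m : ℤ) : ℝ) = ((2 - (-1)) * c : ℤ) := by rw [hc]
    push_cast at this
    linarith
  have e1 : (-1 : ℝ) ^ (j + m) = ε * (2 ^ m - 3 * c) := by
    rw [zpow_add₀ (by norm_num), hε, zpow_natCast, hc']
  have e2 : (2 : ℝ) ^ (-j) = 2 ^ (-(j + m)) * 2 ^ m := by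
    rw [← zpow_natCast, ← zpow_add₀ (by norm_num)]
    congr 1; ring
  rw [e1] at h3 h4 ⊢
  rw [e2, hε] at h1 h2 ⊢
  set u : ℝ := 2 ^ (-(j + m)) with hu
  have hu0 : 0 < u := by positivity
  have h23 : u * (ε * (2 ^ m - 3 * c) * (b / 3) + k') <
      u * (2 ^ m * (ε * (b / 3) + k) + 2 ^ m) := by linarith
  have h14 : u * (2 ^ m * (ε * (b / 3) + k)) < u * (ε * (2 ^ m - 3 * c) * (b / 3) + k' + 1) := by
    linarith
  have i23 := (mul_lt_mul_iff_right₀ hu0).1 h23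
  have i14 := (mul_lt_mul_iff_right₀ hu0).1 h14
  have j23 : (k' : ℤ) + 1 ≤ ε * c * b + 2 ^ m * k + 2 ^ m := by
    have : (k' : ℝ) < ε * c * b + 2 ^ m * k + 2 ^ m := by linarith
    exact_mod_cast this
  have j14 : ε * c * b + 2 ^ m * k ≤ k' := by
    have : ε * c * b + 2 ^ m * k < (k' : ℝ) + 1 := by linarith
    exact Int.lt_add_one_iff.1 (by exact_mod_cast this)
  have r23 : (k' : ℝ) + 1 ≤ ε * c * b + 2 ^ m * k + 2 ^ m := by exact_mod_cast j23
  have r14 : ε * c * b + 2 ^ m * k ≤ (k' : ℝ) := by exact_mod_cast j14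
  constructor
  · have : u * (2 ^ m * (ε * (b / 3) + k)) ≤ u * (ε * (2 ^ m - 3 * c) * (b / 3) + k') :=
      mul_le_mul_of_nonneg_left (by linarith) hu0.le
    linarith
  · have : u * (ε * (2 ^ m - 3 * c) * (b / 3) + k' + 1) ≤
        u * (2 ^ m * (ε * (b / 3) + k) + 2 ^ m) :=
      mul_le_mul_of_nonneg_left (by linarith) hu0.le
    linarith

theorem gridCube_subset_of_mem {α : Fin d → Fin 3} {j j' : ℤ} (hj : j ≤ j') {k k' : Fin d → ℤ}
    {x : Fin d → ℝ} (hx : x ∈ gridCube α j k) (hx' : x ∈ gridCube α j' k') :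
    gridCube α j' k' ⊆ gridCube α j k := by
  obtain ⟨m, rfl⟩ : ∃ m : ℕ, j' = j + m := ⟨(j' - j).toNat, by omega⟩
  intro y hy
  rw [gridCube, mem_cube] at *
  intro i
  obtain ⟨h1, h2⟩ := grid_endpoints_le (α i) j m (k i) (k' i) (hx i).1 (hx i).2 (hx' i).1 (hx' i).2
  exact ⟨h1.trans (hy i).1, (hy i).2.trans_le h2⟩

theorem nestedFamily_dyadicGrid (α : Fin d → Fin 3) : NestedFamily (dyadicGrid α) := by
  rintro _ ⟨j, k, rfl⟩ _ ⟨j', k', rfl⟩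
  by_cases hd : Disjoint (gridCube α j k) (gridCube α j' k')
  · exact Or.inr (Or.inr hd)
  obtain ⟨x, hx, hx'⟩ := Set.not_disjoint_iff.1 hd
  rcases le_total j j' with h | h
  · exact Or.inr (Or.inl (gridCube_subset_of_mem h hx hx'))
  · exact Or.inl (gridCube_subset_of_mem h hx' hx)

theorem gridCube_nonempty (α : Fin d → Fin 3) (j : ℤ) (k : Fin d → ℤ) :
    (gridCube α j k).Nonempty :=
  nonempty_of_measure_ne_zero (isCube_of_mem_dyadicGrid ⟨j, k, rfl⟩).volume_ne_zero

theorem generation_le_of_subset (hd : 0 < d) {α : Fin d → Fin 3} {j j' : ℤ} {k k' : Fin d → ℤ}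
    (h : gridCube α j k ⊆ gridCube α j' k') : j' ≤ j := by
  have h1 := measure_mono (μ := volume) h
  rw [gridCube, gridCube, volume_cube, volume_cube] at h1
  rw [← ENNReal.ofReal_pow (by positivity), ← ENNReal.ofReal_pow (by positivity),
    ENNReal.ofReal_le_ofReal_iff (by positivity)] at h1
  have h2 := (pow_le_pow_iff_left₀ (by positivity) (by positivity) hd.ne').1 h1
  have := (zpow_le_zpow_iff_right₀ (by norm_num : (1 : ℝ) < 2)).1 h2
  omega

/-- Every member of `P` properly contained in `Q` is contained in a child of `Q`: among the cubes
in between there is one of the earliest generation. -/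
theorem exists_children_of_ssubset (hd : 0 < d) {α : Fin d → Fin 3} {P : Set (Set (Fin d → ℝ))}
    (hP : P ⊆ dyadicGrid α) {Q Q' : Set (Fin d → ℝ)} (hQ : Q ∈ P) (hQ' : Q' ∈ P) (h : Q' ⊂ Q) :
    ∃ R ∈ children P Q, Q' ⊆ R := by
  obtain ⟨jQ, kQ, hjQ⟩ := mem_dyadicGrid.1 (hP hQ)
  obtain ⟨jQ', kQ', hjQ'⟩ := mem_dyadicGrid.1 (hP hQ')
  obtain ⟨j, ⟨k, hjP, hjQ'k, hjQk⟩, hmin⟩ := Int.exists_least_of_bdd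
    (P := fun j => ∃ k, gridCube α j k ∈ P ∧ Q' ⊆ gridCube α j k ∧ gridCube α j k ⊂ Q)
    ⟨jQ, fun j ⟨k, _, _, hk⟩ => generation_le_of_subset hd (hjQ ▸ hk.subset)⟩
    ⟨jQ', kQ', hjQ' ▸ hQ', hjQ' ▸ subset_rfl, hjQ' ▸ h⟩
  refine ⟨gridCube α j k, ⟨⟨hjP, hjQk⟩, fun R hR hle => ?_⟩, hjQ'k⟩
  obtain ⟨j1, k1, rfl⟩ := mem_dyadicGrid.1 (hP hR.1)
  have h1 : j ≤ j1 := hmin j1 ⟨k1, hR.1, hjQ'k.trans hle, hR.2⟩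
  obtain ⟨x, hx⟩ := gridCube_nonempty α j k
  exact gridCube_subset_of_mem h1 hx (hle hx)

/-- In a sparse subfamily of a grid every cube has a subset of at least half its measure such that
these subsets are pairwise disjoint: what the children leave. -/
theorem exists_disjoint_subsets_of_sparse (hd : 0 < d) {α : Fin d → Fin 3}
    {P : Set (Set (Fin d → ℝ))} (hP : P ⊆ dyadicGrid α)
    (hs : ∀ Q ∈ P, ∑' Q' : children P Q, volume (Q' : Set (Fin d → ℝ))
        ≤ ENNReal.ofReal (1 - 1 / 2) * volume Q) :
    ∃ E : Set (Fin d → ℝ) → Set (Fin d → ℝ), (∀ Q ∈ P, MeasurableSet (E Q) ∧ E Q ⊆ Q ∧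
      volume Q ≤ 2 * volume (E Q)) ∧ P.PairwiseDisjoint E := by
  have hcube : ∀ Q ∈ P, IsCube Q := fun Q hQ => isCube_of_mem_dyadicGrid (hP hQ)
  have hchP : ∀ Q, children P Q ⊆ P := fun Q R hR =>
    (show Maximal (fun R => R ∈ P ∧ R ⊂ Q) R from hR).prop.1
  have hcount : ∀ Q, (children P Q).Countable := fun Q =>
    (countable_dyadicGrid α).mono ((hchP Q).trans hP)
  have hUm : ∀ Q, MeasurableSet (⋃ R ∈ children P Q, R) := fun Q =>
    MeasurableSet.biUnion (hcount Q) fun R hR => (hcube R (hchP Q hR)).measurableSet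
  refine ⟨fun Q => Q \ ⋃ R ∈ children P Q, R, fun Q hQ =>
    ⟨(hcube Q hQ).measurableSet.diff (hUm Q), Set.sdiff_subset, ?_⟩, ?_⟩
  · have h1 : volume (⋃ R ∈ children P Q, R) ≤ 2⁻¹ * volume Q := by
      refine (measure_biUnion_le volume (hcount Q) id).trans ((hs Q hQ).trans_eq ?_)
      congr 1
      rw [show (1 - 1 / 2 : ℝ) = 2⁻¹ by norm_num, ENNReal.ofReal_inv_of_pos (by norm_num)]
      simp
    have hfin := (hcube Q hQ).volume_ne_top
    have hsplit : 2⁻¹ * volume Q + 2⁻¹ * volume Q ≤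
        volume (Q \ ⋃ R ∈ children P Q, R) + 2⁻¹ * volume Q := by
      rw [← add_mul, ENNReal.inv_two_add_inv_two, one_mul]
      refine (measure_mono (t := Q \ (⋃ R ∈ children P Q, R) ∪ ⋃ R ∈ children P Q, R)
        (by simp)).trans ((measure_union_le _ _).trans ?_)
      gcongr
    have := (ENNReal.add_le_add_iff_right (ENNReal.mul_ne_top (by simp) hfin)).1 hsplit
    exact (ENNReal.inv_mul_le_iff (by simp) (by simp)).1 this
  · have key : ∀ Q ∈ P, ∀ R ∈ P, R ⊂ Q → Disjoint (Q \ ⋃ S ∈ children P Q, S) R := by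
      intro Q hQ R hR hRQ
      obtain ⟨S, hS, hRS⟩ := exists_children_of_ssubset hd hP hQ hR hRQ
      exact Set.disjoint_left.2 fun x hx hxR => hx.2 (Set.mem_biUnion hS (hRS hxR))
    intro Q hQ R hR hne
    rcases nestedFamily_dyadicGrid α Q (hP hQ) R (hP hR) with h | h | h
    · exact ((key R hR Q hQ (h.ssubset_of_ne hne)).mono_right Set.sdiff_subset).symm
    · exact (key Q hQ R hR (h.ssubset_of_ne hne.symm)).mono_right Set.sdiff_subset
    · exact h.mono Set.sdiff_subset Set.sdiff_subset

/-- The Carleson embedding of a sparse family into `L ^ 1`: numbers bounded on each `Q` by the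
values of one function `g` can be summed against `|Q|`. -/
theorem sum_mul_volume_le_of_sparse (hd : 0 < d) {α : Fin d → Fin 3}
    {P : Set (Set (Fin d → ℝ))} (hP : P ⊆ dyadicGrid α)
    (hs : ∀ Q ∈ P, ∑' Q' : children P Q, volume (Q' : Set (Fin d → ℝ))
        ≤ ENNReal.ofReal (1 - 1 / 2) * volume Q)
    {R : Set (Fin d → ℝ)} {G : Finset (Set (Fin d → ℝ))} (hG : ∀ Q ∈ G, Q ∈ P ∧ Q ⊆ R)
    {c : Set (Fin d → ℝ) → ℝ≥0∞} {g : (Fin d → ℝ) → ℝ≥0∞} (hc : ∀ Q ∈ G, ∀ x ∈ Q, c Q ≤ g x) :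
    ∑ Q ∈ G, c Q * volume Q ≤ 2 * ∫⁻ x in R, g x := by
  obtain ⟨E, hE, hdis⟩ := exists_disjoint_subsets_of_sparse hd hP hs
  calc ∑ Q ∈ G, c Q * volume Q ≤ ∑ Q ∈ G, 2 * ∫⁻ x in E Q, g x := by
        refine Finset.sum_le_sum fun Q hQ => ?_
        obtain ⟨hm, hsub, hvol⟩ := hE Q (hG Q hQ).1
        calc c Q * volume Q ≤ c Q * (2 * volume (E Q)) := by gcongr
          _ = 2 * ∫⁻ _ in E Q, c Q := by rw [setLIntegral_const]; ring
          _ ≤ 2 * ∫⁻ x in E Q, g x := by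
              gcongr 2 * ?_
              exact setLIntegral_mono' hm fun x hx => hc Q hQ x (hsub hx)
    _ = 2 * ∫⁻ x in ⋃ Q ∈ G, E Q, g x := by
        rw [← Finset.mul_sum, lintegral_biUnion_finset]
        · exact hdis.subset fun Q hQ => (hG Q hQ).1
        · exact fun Q hQ => (hE Q (hG Q hQ).1).1
    _ ≤ 2 * ∫⁻ x in R, g x := by
        gcongr 2 * ?_
        exact lintegral_mono_set (Set.iUnion₂_subset fun Q hQ =>
          (hE Q (hG Q hQ).1).2.1.trans (hG Q hQ).2)

theorem isCarleson_volume_of_sparse (hd : 0 < d) {α : Fin d → Fin 3}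
    {P : Set (Set (Fin d → ℝ))} (hP : P ⊆ dyadicGrid α)
    (hs : ∀ Q ∈ P, ∑' Q' : children P Q, volume (Q' : Set (Fin d → ℝ))
        ≤ ENNReal.ofReal (1 - 1 / 2) * volume Q) : IsCarleson volume 2 P := by
  intro R hR G hG
  simpa using sum_mul_volume_le_of_sparse hd hP hs hG (c := fun _ => 1) (g := fun _ => 1)
    fun _ _ _ _ => le_rfl

end Cubes

/-! ### Weights, the Fujii-Wilson constant and the limited-range condition -/

section Weights

variable {d : ℕ} {v w : (Fin d → ℝ) → ℝ}

theorem IsWeight.aemeasurable_ofReal (hv : IsWeight v) :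
    AEMeasurable (fun x => ENNReal.ofReal (v x)) volume :=
  hv.1.ennreal_ofReal

theorem IsWeight.enorm_eq (hv : IsWeight v) : ∀ᵐ x, ‖v x‖ₑ = ENNReal.ofReal (v x) := by
  filter_upwards [hv.2] with x hx
  rw [Real.enorm_eq_ofReal hx.le]

theorem weightMeasure_apply {E : Set (Fin d → ℝ)} (hE : MeasurableSet E) :
    weightMeasure v E = ∫⁻ x in E, ENNReal.ofReal (v x) :=
  withDensity_apply _ hE

theorem weightMeasure_absolutelyContinuous : weightMeasure v ≪ volume :=
  withDensity_absolutelyContinuous _ _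

theorem IsWeight.absolutelyContinuous (hv : IsWeight v) : volume ≪ weightMeasure v := by
  refine withDensity_absolutelyContinuous' hv.aemeasurable_ofReal ?_
  filter_upwards [hv.2] with x hx
  exact (ENNReal.ofReal_pos.2 hx).ne'

theorem IsWeight.weightMeasure_ne_zero (hv : IsWeight v) {Q : Set (Fin d → ℝ)} (hQ : IsCube Q) :
    weightMeasure v Q ≠ 0 :=
  fun h => hQ.volume_ne_zero (hv.absolutelyContinuous h)

theorem IsWeight.cubeAvg_one_indicator (hv : IsWeight v) {Q R : Set (Fin d → ℝ)}
    (hQ : MeasurableSet Q) (hR : MeasurableSet R) :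
    cubeAvg 1 (R.indicator v) Q = (volume Q)⁻¹ * weightMeasure v (R ∩ Q) := by
  rw [cubeAvg, eLpNorm_one_eq_lintegral_enorm, lintegral_smul_measure, smul_eq_mul,
    weightMeasure_apply (hR.inter hQ)]
  congr 1
  simp only [enorm_indicator_eq_indicator_enorm]
  rw [setLIntegral_indicator hR]
  exact lintegral_congr_ae (ae_restrict_of_ae hv.enorm_eq)

theorem IsWeight.average_le_cubeMaximal (hv : IsWeight v) {Q R : Set (Fin d → ℝ)}
    (hQ : IsCube Q) (hR : MeasurableSet R) (hQR : Q ⊆ R) {x : Fin d → ℝ} (hx : x ∈ Q) :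
    (volume Q)⁻¹ * weightMeasure v Q ≤ cubeMaximal (R.indicator v) x := by
  have := hv.cubeAvg_one_indicator hQ.measurableSet hR
  rw [Set.inter_eq_self_of_subset_right hQR] at this
  rw [← this]
  exact le_iSup₂_of_le (f := fun Q (_ : IsCube Q) => ⨆ (_ : x ∈ Q), cubeAvg 1 (R.indicator v) Q)
    Q hQ (le_iSup_of_le hx le_rfl)

theorem IsWeight.lintegral_cubeMaximal_le (hv : IsWeight v) {Q : Set (Fin d → ℝ)} (hQ : IsCube Q)
    (hfin : weightMeasure v Q ≠ ∞) :
    ∫⁻ x in Q, cubeMaximal (Q.indicator v) x ≤ fujiiWilsonConst v * weightMeasure v Q := by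
  have h : (weightMeasure v Q)⁻¹ * ∫⁻ x in Q, cubeMaximal (Q.indicator v) x ≤
      fujiiWilsonConst v :=
    le_iSup₂_of_le (f := fun Q (_ : IsCube Q) =>
      (weightMeasure v Q)⁻¹ * ∫⁻ x in Q, cubeMaximal (Q.indicator v) x) Q hQ le_rfl
  rw [ENNReal.inv_mul_le_iff (hv.weightMeasure_ne_zero hQ) hfin] at h
  rwa [mul_comm]

/-- A sparse family satisfies the Carleson condition for `v dx` with constant `2 [v]_FW`. -/
theorem IsWeight.isCarleson_of_sparse (hv : IsWeight v)
    (hfin : ∀ Q, IsCube Q → weightMeasure v Q ≠ ∞) (hd : 0 < d) {α : Fin d → Fin 3}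
    {P : Set (Set (Fin d → ℝ))} (hP : P ⊆ dyadicGrid α)
    (hs : ∀ Q ∈ P, ∑' Q' : children P Q, volume (Q' : Set (Fin d → ℝ))
        ≤ ENNReal.ofReal (1 - 1 / 2) * volume Q) :
    IsCarleson (weightMeasure v) (2 * fujiiWilsonConst v) P := by
  intro R hR G hG
  have hRc := isCube_of_mem_dyadicGrid (hP hR)
  have h := sum_mul_volume_le_of_sparse hd hP hs hG
    (c := fun Q => (volume Q)⁻¹ * weightMeasure v Q) (g := cubeMaximal (R.indicator v))
    fun Q hQ x hx => hv.average_le_cubeMaximal (isCube_of_mem_dyadicGrid (hP (hG Q hQ).1))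
      hRc.measurableSet (hG Q hQ).2 hx
  calc ∑ Q ∈ G, weightMeasure v Q = ∑ Q ∈ G, (volume Q)⁻¹ * weightMeasure v Q * volume Q := by
        refine Finset.sum_congr rfl fun Q hQ => ?_
        have hQc := isCube_of_mem_dyadicGrid (hP (hG Q hQ).1)
        rw [mul_right_comm, ENNReal.inv_mul_cancel hQc.volume_ne_zero hQc.volume_ne_top, one_mul]
    _ ≤ 2 * ∫⁻ x in R, cubeMaximal (R.indicator v) x := h
    _ ≤ 2 * (fujiiWilsonConst v * weightMeasure v R) := by
        gcongr
        exact hv.lintegral_cubeMaximal_le hRc (hfin R hRc)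
    _ = _ := by rw [mul_assoc]

theorem IsWeight.one_le_fujiiWilsonConst (hv : IsWeight v)
    (hfin : ∀ Q, IsCube Q → weightMeasure v Q ≠ ∞) : 1 ≤ fujiiWilsonConst v := by
  have hQ : IsCube (cube (0 : Fin d → ℝ) 1) := ⟨0, 1, one_pos, rfl⟩
  have h1 := hv.lintegral_cubeMaximal_le hQ (hfin _ hQ)
  have h2 : weightMeasure v (cube (0 : Fin d → ℝ) 1) ≤
      ∫⁻ x in cube (0 : Fin d → ℝ) 1, cubeMaximal ((cube (0 : Fin d → ℝ) 1).indicator v) x := by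
    calc weightMeasure v (cube (0 : Fin d → ℝ) 1)
        = ∫⁻ _ in cube (0 : Fin d → ℝ) 1, (volume (cube (0 : Fin d → ℝ) 1))⁻¹ *
            weightMeasure v (cube (0 : Fin d → ℝ) 1) := by
          rw [setLIntegral_const, mul_right_comm,
            ENNReal.inv_mul_cancel hQ.volume_ne_zero hQ.volume_ne_top, one_mul]
      _ ≤ _ := setLIntegral_mono' hQ.measurableSet fun x hx =>
          hv.average_le_cubeMaximal hQ hQ.measurableSet subset_rfl hx
  have h3 := h2.trans h1
  nth_rewrite 1 [← one_mul (weightMeasure v _)] at h3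
  exact (ENNReal.mul_le_mul_iff_left (hv.weightMeasure_ne_zero hQ) (hfin _ hQ)).1 h3

/-- The `A_1` condition controls the maximal function almost everywhere. Up to a factor `3 ^ d`
in the measure, every cube lies in a cube with rational data, and there are countably many of
these. -/
theorem IsWeight.ae_cubeMaximal_le (hv : IsWeight v) {A : ℝ≥0∞}
    (hA : ∀ Q : Set (Fin d → ℝ), IsCube Q → ∀ᵐ x, x ∈ Q →
      (volume Q)⁻¹ * weightMeasure v Q ≤ A * ENNReal.ofReal (v x)) :
    ∀ᵐ x, ∀ Q : Set (Fin d → ℝ), MeasurableSet Q →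
      cubeMaximal (Q.indicator v) x ≤ 3 ^ d * A * ENNReal.ofReal (v x) := by
  have hrat : ∀ᵐ x, ∀ (a : Fin d → ℚ) (ℓ : ℚ), 0 < ℓ → x ∈ cube (fun i => (a i : ℝ)) ℓ →
      (volume (cube (fun i => (a i : ℝ)) ℓ))⁻¹ * weightMeasure v (cube (fun i => (a i : ℝ)) ℓ) ≤
        A * ENNReal.ofReal (v x) := by
    rw [ae_all_iff]; intro a
    rw [ae_all_iff]; intro ℓ
    by_cases hℓ : 0 < ℓ
    · filter_upwards [hA _ ⟨fun i => (a i : ℝ), ℓ, by exact_mod_cast hℓ, rfl⟩] with x hx _ h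
      exact hx h
    · exact Filter.Eventually.of_forall fun x h => absurd h hℓ
  filter_upwards [hrat] with x hx Q hQ
  refine iSup_le fun R => iSup_le fun hR => iSup_le fun hxR => ?_
  rw [hv.cubeAvg_one_indicator hR.measurableSet hQ]
  obtain ⟨a, ℓ, hℓ, rfl⟩ := hR
  have hR : IsCube (cube a ℓ) := ⟨a, ℓ, hℓ, rfl⟩
  -- a rational corner within `ℓ` and a rational side length between `2 ℓ` and `3 ℓ`
  choose a' ha1 ha2 using fun i => exists_rat_btwn (show a i - ℓ < a i by linarith)
  obtain ⟨ℓ', hℓ1, hℓ2⟩ := exists_rat_btwn (show 2 * ℓ < 3 * ℓ by linarith)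
  set R' := cube (fun i => (a' i : ℝ)) ℓ' with hR'
  have hℓ'0 : (0 : ℝ) < ℓ' := by linarith
  have hR'c : IsCube R' := ⟨_, _, hℓ'0, rfl⟩
  have hsub : cube a ℓ ⊆ R' := by
    intro y hy
    rw [hR', mem_cube]
    rw [mem_cube] at hy
    intro i
    have := hy i
    have := ha1 i
    have := ha2 i
    constructor <;> linarith
  have hvol : volume R' ≤ 3 ^ d * volume (cube a ℓ) := by
    rw [hR', volume_cube, volume_cube, ← mul_pow]
    gcongr
    calc ENNReal.ofReal ℓ' ≤ ENNReal.ofReal (3 * ℓ) := ENNReal.ofReal_le_ofReal hℓ2.le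
      _ = 3 * ENNReal.ofReal ℓ := by rw [ENNReal.ofReal_mul (by norm_num)]; norm_num
  have key := hx a' ℓ' (by exact_mod_cast hℓ'0) (hsub hxR)
  rw [← hR', ENNReal.inv_mul_le_iff hR'c.volume_ne_zero hR'c.volume_ne_top] at key
  rw [ENNReal.inv_mul_le_iff hR.volume_ne_zero hR.volume_ne_top]
  calc weightMeasure v (Q ∩ cube a ℓ) ≤ weightMeasure v R' :=
        measure_mono (Set.inter_subset_right.trans hsub)
    _ ≤ volume R' * (A * ENNReal.ofReal (v x)) := key
    _ ≤ 3 ^ d * volume (cube a ℓ) * (A * ENNReal.ofReal (v x)) := by gcongr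
    _ = _ := by ring

theorem IsWeight.fujiiWilsonConst_ne_top (hv : IsWeight v) {A : ℝ≥0∞} (hAt : A ≠ ∞)
    (hA : ∀ Q : Set (Fin d → ℝ), IsCube Q → ∀ᵐ x, x ∈ Q →
      (volume Q)⁻¹ * weightMeasure v Q ≤ A * ENNReal.ofReal (v x))
    (hfin : ∀ Q, IsCube Q → weightMeasure v Q ≠ ∞) : fujiiWilsonConst v ≠ ∞ := by
  refine ne_top_of_le_ne_top (b := 3 ^ d * A) (ENNReal.mul_ne_top (by simp) hAt) ?_
  refine iSup₂_le fun Q hQ => ?_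
  rw [ENNReal.inv_mul_le_iff (hv.weightMeasure_ne_zero hQ) (hfin Q hQ)]
  calc ∫⁻ x in Q, cubeMaximal (Q.indicator v) x
      ≤ ∫⁻ x in Q, 3 ^ d * A * ENNReal.ofReal (v x) := by
        refine lintegral_mono_ae (ae_restrict_of_ae ?_)
        filter_upwards [hv.ae_cubeMaximal_le hA] with x hx
        exact hx Q hQ.measurableSet
    _ = weightMeasure v Q * (3 ^ d * A) := by
        rw [lintegral_const_mul'' _ hv.aemeasurable_ofReal.restrict,
          ← weightMeasure_apply hQ.measurableSet, mul_comm]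

end Weights

section Exponents

variable {r s : ℝ≥0∞}

theorem inv_sub_inv_pos (hrs : r < s) : 0 < r⁻¹ - s⁻¹ :=
  tsub_pos_of_lt (ENNReal.inv_lt_inv.2 hrs)

theorem inv_sub_inv_ne_top (hr : 0 < r) : r⁻¹ - s⁻¹ ≠ ∞ :=
  ENNReal.sub_ne_top (ENNReal.inv_ne_top.2 hr.ne')

/-- The exponent `1 / (1/r - 1/s)` by which a weight is rescaled is positive. -/
theorem rescaling_exponent_pos (hr : 0 < r) (hrs : r < s) : 0 < ((r⁻¹ - s⁻¹)⁻¹).toReal :=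
  ENNReal.toReal_pos (ENNReal.inv_ne_zero.2 (inv_sub_inv_ne_top hr))
    (ENNReal.inv_ne_top.2 (inv_sub_inv_pos hrs).ne')

theorem inv_rescaling_exponent (hr : 0 < r) (hrs : r < s) :
    (((r⁻¹ - s⁻¹)⁻¹).toReal)⁻¹ = r.toReal⁻¹ - (s⁻¹).toReal := by
  rw [ENNReal.toReal_inv, inv_inv, ENNReal.toReal_sub_of_le (ENNReal.inv_le_inv.2 hrs.le)
    (ENNReal.inv_ne_top.2 hr.ne'), ENNReal.toReal_inv]

end Exponents

section LimitedRange

variable {d : ℕ} {w : (Fin d → ℝ) → ℝ} {r s : ℝ≥0∞}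

theorem IsWeight.rescaled (hw : IsWeight w) : IsWeight (rescaledWeight r s w) := by
  refine ⟨hw.1.pow_const _, ?_⟩
  filter_upwards [hw.2] with x hx
  exact Real.rpow_pos_of_pos hx _

theorem IsWeight.ofReal_rescaledWeight (hw : IsWeight w) :
    ∀ᵐ x, ENNReal.ofReal (rescaledWeight r s w x) =
      ENNReal.ofReal (w x) ^ ((r⁻¹ - s⁻¹)⁻¹).toReal := by
  filter_upwards [hw.2] with x hx
  rw [rescaledWeight, ENNReal.ofReal_rpow_of_pos hx]

theorem IsWeight.cubeAvg_eq (hw : IsWeight w) (hr : 0 < r) (hrs : r < s) {Q : Set (Fin d → ℝ)}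
    (hQ : IsCube Q) :
    cubeAvg (r⁻¹ - s⁻¹)⁻¹ w Q =
      ((volume Q)⁻¹ * weightMeasure (rescaledWeight r s w) Q) ^
        (((r⁻¹ - s⁻¹)⁻¹).toReal)⁻¹ := by
  have h0 : (r⁻¹ - s⁻¹)⁻¹ ≠ 0 := ENNReal.inv_ne_zero.2 (inv_sub_inv_ne_top hr)
  have ht : (r⁻¹ - s⁻¹)⁻¹ ≠ ∞ := ENNReal.inv_ne_top.2 (inv_sub_inv_pos hrs).ne'
  rw [cubeAvg, eLpNorm_eq_lintegral_rpow_enorm_toReal h0 ht, lintegral_smul_measure, smul_eq_mul,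
    weightMeasure_apply hQ.measurableSet, one_div]
  congr 2
  refine lintegral_congr_ae (ae_restrict_of_ae ?_)
  filter_upwards [hw.enorm_eq, hw.ofReal_rescaledWeight (r := r) (s := s)] with x h1 h2
  rw [h1, h2]

/-- The `A_1` condition for the rescaled weight. -/
theorem LimitedRangeWeight.ae_average_le (hw : LimitedRangeWeight r r s w) (hr : 0 < r)
    (hrs : r < s) {Q : Set (Fin d → ℝ)} (hQ : IsCube Q) :
    ∀ᵐ x, x ∈ Q → (volume Q)⁻¹ * weightMeasure (rescaledWeight r s w) Q ≤
      limitedRangeConst r r s w ^ ((r⁻¹ - s⁻¹)⁻¹).toReal *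
        ENNReal.ofReal (rescaledWeight r s w x) := by
  have hP := rescaling_exponent_pos hr hrs
  have hle : cubeAvg (r⁻¹ - s⁻¹)⁻¹ w Q * cubeAvg (r⁻¹ - r⁻¹)⁻¹ (fun x => (w x)⁻¹) Q ≤
      limitedRangeConst r r s w :=
    le_iSup₂_of_le (f := fun Q (_ : IsCube Q) =>
      cubeAvg (r⁻¹ - s⁻¹)⁻¹ w Q * cubeAvg (r⁻¹ - r⁻¹)⁻¹ (fun x => (w x)⁻¹) Q) Q hQ le_rfl
  have hexp : (r⁻¹ - r⁻¹)⁻¹ = ∞ := by simp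
  rw [hexp, hw.1.cubeAvg_eq hr hrs hQ] at hle
  have hess : ∀ᵐ x ∂(volume.restrict Q), ‖(w x)⁻¹‖ₑ ≤ cubeAvg ∞ (fun x => (w x)⁻¹) Q := by
    have h := enorm_ae_le_eLpNormEssSup (fun x => (w x)⁻¹) ((volume Q)⁻¹ • volume.restrict Q)
    rw [← eLpNorm_exponent_top] at h
    exact (Measure.ae_ennreal_smul_measure_iff
      (ENNReal.inv_ne_zero.2 hQ.volume_ne_top)).1 h
  rw [ae_restrict_iff' hQ.measurableSet] at hess
  filter_upwards [hess, hw.1.2, hw.1.ofReal_rescaledWeight (r := r) (s := s)] with x h1 h2 h3 hx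
  have hw0 : ENNReal.ofReal (w x) ≠ 0 := (ENNReal.ofReal_pos.2 h2).ne'
  have h4 : ((volume Q)⁻¹ * weightMeasure (rescaledWeight r s w) Q) ^
      (((r⁻¹ - s⁻¹)⁻¹).toReal)⁻¹ * (ENNReal.ofReal (w x))⁻¹ ≤ limitedRangeConst r r s w := by
    refine le_trans ?_ hle
    gcongr
    rw [← ENNReal.ofReal_inv_of_pos h2, ← Real.enorm_eq_ofReal (inv_pos.2 h2).le]
    exact h1 hx
  rw [← div_eq_mul_inv, ENNReal.div_le_iff hw0 ENNReal.ofReal_ne_top,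
    ENNReal.rpow_inv_le_iff hP, ENNReal.mul_rpow_of_nonneg _ _ hP.le, ← h3] at h4
  exact h4

theorem LimitedRangeWeight.weightMeasure_ne_top (hw : LimitedRangeWeight r r s w) (hr : 0 < r)
    (hrs : r < s) {Q : Set (Fin d → ℝ)} (hQ : IsCube Q) :
    weightMeasure (rescaledWeight r s w) Q ≠ ∞ := by
  have hP := rescaling_exponent_pos hr hrs
  intro htop
  have h := hw.ae_average_le hr hrs hQ
  refine hQ.volume_ne_zero (measure_mono_null (fun x hx => ?_) (ae_iff.1 h))
  rw [Set.mem_ofPred_eq]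
  intro hx'
  have := hx' hx
  rw [htop, ENNReal.mul_top (ENNReal.inv_ne_zero.2 hQ.volume_ne_top), top_le_iff] at this
  exact ENNReal.mul_ne_top (ENNReal.rpow_ne_top_of_nonneg hP.le hw.2.ne) ENNReal.ofReal_ne_top this

theorem LimitedRangeWeight.fujiiWilsonConst_ne_top (hw : LimitedRangeWeight r r s w) (hr : 0 < r)
    (hrs : r < s) : fujiiWilsonConst (rescaledWeight r s w) ≠ ∞ :=
  hw.1.rescaled.fujiiWilsonConst_ne_top
    (ENNReal.rpow_ne_top_of_nonneg (rescaling_exponent_pos hr hrs).le hw.2.ne)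
    (fun _ hQ => hw.ae_average_le hr hrs hQ) fun _ hQ => hw.weightMeasure_ne_top hr hrs hQ

theorem LimitedRangeWeight.one_le_fujiiWilsonConst (hw : LimitedRangeWeight r r s w) (hr : 0 < r)
    (hrs : r < s) : 1 ≤ fujiiWilsonConst (rescaledWeight r s w) :=
  hw.1.rescaled.one_le_fujiiWilsonConst fun _ hQ => hw.weightMeasure_ne_top hr hrs hQ

/-- The `A_1` condition in the form in which it acts on `|f| ^ r`; here `γ = 1 - r / s`. -/
theorem LimitedRangeWeight.ae_average_rpow_le (hw : LimitedRangeWeight r r s w) (hr : 0 < r)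
    (hrs : r < s) {Q : Set (Fin d → ℝ)} (hQ : IsCube Q) :
    ∀ᵐ x, x ∈ Q → ((volume Q)⁻¹ * weightMeasure (rescaledWeight r s w) Q) ^
      (1 - r.toReal * (s⁻¹).toReal) ≤
        limitedRangeConst r r s w ^ r.toReal * ENNReal.ofReal (w x) ^ r.toReal := by
  have hP := rescaling_exponent_pos hr hrs
  have hR : 0 < r.toReal := ENNReal.toReal_pos hr.ne' hrs.ne_top
  have hγ : 1 - r.toReal * (s⁻¹).toReal = r.toReal * (((r⁻¹ - s⁻¹)⁻¹).toReal)⁻¹ := by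
    rw [inv_rescaling_exponent hr hrs, mul_sub, mul_inv_cancel₀ hR.ne']
  have hPγ : ((r⁻¹ - s⁻¹)⁻¹).toReal * (r.toReal * (((r⁻¹ - s⁻¹)⁻¹).toReal)⁻¹) = r.toReal := by
    field_simp
  have hγ0 : 0 ≤ r.toReal * (((r⁻¹ - s⁻¹)⁻¹).toReal)⁻¹ := by positivity
  filter_upwards [hw.ae_average_le hr hrs hQ, hw.1.ofReal_rescaledWeight (r := r) (s := s)]
    with x h1 h2 hx
  have := ENNReal.rpow_le_rpow (h1 hx) hγ0
  rwa [h2, ENNReal.mul_rpow_of_nonneg (limitedRangeConst r r s w ^ _) _ hγ0, ← ENNReal.rpow_mul,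
    ← ENNReal.rpow_mul, hPγ, ← hγ] at this

end LimitedRange

/-! ### The sparse form of a function and a dual function -/

section SparseForm

/-- A term of the sparse form in terms of the mixed density; `m` and `n` stand for `|Q|` and `v(Q)`,
`φ` and `τ` for `∫_Q |f| ^ r` and `v(E ∩ Q)`. -/
theorem rpow_mul_rpow_mul_eq {φ τ m n : ℝ≥0∞} (hm : m ≠ 0) (hmt : m ≠ ∞) (hn : n ≠ 0)
    (hnt : n ≠ ∞) {κ γ : ℝ} (hκ : 0 ≤ κ) (hθ : 0 ≤ 1 - κ * (1 - γ)) :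
    (m⁻¹ * φ) ^ κ * (m⁻¹ * τ) ^ (1 - κ * (1 - γ)) * m =
      (φ * m ^ (-γ) * n ^ (γ - 1)) ^ κ * ((τ / n) ^ (1 - κ * (1 - γ)) * n) := by
  set θ := 1 - κ * (1 - γ) with hθdef
  have e1 : m⁻¹ ^ κ * m⁻¹ ^ θ * m = (m ^ (-γ)) ^ κ := by
    conv_lhs => rw [← ENNReal.rpow_one m]
    rw [← ENNReal.rpow_neg, ← ENNReal.rpow_mul, ← ENNReal.rpow_mul, ← ENNReal.rpow_mul,
      ← ENNReal.rpow_add _ _ hm hmt, ENNReal.rpow_one, ← ENNReal.rpow_one m, ← ENNReal.rpow_mul,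
      ← ENNReal.rpow_add _ _ hm hmt, ENNReal.rpow_one]
    congr 1
    rw [hθdef]; ring
  have e2 : (n ^ (γ - 1)) ^ κ * ((n⁻¹) ^ θ * n) = 1 := by
    conv_lhs => rw [← ENNReal.rpow_one n]
    rw [← ENNReal.rpow_neg, ENNReal.rpow_one, ← ENNReal.rpow_mul, ← ENNReal.rpow_mul]
    nth_rewrite 3 [← ENNReal.rpow_one n]
    rw [← ENNReal.rpow_add _ _ hn hnt, ← ENNReal.rpow_add _ _ hn hnt,
      show (γ - 1) * κ + (-1 * θ + 1) = 0 by rw [hθdef]; ring, ENNReal.rpow_zero]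
  rw [ENNReal.mul_rpow_of_nonneg m⁻¹ φ hκ, ENNReal.mul_rpow_of_nonneg m⁻¹ τ hθ,
    ENNReal.mul_rpow_of_nonneg (φ * m ^ (-γ)) _ hκ, ENNReal.mul_rpow_of_nonneg φ _ hκ,
    div_eq_mul_inv, ENNReal.mul_rpow_of_nonneg τ _ hθ]
  calc _ = φ ^ κ * τ ^ θ * (m⁻¹ ^ κ * m⁻¹ ^ θ * m) := by ring
    _ = φ ^ κ * τ ^ θ * (m ^ (-γ)) ^ κ * ((n ^ (γ - 1)) ^ κ * ((n⁻¹) ^ θ * n)) := by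
        rw [e1, e2, mul_one]
    _ = _ := by ring

variable {d : ℕ} {𝕜 : Type*} [RCLike 𝕜] {r s q : ℝ≥0∞}

theorem cubeAvg_rpow_eq (hr : 0 < r) (hrt : r ≠ ∞) (f : (Fin d → ℝ) → 𝕜) {Q : Set (Fin d → ℝ)}
    (hQ : MeasurableSet Q) :
    cubeAvg r f Q ^ q.toReal =
      ((volume Q)⁻¹ * volume.withDensity (fun x => ‖f x‖ₑ ^ r.toReal) Q) ^
        (q.toReal / r.toReal) := by
  rw [cubeAvg, eLpNorm_eq_lintegral_rpow_enorm_toReal hr.ne' hrt, lintegral_smul_measure,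
    smul_eq_mul, withDensity_apply _ hQ, ← ENNReal.rpow_mul]
  congr 1
  ring

/-- The exponent `1 - q / s`, the reciprocal of the Hölder conjugate of `s / q`. -/
theorem toReal_conjExponent_inv (hq : 0 < q) (hqs : q < s) :
    ((ENNReal.conjExponent (s / q)).toReal)⁻¹ = 1 - q.toReal * (s⁻¹).toReal ∧
      0 < 1 - q.toReal * (s⁻¹).toReal ∧ ENNReal.conjExponent (s / q) ≠ 0 ∧
      ENNReal.conjExponent (s / q) ≠ ∞ := by
  have hqt : q ≠ ∞ := hqs.ne_top
  have hs0 : s ≠ 0 := (hq.trans hqs).ne'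
  have h1 : 1 < s / q := by
    rw [ENNReal.lt_div_iff_mul_lt (Or.inl hq.ne') (Or.inl hqt), one_mul]
    exact hqs
  have hinv : (s / q)⁻¹ = q * s⁻¹ := by
    rw [ENNReal.inv_div (Or.inl hqt) (Or.inl hq.ne'), div_eq_mul_inv]
  have hlt : q * s⁻¹ < 1 := by
    rw [← hinv]; exact ENNReal.inv_lt_one.2 h1
  have hadd : (s / q)⁻¹ + (ENNReal.conjExponent (s / q))⁻¹ = 1 :=
    (ENNReal.HolderConjugate.conjExponent h1.le).inv_add_inv_eq_one
  have hc : (ENNReal.conjExponent (s / q))⁻¹ = 1 - q * s⁻¹ := by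
    rw [← hadd, hinv, ENNReal.add_sub_cancel_left hlt.ne_top]
  have hreal : (1 - q * s⁻¹).toReal = 1 - q.toReal * (s⁻¹).toReal := by
    rw [ENNReal.toReal_sub_of_le hlt.le ENNReal.one_ne_top, ENNReal.toReal_mul,
      ENNReal.toReal_one]
  have hne : 1 - q * s⁻¹ ≠ 0 := (tsub_pos_of_lt hlt).ne'
  have hnt : 1 - q * s⁻¹ ≠ ∞ := ENNReal.sub_ne_top ENNReal.one_ne_top
  refine ⟨?_, ?_, ?_, ?_⟩
  · rw [← ENNReal.toReal_inv, hc, hreal]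
  · rw [← hreal]; exact ENNReal.toReal_pos hne hnt
  · intro h; rw [h, ENNReal.inv_zero] at hc; exact hnt hc.symm
  · intro h; rw [h, ENNReal.inv_top] at hc; exact hne hc.symm

/-- The function `v ^ (1 - q / s)` on `E`, which serves as the dual function for the set `E`. -/
noncomputable def dualFunction (s q : ℝ≥0∞) (v : (Fin d → ℝ) → ℝ) (E : Set (Fin d → ℝ)) :
    (Fin d → ℝ) → ℝ :=
  E.indicator fun x => v x ^ (1 - q.toReal * (s⁻¹).toReal)

theorem IsWeight.enorm_dualFunction {v : (Fin d → ℝ) → ℝ} (hv : IsWeight v)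
    (E : Set (Fin d → ℝ)) : ∀ᵐ x, ‖dualFunction s q v E x‖ₑ =
      E.indicator (fun x => ENNReal.ofReal (v x) ^ (1 - q.toReal * (s⁻¹).toReal)) x := by
  filter_upwards [hv.2] with x hx
  rw [dualFunction, enorm_indicator_eq_indicator_enorm]
  by_cases hxE : x ∈ E
  · rw [Set.indicator_of_mem hxE, Set.indicator_of_mem hxE,
      Real.enorm_eq_ofReal (Real.rpow_pos_of_pos hx _).le, ENNReal.ofReal_rpow_of_pos hx]
  · rw [Set.indicator_of_notMem hxE, Set.indicator_of_notMem hxE]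

theorem IsWeight.cubeAvg_dualFunction {v : (Fin d → ℝ) → ℝ} (hv : IsWeight v) (hq : 0 < q)
    (hqs : q < s) {E Q : Set (Fin d → ℝ)} (hE : MeasurableSet E) (hQ : MeasurableSet Q) :
    cubeAvg (ENNReal.conjExponent (s / q)) (dualFunction s q v E) Q =
      ((volume Q)⁻¹ * (weightMeasure v).restrict E Q) ^ (1 - q.toReal * (s⁻¹).toReal) := by
  obtain ⟨h1, h2, h3, h4⟩ := toReal_conjExponent_inv hq hqs
  have hc : 0 < (ENNReal.conjExponent (s / q)).toReal := ENNReal.toReal_pos h3 h4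
  rw [cubeAvg, eLpNorm_eq_lintegral_rpow_enorm_toReal h3 h4, lintegral_smul_measure, smul_eq_mul,
    one_div, h1, Measure.restrict_apply hQ, weightMeasure_apply (hQ.inter hE)]
  congr 2
  have : ∫⁻ x in Q, ‖dualFunction s q v E x‖ₑ ^ (ENNReal.conjExponent (s / q)).toReal =
      ∫⁻ x in Q, E.indicator (fun x => ENNReal.ofReal (v x)) x := by
    refine lintegral_congr_ae (ae_restrict_of_ae ?_)
    filter_upwards [hv.enorm_dualFunction (s := s) (q := q) E] with x hx
    rw [hx]
    by_cases hxE : x ∈ E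
    · rw [Set.indicator_of_mem hxE, Set.indicator_of_mem hxE, ← ENNReal.rpow_mul, ← h1,
        inv_mul_cancel₀ hc.ne', ENNReal.rpow_one]
    · rw [Set.indicator_of_notMem hxE, Set.indicator_of_notMem hxE,
        ENNReal.zero_rpow_of_pos hc]
  rw [this, setLIntegral_indicator hE, Set.inter_comm]

theorem IsWeight.integrable_dualFunction {v : (Fin d → ℝ) → ℝ} (hv : IsWeight v) (hq : 0 < q)
    (hqs : q < s) {E : Set (Fin d → ℝ)} (hE : MeasurableSet E) (hE1 : volume E ≠ ∞)
    (hE2 : weightMeasure v E ≠ ∞) : Integrable (dualFunction s q v E) volume := by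
  obtain ⟨-, h2, -, -⟩ := toReal_conjExponent_inv hq hqs
  have hle : 1 - q.toReal * (s⁻¹).toReal ≤ 1 := by
    have : 0 ≤ q.toReal * (s⁻¹).toReal := by positivity
    linarith
  refine ⟨((hv.1.pow_const _).aestronglyMeasurable.indicator hE), ?_⟩
  rw [HasFiniteIntegral, lintegral_congr_ae (hv.enorm_dualFunction E), lintegral_indicator hE]
  calc ∫⁻ x in E, ENNReal.ofReal (v x) ^ (1 - q.toReal * (s⁻¹).toReal)
      ≤ ∫⁻ x in E, (1 + ENNReal.ofReal (v x)) := by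
        refine lintegral_mono fun x => ?_
        rcases le_total (ENNReal.ofReal (v x)) 1 with h | h
        · exact (ENNReal.rpow_le_one h h2.le).trans le_self_add
        · refine le_trans ?_ le_add_self
          conv_rhs => rw [← ENNReal.rpow_one (ENNReal.ofReal (v x))]
          exact ENNReal.rpow_le_rpow_of_exponent_le h hle
    _ = volume E + weightMeasure v E := by
        rw [lintegral_add_left measurable_const, setLIntegral_one, weightMeasure_apply hE]
    _ < ∞ := ENNReal.add_lt_top.2 ⟨hE1.lt_top, hE2.lt_top⟩

/-- The measure `|f| ^ r dx`. -/
noncomputable def powerMeasure (r : ℝ≥0∞) (f : (Fin d → ℝ) → 𝕜) : Measure (Fin d → ℝ) :=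
  volume.withDensity fun x => ‖f x‖ₑ ^ r.toReal

/-- The measure `[w] ^ r |f w| ^ r dx`. -/
noncomputable def weightedPowerMeasure (r s : ℝ≥0∞) (w : (Fin d → ℝ) → ℝ)
    (f : (Fin d → ℝ) → 𝕜) : Measure (Fin d → ℝ) :=
  volume.withDensity fun x => limitedRangeConst r r s w ^ r.toReal * ‖w x • f x‖ₑ ^ r.toReal

variable {w : (Fin d → ℝ) → ℝ} {f : (Fin d → ℝ) → 𝕜}

theorem weightedPowerMeasure_univ (hr : 0 < r) (hrs : r < s) (hw : LimitedRangeWeight r r s w) :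
    weightedPowerMeasure r s w f Set.univ =
      (limitedRangeConst r r s w * weightedLpNorm f r w) ^ r.toReal := by
  have hR : 0 < r.toReal := ENNReal.toReal_pos hr.ne' hrs.ne_top
  rw [weightedPowerMeasure, withDensity_apply _ MeasurableSet.univ, setLIntegral_univ,
    lintegral_const_mul' _ _ (ENNReal.rpow_ne_top_of_nonneg hR.le hw.2.ne),
    ENNReal.mul_rpow_of_nonneg _ _ hR.le, weightedLpNorm,
    eLpNorm_eq_lintegral_rpow_enorm_toReal hr.ne' hrs.ne_top, ← ENNReal.rpow_mul, one_div,
    inv_mul_cancel₀ hR.ne', ENNReal.rpow_one]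

/-- The limited range condition compares the two measures built from `f`. -/
theorem LimitedRangeWeight.rpow_mul_powerMeasure_le (hw : LimitedRangeWeight r r s w)
    (hr : 0 < r) (hrs : r < s) {Q E : Set (Fin d → ℝ)} (hQ : IsCube Q) (hEQ : E ⊆ Q)
    (hE : MeasurableSet E) :
    (weightMeasure (rescaledWeight r s w) Q / volume Q) ^ (1 - r.toReal * (s⁻¹).toReal) *
      powerMeasure r f E ≤ weightedPowerMeasure r s w f E := by
  have hR : 0 < r.toReal := ENNReal.toReal_pos hr.ne' hrs.ne_top
  rw [powerMeasure, weightedPowerMeasure, withDensity_apply _ hE, withDensity_apply _ hE]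
  refine (lintegral_const_mul_le _ _).trans (setLIntegral_mono_ae' hE ?_)
  filter_upwards [hw.ae_average_rpow_le hr hrs hQ, hw.1.enorm_eq] with x hx hwx hxE
  rw [enorm_smul, hwx, ENNReal.mul_rpow_of_nonneg _ _ hR.le, ← mul_assoc]
  gcongr
  rw [div_eq_mul_inv, mul_comm (weightMeasure _ _)]
  exact hx (hEQ hxE)

theorem BddCompactSupp.powerMeasure_ne_top (hf : BddCompactSupp f)
    {Q : Set (Fin d → ℝ)} (hQ : IsCube Q) : powerMeasure r f Q ≠ ∞ := by
  obtain ⟨C, hC⟩ : ∃ C : ℝ≥0∞, C ≠ ∞ ∧ ∀ᵐ x, ‖f x‖ₑ ≤ C :=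
    ⟨eLpNormEssSup f volume, by
      have := hf.1.2; rw [eLpNorm_exponent_top] at this; exact this.ne,
      enorm_ae_le_eLpNormEssSup f volume⟩
  rw [powerMeasure, withDensity_apply _ hQ.measurableSet]
  refine ne_top_of_le_ne_top (b := C ^ r.toReal * volume Q)
    (ENNReal.mul_ne_top (ENNReal.rpow_ne_top_of_nonneg ENNReal.toReal_nonneg hC.1)
      hQ.volume_ne_top) ?_
  rw [← setLIntegral_const]
  refine lintegral_mono_ae (ae_restrict_of_ae ?_)
  filter_upwards [hC.2] with x hx
  gcongr

theorem LimitedRangeWeight.dyadicFamily (hw : LimitedRangeWeight r r s w) (hr : 0 < r)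
    (hrs : r < s) (α : Fin d → Fin 3) :
    DyadicFamily volume (weightMeasure (rescaledWeight r s w)) (dyadicGrid α) where
  nested := nestedFamily_dyadicGrid α
  measurableSet _ hQ := (isCube_of_mem_dyadicGrid hQ).measurableSet
  left_ne_zero _ hQ := (isCube_of_mem_dyadicGrid hQ).volume_ne_zero
  left_ne_top _ hQ := (isCube_of_mem_dyadicGrid hQ).volume_ne_top
  right_ne_zero _ hQ := hw.1.rescaled.weightMeasure_ne_zero (isCube_of_mem_dyadicGrid hQ)
  right_ne_top _ hQ := hw.weightMeasure_ne_top hr hrs (isCube_of_mem_dyadicGrid hQ)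

theorem exponent_identity (hr : 0 < r) (hrs : r < s) :
    1 - q.toReal / r.toReal * (1 - (1 - r.toReal * (s⁻¹).toReal)) =
      1 - q.toReal * (s⁻¹).toReal := by
  have hR : 0 < r.toReal := ENNReal.toReal_pos hr.ne' hrs.ne_top
  field_simp
  ring

theorem one_sub_mul_toReal_inv_pos (hr : 0 < r) (hrs : r < s) :
    0 < 1 - r.toReal * (s⁻¹).toReal :=
  (toReal_conjExponent_inv hr hrs).2.1

/-- The set where the maximal function of the mixed density of `f` exceeds `L`. -/
noncomputable def exceptionalSet (r s : ℝ≥0∞) (w : (Fin d → ℝ) → ℝ) (f : (Fin d → ℝ) → 𝕜)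
    (L : ℝ≥0∞) : Set (Fin d → ℝ) :=
  ⋃ α : Fin d → Fin 3, ⋃ Q ∈ {Q ∈ dyadicGrid α | L < mixedDensity volume
    (weightMeasure (rescaledWeight r s w)) (powerMeasure r f) (1 - r.toReal * (s⁻¹).toReal) Q}, Q

theorem measurableSet_exceptionalSet (L : ℝ≥0∞) : MeasurableSet (exceptionalSet r s w f L) :=
  MeasurableSet.iUnion fun α => MeasurableSet.biUnion
    ((countable_dyadicGrid α).mono (Set.sep_subset _ _))
    fun _ hQ => (isCube_of_mem_dyadicGrid hQ.1).measurableSet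

theorem LimitedRangeWeight.mul_measure_exceptionalSet_le (hw : LimitedRangeWeight r r s w)
    (hr : 0 < r) (hrs : r < s) (L : ℝ≥0∞) :
    L * weightMeasure (rescaledWeight r s w) (exceptionalSet r s w f L) ≤
      3 ^ d * weightedPowerMeasure r s w f Set.univ := by
  have hγ := one_sub_mul_toReal_inv_pos hr hrs
  calc L * weightMeasure (rescaledWeight r s w) (exceptionalSet r s w f L)
      ≤ ∑ α : Fin d → Fin 3, L * weightMeasure (rescaledWeight r s w)
          (⋃ Q ∈ {Q ∈ dyadicGrid α | L < mixedDensity volume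
            (weightMeasure (rescaledWeight r s w)) (powerMeasure r f)
            (1 - r.toReal * (s⁻¹).toReal) Q}, Q) := by
        rw [← Finset.mul_sum]
        gcongr
        exact measure_iUnion_fintype_le _ _
    _ ≤ ∑ _α : Fin d → Fin 3, weightedPowerMeasure r s w f Set.univ := by
        refine Finset.sum_le_sum fun α _ => ?_
        have hD := hw.dyadicFamily hr hrs α
        refine (hD.nested.mono (Set.sep_subset _ _)).mul_measure_sUnion_le_of_countable
          ((countable_dyadicGrid α).mono (Set.sep_subset _ _))
          (fun Q hQ => hD.measurableSet Q hQ.1) fun Q hQ => ?_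
        calc L * weightMeasure (rescaledWeight r s w) Q
            ≤ mixedDensity volume (weightMeasure (rescaledWeight r s w)) (powerMeasure r f)
              (1 - r.toReal * (s⁻¹).toReal) Q * weightMeasure (rescaledWeight r s w) Q := by
              gcongr
              exact hQ.2.le
          _ ≤ weightedPowerMeasure r s w f Q := by
              rw [mixedDensity_mul_right hγ.le (hD.right_ne_zero Q hQ.1)
                (hD.right_ne_top Q hQ.1)]
              exact hw.rpow_mul_powerMeasure_le hr hrs (isCube_of_mem_dyadicGrid hQ.1) subset_rfl
                (hD.measurableSet Q hQ.1)
    _ = _ := by simp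

/-- The sparse form of `f` and of the dual function of a set avoiding the exceptional set. -/
theorem exists_sparse_form_le (hd : 0 < d) (hr : 0 < r) (hrs : r < s) (hq : 0 < q)
    (hqs : q < s) :
    ∃ C : ℝ≥0, ∀ (w : (Fin d → ℝ) → ℝ), LimitedRangeWeight r r s w →
      ∀ f : (Fin d → ℝ) → 𝕜, BddCompactSupp f →
      ∀ (E : Set (Fin d → ℝ)) (L V : ℝ≥0∞), MeasurableSet E →
      Disjoint E (exceptionalSet r s w f L) → L ≠ 0 → L ≠ ∞ →
      weightedPowerMeasure r s w f Set.univ ≤ L * V →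
      weightMeasure (rescaledWeight r s w) E ≤ V →
      ∀ S : Set (Set (Fin d → ℝ)), IsSparse (1 / 2) S →
      ∑' Q : S, cubeAvg r f Q ^ q.toReal * cubeAvg (ENNReal.conjExponent (s / q))
        (dualFunction s q (rescaledWeight r s w) E) Q * volume (Q : Set (Fin d → ℝ)) ≤
      C * (L ^ (q.toReal / r.toReal) * V * packingFactor (q.toReal / r.toReal)
        (2 * fujiiWilsonConst (rescaledWeight r s w))) := by
  have hR : 0 < r.toReal := ENNReal.toReal_pos hr.ne' hrs.ne_top
  have hq0 : 0 < q.toReal := ENNReal.toReal_pos hq.ne' hqs.ne_top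
  have hκ : 0 < q.toReal / r.toReal := by positivity
  have hγ := one_sub_mul_toReal_inv_pos hr hrs
  have hγ1 : 1 - r.toReal * (s⁻¹).toReal ≤ 1 := by
    have : 0 ≤ r.toReal * (s⁻¹).toReal := by positivity
    linarith
  have hθeq := exponent_identity (q := q) hr hrs
  have hθ : 0 < 1 - q.toReal / r.toReal * (1 - (1 - r.toReal * (s⁻¹).toReal)) := by
    rw [hθeq]; exact one_sub_mul_toReal_inv_pos hq hqs
  obtain ⟨C, hC⟩ := exists_sum_mixedDensity_le (Fin d → ℝ) hγ hγ1 hκ hθ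
  refine ⟨3 ^ d * C, fun w hw f hf E L V hE hEL hL0 hLt hΨ hV S hS => ?_⟩
  set ν := weightMeasure (rescaledWeight r s w) with hν
  set B := L ^ (q.toReal / r.toReal) * V * packingFactor (q.toReal / r.toReal)
    (2 * fujiiWilsonConst (rescaledWeight r s w)) with hB
  obtain ⟨S', rfl, hS'⟩ := hS
  set F : Set (Fin d → ℝ) → ℝ≥0∞ := fun Q => cubeAvg r f Q ^ q.toReal *
    cubeAvg (ENNReal.conjExponent (s / q)) (dualFunction s q (rescaledWeight r s w) E) Q *
    volume Q with hF
  have hgrid : ∀ α, ∑' Q : S' α, F Q ≤ C * B := by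
    intro α
    obtain ⟨hP, hs⟩ := hS' α
    have hD := hw.dyadicFamily hr hrs α
    refine ENNReal.summable.tsum_le_of_sum_le fun G => ?_
    classical
    set G' : Finset (Set (Fin d → ℝ)) := G.image Subtype.val with hG'
    have hG'P : (G' : Set (Set (Fin d → ℝ))) ⊆ S' α := by
      intro Q hQ
      simp only [hG', Finset.coe_image, Set.mem_image] at hQ
      obtain ⟨Q, -, rfl⟩ := hQ
      exact Q.2
    have hG'D := hG'P.trans hP
    have hterm : ∀ Q ∈ G', F Q = mixedDensity volume ν (powerMeasure r f)
        (1 - r.toReal * (s⁻¹).toReal) Q ^ (q.toReal / r.toReal) *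
        ((ν.restrict E Q / ν Q) ^
          (1 - q.toReal / r.toReal * (1 - (1 - r.toReal * (s⁻¹).toReal))) * ν Q) := by
      intro Q hQ
      have hQD := hG'D hQ
      rw [hF, mixedDensity, ← rpow_mul_rpow_mul_eq (hD.left_ne_zero Q hQD) (hD.left_ne_top Q hQD)
        (hD.right_ne_zero Q hQD) (hD.right_ne_top Q hQD) hκ.le hθ.le]
      simp only
      rw [cubeAvg_rpow_eq hr hrs.ne_top f (hD.measurableSet Q hQD),
        hw.1.rescaled.cubeAvg_dualFunction hq hqs hE (hD.measurableSet Q hQD), hθeq]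
      rfl
    have hsum : ∑ Q ∈ G, F Q = ∑ Q ∈ G', F Q := by
      rw [hG', Finset.sum_image fun _ _ _ _ h => Subtype.ext h]
    have hFW : 1 ≤ 2 * fujiiWilsonConst (rescaledWeight r s w) :=
      le_mul_of_one_le_of_le (by norm_num) (hw.one_le_fujiiWilsonConst hr hrs)
    rw [hsum, Finset.sum_congr rfl hterm]
    refine hC volume ν (powerMeasure r f) (weightedPowerMeasure r s w f) (ν.restrict E) G' _ L V
      (hD.mono hG'D) ((isCarleson_volume_of_sparse hd hP hs).mono hG'P)
      ((hw.1.rescaled.isCarleson_of_sparse (fun Q hQ => hw.weightMeasure_ne_top hr hrs hQ)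
        hd hP hs).mono hG'P) hFW
      (ENNReal.mul_ne_top (by simp) (hw.fujiiWilsonConst_ne_top hr hrs))
      (fun Q hQ => hf.powerMeasure_ne_top (isCube_of_mem_dyadicGrid (hG'D hQ)))
      (fun Q hQ A hAQ hA => hw.rpow_mul_powerMeasure_le hr hrs
        (isCube_of_mem_dyadicGrid (hG'D hQ)) hAQ hA)
      Measure.restrict_le_self hL0 hLt (fun Q hQ hτ => ?_) hΨ (by simpa using hV)
    by_contra hlt
    refine hτ ?_
    rw [Measure.restrict_apply (hD.measurableSet Q (hG'D hQ))]
    have hsub : Q ⊆ exceptionalSet r s w f L := fun x hx =>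
      Set.mem_iUnion.2 ⟨α, Set.mem_biUnion ⟨hG'D hQ, not_le.1 hlt⟩ hx⟩
    rw [(hEL.mono_right hsub).symm.inter_eq, measure_empty]
  calc ∑' Q : (⋃ α, S' α : Set (Set (Fin d → ℝ))), F Q ≤ ∑ α, ∑' Q : S' α, F Q :=
        ENNReal.tsum_iUnion_le F S'
    _ ≤ ∑ _α : Fin d → Fin 3, C * B := Finset.sum_le_sum fun α _ => hgrid α
    _ = _ := by simp [mul_assoc]

end SparseForm

/-! ### The weak-type estimate -/

section WeakType

variable {d : ℕ} {𝕜 : Type*} [RCLike 𝕜] {r s q : ℝ≥0∞} {w : (Fin d → ℝ) → ℝ}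

theorem packingFactor_two_mul_le {κ : ℝ} (hκ : 0 < κ) {H : ℝ≥0∞} (hH : 1 ≤ H) (hHt : H ≠ ∞) :
    packingFactor κ (2 * H) ≤ 2 * packingFactor κ H := by
  rw [packingFactor, packingFactor]
  split_ifs with h
  · have hlog : ENNReal.ofReal (1 + Real.log (2 * H).toReal) ≤
        2 * ENNReal.ofReal (1 + Real.log H.toReal) := by
      have hH1 : 1 ≤ H.toReal := by
        rw [← ENNReal.toReal_one]; exact ENNReal.toReal_mono hHt hH
      rw [ENNReal.toReal_mul, ENNReal.toReal_ofNat, Real.log_mul (by norm_num) (by linarith),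
        show (2 : ℝ≥0∞) = ENNReal.ofReal 2 by simp, ← ENNReal.ofReal_mul (by norm_num)]
      refine ENNReal.ofReal_le_ofReal ?_
      have h1 := Real.log_nonneg hH1
      have h2 := Real.log_two_lt_d9
      linarith
    calc (2 * H) ^ (1 - κ) * ENNReal.ofReal (1 + Real.log (2 * H).toReal) ^ κ
        ≤ (2 * H) ^ (1 - κ) * (2 * ENNReal.ofReal (1 + Real.log H.toReal)) ^ κ := by gcongr
      _ = 2 ^ (1 - κ) * 2 ^ κ * (H ^ (1 - κ) * ENNReal.ofReal (1 + Real.log H.toReal) ^ κ) := by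
          rw [ENNReal.mul_rpow_of_nonneg _ _ (by linarith), ENNReal.mul_rpow_of_nonneg _ _ hκ.le]
          ring
      _ = _ := by
          rw [← ENNReal.rpow_add _ _ (by simp) (by simp)]
          simp
  · norm_num

/-- The weight enters through the `q`-th root of the factor coming from the sum over levels. -/
theorem weightFactor_eq (hr : 0 < r) (hrs : r < s) (hq : 0 < q) (hqs : q < s) :
    weightFactor r s q w = limitedRangeConst r r s w *
      packingFactor (q.toReal / r.toReal) (fujiiWilsonConst (rescaledWeight r s w)) ^
        (1 / q.toReal) := by
  have hR : 0 < r.toReal := ENNReal.toReal_pos hr.ne' hrs.ne_top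
  have hq0 : 0 < q.toReal := ENNReal.toReal_pos hq.ne' hqs.ne_top
  have hiff : q ≤ r ↔ q.toReal / r.toReal ≤ 1 := by
    rw [div_le_one hR, ENNReal.toReal_le_toReal hqs.ne_top hrs.ne_top]
  rw [weightFactor, packingFactor]
  simp only [hiff]
  split_ifs with h
  · rw [ENNReal.mul_rpow_of_nonneg _ _ (by positivity), ← ENNReal.rpow_mul, ← ENNReal.rpow_mul,
      mul_assoc]
    congr 3
    · field_simp
    · field_simp
  · simp

theorem LimitedRangeWeight.weightFactor_ne_top (hw : LimitedRangeWeight r r s w) (hr : 0 < r)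
    (hrs : r < s) (hq : 0 < q) : weightFactor r s q w ≠ ∞ := by
  rw [weightFactor]
  split_ifs with h
  · have hqt : q ≠ ∞ := ne_top_of_le_ne_top hrs.ne_top h
    have hq0 : 0 < q.toReal := ENNReal.toReal_pos hq.ne' hqt
    have hle : q.toReal ≤ r.toReal := ENNReal.toReal_mono hrs.ne_top h
    refine ENNReal.mul_ne_top (ENNReal.mul_ne_top hw.2.ne ?_) ?_
    · refine ENNReal.rpow_ne_top_of_nonneg ?_ (hw.fujiiWilsonConst_ne_top hr hrs)
      exact sub_nonneg.2 (one_div_le_one_div_of_le hq0 hle)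
    · exact ENNReal.rpow_ne_top_of_nonneg (by positivity) ENNReal.ofReal_ne_top
  · exact hw.2.ne

/-- The distributional estimate on a bounded set. The dual function is that of the part of the set
outside the exceptional set, whose level is chosen so that at least half of the measure remains. -/
theorem exists_mul_measure_rpow_le_of_bounded (hd : 0 < d) (hr : 0 < r) (hrs : r < s) (hq : 0 < q)
    (hqs : q < s) :
    ∃ C : ℝ≥0, ∀ (K : ℝ≥0) (T : ((Fin d → ℝ) → 𝕜) → ((Fin d → ℝ) → 𝕜)),
      SparseDominated r s q K T → ∀ w : (Fin d → ℝ) → ℝ, LimitedRangeWeight r r s w →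
      ∀ f : (Fin d → ℝ) → 𝕜, BddCompactSupp f → ∀ (N t : ℝ≥0∞), N ≠ 0 → N ≠ ∞ →
      weightedPowerMeasure r s w f Set.univ ≤ N →
      ∀ E Q : Set (Fin d → ℝ), MeasurableSet E → IsCube Q → E ⊆ Q →
      (∀ x ∈ E, t < ‖rescaledWeight r s w x ^ (-(s⁻¹).toReal) • T f x‖ₑ) →
      t ^ q.toReal * weightMeasure (rescaledWeight r s w) E ^ (q.toReal / r.toReal) ≤
        C * K ^ q.toReal * (N ^ (q.toReal / r.toReal) * packingFactor (q.toReal / r.toReal)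
          (fujiiWilsonConst (rescaledWeight r s w))) := by
  have hR : 0 < r.toReal := ENNReal.toReal_pos hr.ne' hrs.ne_top
  have hq0 : 0 < q.toReal := ENNReal.toReal_pos hq.ne' hqs.ne_top
  have hκ : 0 < q.toReal / r.toReal := by positivity
  obtain ⟨C, hC⟩ := exists_sparse_form_le (𝕜 := 𝕜) hd hr hrs hq hqs
  set κ := q.toReal / r.toReal with hκdef
  set D : ℝ≥0∞ := 2 * 3 ^ d with hD
  have hD0 : D ≠ 0 := by simp [hD]
  have hDt : D ≠ ∞ := ENNReal.mul_ne_top (by simp) (by simp)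
  have hDκ : D ^ κ ≠ ∞ := ENNReal.rpow_ne_top_of_nonneg hκ.le hDt
  refine ⟨4 * C * (D ^ κ).toNNReal, fun K T hT w hw f hf N t hN0 hNt hN E Q hE hQ hEQ hEt => ?_⟩
  set v := rescaledWeight r s w with hvdef
  have hv : IsWeight v := hw.1.rescaled
  set ν := weightMeasure v with hν
  set V := ν E with hV
  have hVt : V ≠ ∞ := ne_top_of_le_ne_top (hw.weightMeasure_ne_top hr hrs hQ) (measure_mono hEQ)
  rcases eq_or_ne V 0 with hV0 | hV0
  · rw [hV0, ENNReal.zero_rpow_of_pos hκ, mul_zero]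
    exact zero_le
  set L := D * N / V with hL
  have hLt : L ≠ ∞ := ENNReal.div_ne_top (ENNReal.mul_ne_top hDt hNt) hV0
  have hL0 : L ≠ 0 := ENNReal.div_ne_zero.2 ⟨mul_ne_zero hD0 hN0, hVt⟩
  have hLV : L * V = D * N := ENNReal.div_mul_cancel hV0 hVt
  set U := exceptionalSet r s w f L with hU
  have hUm : MeasurableSet U := measurableSet_exceptionalSet L
  -- the exceptional set covers at most half of `E`
  have hUle : ν U ≤ V / 2 := by
    have h1 : L * ν U ≤ L * (V / 2) := by
      calc L * ν U ≤ 3 ^ d * weightedPowerMeasure r s w f Set.univ :=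
            hw.mul_measure_exceptionalSet_le hr hrs L
        _ ≤ 3 ^ d * N := by gcongr
        _ = 2⁻¹ * (D * N) := by
            rw [hD, ← mul_assoc, ← mul_assoc, ENNReal.inv_mul_cancel (by simp) (by simp), one_mul]
        _ = L * (V / 2) := by rw [← hLV, ENNReal.div_eq_inv_mul]; ring
    exact (ENNReal.mul_le_mul_iff_right hL0 hLt).1 h1
  set E' := E \ U with hE'
  have hE'm : MeasurableSet E' := hE.diff hUm
  have hE'V : ν E' ≤ V := measure_mono Set.sdiff_subset
  have hhalf : V / 2 ≤ ν E' := by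
    have h1 : V / 2 + V / 2 ≤ ν E' + V / 2 := by
      rw [ENNReal.add_halves]
      calc V ≤ ν (E' ∪ U) := measure_mono (by simp [hE'])
        _ ≤ ν E' + ν U := measure_union_le _ _
        _ ≤ _ := by gcongr
    exact (ENNReal.add_le_add_iff_right (ENNReal.div_ne_top hVt (by simp))).1 h1
  obtain ⟨hTf, hdom⟩ := hT f hf
  obtain ⟨S, hS, hsparse⟩ := hdom (dualFunction s q v E') (hv.integrable_dualFunction hq hqs hE'm
    (ne_top_of_le_ne_top hQ.volume_ne_top (measure_mono (Set.sdiff_subset.trans hEQ)))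
    (ne_top_of_le_ne_top hVt hE'V))
  have hform := hC w hw f hf E' L V hE'm Set.disjoint_sdiff_left hL0 hLt
    (by rw [hLV]
        refine hN.trans (le_mul_of_one_le_left' ?_)
        rw [hD]
        exact one_le_mul_of_one_le_of_one_le (by norm_num) (one_le_pow₀ (by norm_num))) hE'V S hS
  -- the dual function turns the lower bound for `T f` into the measure of the set
  have hlow : t ^ q.toReal * ν E' ≤ ∫⁻ x, ‖T f x‖ₑ ^ q.toReal * ‖dualFunction s q v E' x‖ₑ := by
    calc t ^ q.toReal * ν E' = ∫⁻ x in E', t ^ q.toReal * ENNReal.ofReal (v x) := by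
          rw [hν, weightMeasure_apply hE'm, lintegral_const_mul'' _ hv.aemeasurable_ofReal.restrict]
      _ ≤ ∫⁻ x in E', ‖T f x‖ₑ ^ q.toReal * ‖dualFunction s q v E' x‖ₑ := by
          refine setLIntegral_mono_ae' hE'm ?_
          filter_upwards [hv.2, hv.enorm_dualFunction (s := s) (q := q) E'] with x hx hg hxE
          rw [hg, Set.indicator_of_mem hxE]
          have hvx0 : ENNReal.ofReal (v x) ≠ 0 := (ENNReal.ofReal_pos.2 hx).ne'
          have h1 := (hEt x hxE.1).le
          rw [enorm_smul, Real.enorm_eq_ofReal (Real.rpow_pos_of_pos hx _).le,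
            ← ENNReal.ofReal_rpow_of_pos hx] at h1
          calc t ^ q.toReal * ENNReal.ofReal (v x)
              ≤ (ENNReal.ofReal (v x) ^ (-(s⁻¹).toReal) * ‖T f x‖ₑ) ^ q.toReal *
                  ENNReal.ofReal (v x) := by gcongr
            _ = ‖T f x‖ₑ ^ q.toReal * ((ENNReal.ofReal (v x) ^ (-(s⁻¹).toReal)) ^ q.toReal *
                  ENNReal.ofReal (v x) ^ (1 : ℝ)) := by
                rw [ENNReal.mul_rpow_of_nonneg _ _ hq0.le, ENNReal.rpow_one]; ring
            _ = _ := by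
                rw [← ENNReal.rpow_mul, ← ENNReal.rpow_add _ _ hvx0 ENNReal.ofReal_ne_top]
                congr 2; ring
      _ ≤ _ := setLIntegral_le_lintegral _ _
  have hmain : t ^ q.toReal * ν E' ≤
      K ^ q.toReal * (C * (L ^ κ * V * packingFactor κ (2 * fujiiWilsonConst v))) := by
    have h1 := ENNReal.rpow_le_rpow hsparse hq0.le
    rw [ENNReal.mul_rpow_of_nonneg _ _ hq0.le, ← ENNReal.rpow_mul, ← ENNReal.rpow_mul,
      one_div_mul_cancel hq0.ne', ENNReal.rpow_one, ENNReal.rpow_one] at h1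
    refine hlow.trans (h1.trans ?_)
    gcongr
  have hFW1 := hw.one_le_fujiiWilsonConst hr hrs
  have hFWt := hw.fujiiWilsonConst_ne_top hr hrs
  have hLκ : L ^ κ * V ^ κ = D ^ κ * N ^ κ := by
    rw [← ENNReal.mul_rpow_of_nonneg _ _ hκ.le, hLV, ENNReal.mul_rpow_of_nonneg _ _ hκ.le]
  have hchain : t ^ q.toReal * (V / 2) ≤
      K ^ q.toReal * (C * (L ^ κ * V * (2 * packingFactor κ (fujiiWilsonConst v)))) :=
    calc t ^ q.toReal * (V / 2) ≤ t ^ q.toReal * ν E' := mul_le_mul_right hhalf _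
      _ ≤ _ := hmain
      _ ≤ _ := mul_le_mul_right (mul_le_mul_right
          (mul_le_mul_right (packingFactor_two_mul_le hκ hFW1 hFWt) _) _) _
  have hfinal : V * (t ^ q.toReal * V ^ κ) ≤ V * (4 * C * D ^ κ * K ^ q.toReal *
      (N ^ κ * packingFactor κ (fujiiWilsonConst v))) := by
    calc V * (t ^ q.toReal * V ^ κ) = 2 * (V / 2) * (t ^ q.toReal * V ^ κ) := by
          rw [ENNReal.mul_div_cancel (by simp) (by simp)]
      _ = 2 * (t ^ q.toReal * (V / 2)) * V ^ κ := by ring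
      _ ≤ 2 * (K ^ q.toReal * (C * (L ^ κ * V * (2 * packingFactor κ (fujiiWilsonConst v))))) *
            V ^ κ := mul_le_mul_left (mul_le_mul_right hchain _) _
      _ = V * (4 * C * (L ^ κ * V ^ κ) * K ^ q.toReal *
            packingFactor κ (fujiiWilsonConst v)) := by ring
      _ = _ := by rw [hLκ]; ring
  have := (ENNReal.mul_le_mul_iff_right hV0 hVt).1 hfinal
  rw [ENNReal.coe_mul, ENNReal.coe_mul, ENNReal.coe_toNNReal hDκ]
  simpa using this

theorem le_mul_of_forall_gt {x y z : ℝ≥0∞} (hy : y ≠ ∞) (hz : z ≠ ∞)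
    (h : ∀ a, z < a → a ≠ ∞ → x ≤ y * a) : x ≤ y * z := by
  have : (nhdsWithin z (Set.Ioi z)).NeBot := nhdsGT_neBot_of_exists_gt ⟨∞, hz.lt_top⟩
  refine ge_of_tendsto (f := fun a => y * a) (x := nhdsWithin z (Set.Ioi z))
    ((ENNReal.continuous_const_mul hy).tendsto z |>.mono_left nhdsWithin_le_nhds) ?_
  filter_upwards [self_mem_nhdsWithin, nhdsWithin_le_nhds (gt_mem_nhds hz.lt_top)] with a h1 h2
  exact h a h1 h2.ne

/-- The endpoint estimate for bounded functions with compact support. -/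
theorem exists_endpointWeakNorm_le (hd : 0 < d) (hr : 0 < r) (hrs : r < s) (hq : 0 < q)
    (hqs : q < s) :
    ∃ C : ℝ≥0, ∀ (K : ℝ≥0) (T : ((Fin d → ℝ) → 𝕜) → ((Fin d → ℝ) → 𝕜)),
      SparseDominated r s q K T → ∀ w : (Fin d → ℝ) → ℝ, LimitedRangeWeight r r s w →
      ∀ f : (Fin d → ℝ) → 𝕜, BddCompactSupp f → weightedLpNorm f r w ≠ ∞ →
        endpointWeakNorm r s w (T f) ≤ C * K * weightFactor r s q w * weightedLpNorm f r w := by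
  have hR : 0 < r.toReal := ENNReal.toReal_pos hr.ne' hrs.ne_top
  have hq0 : 0 < q.toReal := ENNReal.toReal_pos hq.ne' hqs.ne_top
  obtain ⟨C, hC⟩ := exists_mul_measure_rpow_le_of_bounded (𝕜 := 𝕜) hd hr hrs hq hqs
  refine ⟨C ^ (1 / q.toReal), fun K T hT w hw f hf hfin => ?_⟩
  set v := rescaledWeight r s w with hvdef
  have hv : IsWeight v := hw.1.rescaled
  set PF := packingFactor (q.toReal / r.toReal) (fujiiWilsonConst v) with hPF
  have hPFt : PF ^ (1 / q.toReal) ≠ ∞ := by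
    refine ENNReal.rpow_ne_top_of_nonneg (by positivity) ?_
    rw [hPF, packingFactor]
    split_ifs with h
    · exact ENNReal.mul_ne_top
        (ENNReal.rpow_ne_top_of_nonneg (by linarith) (hw.fujiiWilsonConst_ne_top hr hrs))
        (ENNReal.rpow_ne_top_of_nonneg (by positivity) ENNReal.ofReal_ne_top)
    · simp
  -- the estimate for bounded measurable parts of the level set
  have key : ∀ (t : ℝ≥0) (E Q : Set (Fin d → ℝ)), MeasurableSet E → IsCube Q → E ⊆ Q →
      (∀ x ∈ E, (t : ℝ≥0∞) < ‖v x ^ (-(s⁻¹).toReal) • T f x‖ₑ) →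
      t * weightMeasure v E ^ (r⁻¹).toReal ≤
        C ^ (1 / q.toReal) * K * weightFactor r s q w * weightedLpNorm f r w := by
    intro t E Q hE hQ hEQ hEt
    have hX : (C : ℝ≥0∞) ^ (1 / q.toReal) * K * PF ^ (1 / q.toReal) ≠ ∞ :=
      ENNReal.mul_ne_top (ENNReal.mul_ne_top
        (ENNReal.rpow_ne_top_of_nonneg (by positivity) (by simp)) (by simp)) hPFt
    have h1 : t * weightMeasure v E ^ (r⁻¹).toReal ≤
        (C : ℝ≥0∞) ^ (1 / q.toReal) * K * PF ^ (1 / q.toReal) *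
          (limitedRangeConst r r s w * weightedLpNorm f r w) := by
      -- the bound `N` has to be positive even if `f` vanishes, so the norm is approached
      -- from above
      refine le_mul_of_forall_gt hX (ENNReal.mul_ne_top hw.2.ne hfin) fun a ha hat => ?_
      have h2 := hC K T hT w hw f hf (a ^ r.toReal) t
        (by simp [ENNReal.rpow_eq_zero_iff, (zero_le.trans_lt ha).ne', hat])
        (ENNReal.rpow_ne_top_of_nonneg hR.le hat)
        (by rw [weightedPowerMeasure_univ hr hrs hw]; gcongr) E Q hE hQ hEQ hEt
      have h3 := ENNReal.rpow_le_rpow h2 (show 0 ≤ 1 / q.toReal by positivity)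
      have hq1 : 0 ≤ 1 / q.toReal := by positivity
      have e1 : q.toReal * (1 / q.toReal) = 1 := mul_one_div_cancel hq0.ne'
      have e2 : q.toReal / r.toReal * (1 / q.toReal) = (r⁻¹).toReal := by
        rw [ENNReal.toReal_inv]; field_simp
      have e3 : r.toReal * (r⁻¹).toReal = 1 := by
        rw [ENNReal.toReal_inv, mul_inv_cancel₀ hR.ne']
      simp only [ENNReal.mul_rpow_of_nonneg _ _ hq1, ← ENNReal.rpow_mul, e1, e2, mul_assoc, e3,
        ENNReal.rpow_one] at h3
      refine h3.trans (le_of_eq ?_)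
      ring
    refine h1.trans (le_of_eq ?_)
    rw [weightFactor_eq hr hrs hq hqs]
    ring
  rw [← ENNReal.coe_rpow_of_nonneg _ (by positivity)] at key
  refine iSup₂_le fun t _ => ?_
  set A := {x | (t : ℝ≥0∞) < ‖v x ^ (-(s⁻¹).toReal) • T f x‖ₑ} with hA
  have hAm : NullMeasurableSet A volume := by
    refine nullMeasurableSet_lt aemeasurable_const ?_
    exact ((hv.1.pow_const _).aestronglyMeasurable.smul (hT f hf).1).enorm
  obtain ⟨E, hEA, hEm, hEae⟩ := hAm.exists_measurable_subset_ae_eq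
  have hmeas : weightMeasure v A = weightMeasure v E :=
    (measure_congr (weightMeasure_absolutelyContinuous.ae_eq hEae)).symm
  set Q : ℕ → Set (Fin d → ℝ) := fun n => cube (fun _ => -((n : ℝ) + 1)) (2 * ((n : ℝ) + 1))
  have hQc : ∀ n, IsCube (Q n) := fun n => ⟨_, _, by positivity, rfl⟩
  have hmono : Monotone fun n => E ∩ Q n := by
    intro m n hmn
    refine Set.inter_subset_inter_right _ fun x hx => ?_
    have hmn' : (m : ℝ) ≤ n := by exact_mod_cast hmn
    rw [mem_cube] at hx ⊢
    intro i
    have := hx i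
    constructor <;> linarith
  have hunion : ⋃ n, E ∩ Q n = E := by
    rw [← Set.inter_iUnion, Set.inter_eq_left]
    intro x _
    obtain ⟨n, hn⟩ := exists_nat_ge ‖x‖
    refine Set.mem_iUnion.2 ⟨n, mem_cube.2 fun i => ?_⟩
    have h1 := (norm_le_pi_norm x i).trans hn
    rw [Real.norm_eq_abs, abs_le] at h1
    constructor <;> linarith
  have hlim := tendsto_measure_iUnion_atTop (μ := weightMeasure v) hmono
  rw [hunion] at hlim
  rw [hmeas]
  refine le_of_tendsto' (ENNReal.Tendsto.const_mul
    (((ENNReal.continuous_rpow_const (y := (r⁻¹).toReal)).tendsto _).comp hlim)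
    (Or.inr ENNReal.coe_ne_top)) fun n => ?_
  exact key t (E ∩ Q n) (Q n) (hEm.inter (hQc n).measurableSet) (hQc n) Set.inter_subset_right
    fun x hx => hEA hx.1

end WeakType

/-! ### Extension to the weighted space -/

section Extension

open Filter Topology

variable {d : ℕ} {𝕜 : Type*} [RCLike 𝕜] {r s q : ℝ≥0∞} {w : (Fin d → ℝ) → ℝ}

theorem BddCompactSupp.sub {f g : (Fin d → ℝ) → 𝕜} (hf : BddCompactSupp f)
    (hg : BddCompactSupp g) : BddCompactSupp (f - g) :=
  ⟨hf.1.sub hg.1, hf.2.sub hg.2⟩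

theorem BddCompactSupp.aestronglyMeasurable {f : (Fin d → ℝ) → 𝕜} (hf : BddCompactSupp f) :
    AEStronglyMeasurable f volume := hf.1.1

theorem exists_isCube_superset {A : Set (Fin d → ℝ)} (hA : Bornology.IsBounded A) :
    ∃ Q, IsCube Q ∧ A ⊆ Q := by
  obtain ⟨R, hR⟩ := hA.subset_closedBall 0
  refine ⟨cube (fun _ => -(|R| + 1)) (2 * (|R| + 1)), ⟨_, _, by positivity, rfl⟩, fun x hx => ?_⟩
  rw [mem_cube]
  intro i
  have h1 : ‖x‖ ≤ R := by simpa using hR hx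
  have h2 := (norm_le_pi_norm x i).trans (h1.trans (le_abs_self R))
  rw [Real.norm_eq_abs, abs_le] at h2
  constructor <;> linarith

/-- Bounded functions with compact support belong to `L ^ r_w`, because `w ^ r` is the power
`1 - r / s ≤ 1` of the locally integrable rescaled weight. -/
theorem LimitedRangeWeight.memWeightedLp (hw : LimitedRangeWeight r r s w) (hr : 0 < r)
    (hrs : r < s) {f : (Fin d → ℝ) → 𝕜} (hf : BddCompactSupp f) : MemWeightedLp f r w := by
  refine ⟨hf.1.1, ?_⟩
  have hR : 0 < r.toReal := ENNReal.toReal_pos hr.ne' hrs.ne_top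
  obtain ⟨Q, hQ, hfQ⟩ := exists_isCube_superset hf.2.isCompact.isBounded
  have hM : eLpNormEssSup f volume ≠ ∞ := by
    have := hf.1.2
    rw [eLpNorm_exponent_top] at this
    exact this.ne
  rw [weightedLpNorm, eLpNorm_lt_top_iff_lintegral_rpow_enorm_lt_top hr.ne' hrs.ne_top]
  set γ := 1 - r.toReal * (s⁻¹).toReal with hγ
  have hγ0 : 0 < γ := one_sub_mul_toReal_inv_pos hr hrs
  have hγ1 : γ ≤ 1 := by
    have : 0 ≤ r.toReal * (s⁻¹).toReal := by positivity
    linarith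
  have hPγ : ((r⁻¹ - s⁻¹)⁻¹).toReal * γ = r.toReal := by
    have h1 := inv_rescaling_exponent hr hrs
    have h2 := rescaling_exponent_pos hr hrs
    have h3 : γ = r.toReal * (((r⁻¹ - s⁻¹)⁻¹).toReal)⁻¹ := by
      rw [h1, mul_sub, mul_inv_cancel₀ hR.ne']
    rw [h3]
    field_simp
  calc ∫⁻ x, ‖w x • f x‖ₑ ^ r.toReal
      ≤ ∫⁻ x, Q.indicator (fun x => eLpNormEssSup f volume ^ r.toReal *
          (1 + ENNReal.ofReal (rescaledWeight r s w x))) x := by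
        refine lintegral_mono_ae ?_
        filter_upwards [enorm_ae_le_eLpNormEssSup f volume, hw.1.enorm_eq,
          hw.1.ofReal_rescaledWeight (r := r) (s := s)] with x h1 h2 h3
        by_cases hx : x ∈ Q
        · rw [Set.indicator_of_mem hx, enorm_smul, ENNReal.mul_rpow_of_nonneg _ _ hR.le, mul_comm,
            h2]
          gcongr
          rw [← hPγ, ENNReal.rpow_mul, ← h3]
          rcases le_total (ENNReal.ofReal (rescaledWeight r s w x)) 1 with h | h
          · exact (ENNReal.rpow_le_one h hγ0.le).trans le_self_add
          · refine le_trans ?_ le_add_self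
            conv_rhs => rw [← ENNReal.rpow_one (ENNReal.ofReal _)]
            exact ENNReal.rpow_le_rpow_of_exponent_le h hγ1
        · have : f x = 0 := image_eq_zero_of_notMem_tsupport fun h => hx (hfQ h)
          simp [this, hR]
    _ = eLpNormEssSup f volume ^ r.toReal *
          (volume Q + weightMeasure (rescaledWeight r s w) Q) := by
        rw [lintegral_indicator hQ.measurableSet,
          lintegral_const_mul' _ _ (ENNReal.rpow_ne_top_of_nonneg hR.le hM),
          lintegral_add_left measurable_const, setLIntegral_one,
          weightMeasure_apply hQ.measurableSet]
    _ < ∞ := ENNReal.mul_lt_top (ENNReal.rpow_lt_top_of_nonneg hR.le hM)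
        (ENNReal.add_lt_top.2 ⟨hQ.volume_ne_top.lt_top, (hw.weightMeasure_ne_top hr hrs hQ).lt_top⟩)

theorem weightedLpNorm_sub_le (hw : IsWeight w) {f g : (Fin d → ℝ) → 𝕜}
    (hf : AEStronglyMeasurable f volume) (hg : AEStronglyMeasurable g volume) :
    weightedLpNorm (f - g) r w ≤
      ENNReal.LpAddConst r * (weightedLpNorm f r w + weightedLpNorm g r w) := by
  have := eLpNorm_sub_le' (hw.1.aestronglyMeasurable.smul hf) (hw.1.aestronglyMeasurable.smul hg) r
  refine le_trans (le_of_eq ?_) this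
  rw [weightedLpNorm]
  congr 1
  ext x
  simp [smul_sub]

/-- Truncation of a function in range and in space. -/
noncomputable def truncation (f : (Fin d → ℝ) → 𝕜) (n : ℕ) : (Fin d → ℝ) → 𝕜 :=
  {x | ‖x‖ ≤ n ∧ ‖f x‖ ≤ n}.indicator f

theorem bddCompactSupp_truncation {f : (Fin d → ℝ) → 𝕜} (hf : AEStronglyMeasurable f volume)
    (n : ℕ) : BddCompactSupp (truncation f n) := by
  have hm : NullMeasurableSet {x | ‖x‖ ≤ n ∧ ‖f x‖ ≤ n} volume := by
    refine NullMeasurableSet.inter ?_ ?_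
    · exact (measurableSet_le measurable_norm measurable_const).nullMeasurableSet
    · exact nullMeasurableSet_le hf.norm.aemeasurable aemeasurable_const
  refine ⟨memLp_top_of_bound (hf.indicator₀ hm) n (Eventually.of_forall fun x => ?_), ?_⟩
  · rw [truncation]
    by_cases hx : x ∈ {x | ‖x‖ ≤ n ∧ ‖f x‖ ≤ n}
    · rw [Set.indicator_of_mem hx]; exact hx.2
    · rw [Set.indicator_of_notMem hx]; simp
  · refine HasCompactSupport.intro (isCompact_closedBall (0 : Fin d → ℝ) n) fun x hx => ?_
    refine Set.indicator_of_notMem (fun h => hx ?_) f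
    simpa using h.1

theorem weightedLpNorm_truncation_le (f : (Fin d → ℝ) → 𝕜) (n : ℕ) :
    weightedLpNorm (truncation f n) r w ≤ weightedLpNorm f r w := by
  refine eLpNorm_mono fun x => ?_
  rw [norm_smul, norm_smul]
  gcongr
  exact norm_indicator_le_norm_self _ _

theorem tendsto_weightedLpNorm_sub_truncation (hw : IsWeight w) (hr : 0 < r) (hrt : r ≠ ∞)
    {f : (Fin d → ℝ) → 𝕜} (hf : MemWeightedLp f r w) :
    Tendsto (fun n => weightedLpNorm (f - truncation f n) r w) atTop (𝓝 0) := by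
  have hR : 0 < r.toReal := ENNReal.toReal_pos hr.ne' hrt
  have hlim : Tendsto (fun n => ∫⁻ x, ‖w x • (f - truncation f n) x‖ₑ ^ r.toReal) atTop
      (𝓝 (∫⁻ _ : Fin d → ℝ, 0)) := by
    refine tendsto_lintegral_of_dominated_convergence'
      (fun x => ‖w x • f x‖ₑ ^ r.toReal) (fun n => ?_) (fun n => ?_) ?_ ?_
    · exact ((hw.1.aestronglyMeasurable.smul
        (hf.1.sub (bddCompactSupp_truncation hf.1 n).aestronglyMeasurable)).enorm).pow_const _
    · refine Eventually.of_forall fun x => ?_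
      simp only [enorm_smul]
      gcongr
      rw [Pi.sub_apply, truncation]
      by_cases hx : x ∈ {x | ‖x‖ ≤ n ∧ ‖f x‖ ≤ n}
      · rw [Set.indicator_of_mem hx]; simp
      · rw [Set.indicator_of_notMem hx]; simp
    · exact ((eLpNorm_lt_top_iff_lintegral_rpow_enorm_lt_top hr.ne' hrt).1 hf.2).ne
    · refine Eventually.of_forall fun x => ?_
      obtain ⟨n, hn⟩ := exists_nat_ge (max ‖x‖ ‖f x‖)
      refine tendsto_const_nhds.congr' ?_
      filter_upwards [eventually_ge_atTop n] with m hm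
      have hm' : (n : ℝ) ≤ m := by exact_mod_cast hm
      have hx : x ∈ {x | ‖x‖ ≤ m ∧ ‖f x‖ ≤ m} :=
        ⟨(le_max_left _ _).trans (hn.trans hm'), (le_max_right _ _).trans (hn.trans hm')⟩
      rw [Pi.sub_apply, truncation, Set.indicator_of_mem hx]
      simp [hR]
  rw [lintegral_zero] at hlim
  have := ((ENNReal.continuous_rpow_const (y := 1 / r.toReal)).tendsto 0).comp hlim
  rw [ENNReal.zero_rpow_of_pos (by positivity)] at this
  refine this.congr fun n => ?_
  rw [weightedLpNorm, eLpNorm_eq_lintegral_rpow_enorm_toReal hr.ne' hrt]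
  rfl

/-- The sequence `u` of bounded functions with compact support converges geometrically to `f` in
`L ^ r_w`. -/
def FastApprox (r : ℝ≥0∞) (w : (Fin d → ℝ) → ℝ) (f : (Fin d → ℝ) → 𝕜)
    (u : ℕ → (Fin d → ℝ) → 𝕜) : Prop :=
  (∀ n, BddCompactSupp (u n)) ∧
    ∃ c : ℝ≥0∞, c ≠ ∞ ∧ ∀ n, weightedLpNorm (f - u n) r w ≤ c * 4⁻¹ ^ n

theorem exists_fastApprox (hw : IsWeight w) (hr : 0 < r) (hrt : r ≠ ∞)
    {f : (Fin d → ℝ) → 𝕜} (hf : MemWeightedLp f r w) :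
    ∃ u, FastApprox r w f u ∧ ∀ n, weightedLpNorm (u n) r w ≤ weightedLpNorm f r w := by
  have hlim := tendsto_weightedLpNorm_sub_truncation hw hr hrt hf
  have h : ∀ k : ℕ, ∃ n, weightedLpNorm (f - truncation f n) r w ≤ 4⁻¹ ^ k := fun k =>
    (hlim.eventually_le_const (ENNReal.pow_pos (by simp) k)).exists
  choose n hn using h
  exact ⟨fun k => truncation f (n k), ⟨fun k => bddCompactSupp_truncation hf.1 _, 1, by simp,
    fun k => by rw [one_mul]; exact hn k⟩, fun k => weightedLpNorm_truncation_le f _⟩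

theorem FastApprox.sub (hw : IsWeight w) {f g : (Fin d → ℝ) → 𝕜}
    {u z : ℕ → (Fin d → ℝ) → 𝕜} (hf : AEStronglyMeasurable f volume)
    (hg : AEStronglyMeasurable g volume) (hu : FastApprox r w f u) (hz : FastApprox r w g z) :
    FastApprox r w (f - g) (fun n => u n - z n) := by
  obtain ⟨hu0, c, hc, hu⟩ := hu
  obtain ⟨hz0, c', hc', hz⟩ := hz
  refine ⟨fun n => (hu0 n).sub (hz0 n), ENNReal.LpAddConst r * (c + c'),
    ENNReal.mul_ne_top (ENNReal.LpAddConst_lt_top r).ne (ENNReal.add_ne_top.2 ⟨hc, hc'⟩),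
    fun n => ?_⟩
  rw [sub_sub_sub_comm]
  refine (weightedLpNorm_sub_le hw (hf.sub (hu0 n).aestronglyMeasurable)
    (hg.sub (hz0 n).aestronglyMeasurable)).trans ?_
  rw [mul_assoc, add_mul]
  gcongr
  · exact hu n
  · exact hz n

/-- Under a weak-type estimate, `T` maps a sequence converging geometrically to zero in `L ^ r_w`
to one which converges geometrically to zero almost everywhere, by the Borel-Cantelli lemma. -/
theorem ae_eventually_norm_le {T : ((Fin d → ℝ) → 𝕜) → ((Fin d → ℝ) → 𝕜)}
    (hw : LimitedRangeWeight r r s w) (hr : 0 < r) (hrs : r < s) {X : ℝ≥0∞} (hX : X ≠ ∞)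
    (hT : ∀ f, BddCompactSupp f → endpointWeakNorm r s w (T f) ≤ X * weightedLpNorm f r w)
    {h : ℕ → (Fin d → ℝ) → 𝕜} (hh : FastApprox r w 0 h) :
    ∀ᵐ x, ∃ B : ℝ, ∀ᶠ n in atTop, ‖T (h n) x‖ ≤ B * (1 / 2) ^ n := by
  have hR : 0 < r.toReal := ENNReal.toReal_pos hr.ne' hrs.ne_top
  obtain ⟨hh0, c, hc, hh⟩ := hh
  set v := rescaledWeight r s w with hvdef
  have hv : IsWeight v := hw.1.rescaled
  set ν := weightMeasure v with hν
  set A : ℕ → Set (Fin d → ℝ) := fun n =>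
    {x | ((2⁻¹ ^ n : ℝ≥0) : ℝ≥0∞) < ‖v x ^ (-(s⁻¹).toReal) • T (h n) x‖ₑ} with hA
  have hAle : ∀ n, ν (A n) ≤ (X * c) ^ r.toReal * ((2 : ℝ≥0∞) ^ (-r.toReal)) ^ n := by
    intro n
    have h1 : ((2⁻¹ ^ n : ℝ≥0) : ℝ≥0∞) * ν (A n) ^ (r⁻¹).toReal ≤ X * (c * 4⁻¹ ^ n) := by
      calc _ ≤ endpointWeakNorm r s w (T (h n)) :=
            le_iSup₂_of_le (f := fun (t : ℝ≥0) (_ : 0 < t) => (t : ℝ≥0∞) *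
              ν {x | (t : ℝ≥0∞) < ‖v x ^ (-(s⁻¹).toReal) • T (h n) x‖ₑ} ^ (r⁻¹).toReal)
              (2⁻¹ ^ n) (by positivity) le_rfl
        _ ≤ X * weightedLpNorm (h n) r w := hT _ (hh0 n)
        _ ≤ X * (c * 4⁻¹ ^ n) := by
            gcongr
            refine le_trans (le_of_eq ?_) (hh n)
            rw [zero_sub, weightedLpNorm, weightedLpNorm, ← eLpNorm_neg]
            congr 1
            ext x
            simp
    have h2 : ν (A n) ^ (r⁻¹).toReal ≤ X * c * 2⁻¹ ^ n := by
      have e : (4⁻¹ : ℝ≥0∞) ^ n = 2⁻¹ ^ n * 2⁻¹ ^ n := by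
        rw [← mul_pow, ← ENNReal.mul_inv (by simp) (by simp)]; norm_num
      have e' : ((2⁻¹ ^ n : ℝ≥0) : ℝ≥0∞) = 2⁻¹ ^ n := by simp [ENNReal.inv_pow]
      rw [e, e'] at h1
      refine (ENNReal.mul_le_mul_iff_right (a := 2⁻¹ ^ n) (by simp) (by simp)).1 (h1.trans ?_)
      refine le_of_eq ?_
      ring
    rw [ENNReal.toReal_inv, ENNReal.rpow_inv_le_iff hR, ENNReal.mul_rpow_of_nonneg _ _ hR.le] at h2
    refine h2.trans (le_of_eq ?_)
    rw [← ENNReal.inv_pow, ENNReal.inv_rpow, two_rpow_pow_comm, ENNReal.rpow_neg]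
  have hsum : ∑' n, ν (A n) ≠ ∞ := by
    refine ne_top_of_le_ne_top ?_ (ENNReal.tsum_le_tsum hAle)
    rw [ENNReal.tsum_mul_left]
    exact ENNReal.mul_ne_top (ENNReal.rpow_ne_top_of_nonneg hR.le (ENNReal.mul_ne_top hX hc))
      (tsum_pow_ne_top (two_rpow_neg_lt_one hR))
  have hae : ∀ᵐ x, ∀ᶠ n in atTop, x ∉ A n :=
    hv.absolutelyContinuous.ae_le (ae_eventually_notMem hsum)
  filter_upwards [hae, hv.2] with x hx hvx
  refine ⟨v x ^ (s⁻¹).toReal, ?_⟩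
  filter_upwards [hx] with n hn
  have hpos : 0 < v x ^ (s⁻¹).toReal := Real.rpow_pos_of_pos hvx _
  have h1 : ‖v x ^ (-(s⁻¹).toReal) • T (h n) x‖₊ ≤ 2⁻¹ ^ n := by
    simpa only [hA, Set.mem_ofPred_eq, not_lt, enorm_eq_nnnorm, ENNReal.coe_le_coe] using hn
  have h2 : ‖v x ^ (-(s⁻¹).toReal) • T (h n) x‖ ≤ (1 / 2) ^ n := by
    have := NNReal.coe_le_coe.2 h1
    rw [one_div]
    exact_mod_cast this
  rw [norm_smul, Real.norm_of_nonneg (Real.rpow_nonneg hvx.le _), Real.rpow_neg hvx.le,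
    inv_mul_le_iff₀ hpos] at h2
  exact h2

/-- The function `F` is the value at `f ∈ L ^ r_w` of the extension of `T`: the almost everywhere
limit of `T (u n)` along every geometrically convergent approximation `u` of `f`. -/
def IsExtensionValue (r : ℝ≥0∞) (w : (Fin d → ℝ) → ℝ)
    (T : ((Fin d → ℝ) → 𝕜) → ((Fin d → ℝ) → 𝕜)) (f F : (Fin d → ℝ) → 𝕜) : Prop :=
  AEStronglyMeasurable F volume ∧
    ∀ u, FastApprox r w f u → ∀ᵐ x, Tendsto (fun n => T (u n) x) atTop (𝓝 (F x))

/-- All geometrically convergent approximations of `f` give the same limit, because the difference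
of any two of them is such an approximation of zero. -/
theorem exists_isExtensionValue {T : ((Fin d → ℝ) → 𝕜) → ((Fin d → ℝ) → 𝕜)}
    (hw : LimitedRangeWeight r r s w) (hr : 0 < r) (hrs : r < s) {X : ℝ≥0∞} (hX : X ≠ ∞)
    (hTm : ∀ f, BddCompactSupp f → AEStronglyMeasurable (T f) volume)
    (hT : ∀ f, BddCompactSupp f → endpointWeakNorm r s w (T f) ≤ X * weightedLpNorm f r w)
    (hsub : ∀ f g : (Fin d → ℝ) → 𝕜, BddCompactSupp f → BddCompactSupp g →
      ∀ᵐ x, ‖T f x - T g x‖ ≤ ‖T (f - g) x‖)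
    {f : (Fin d → ℝ) → 𝕜} (hf : MemWeightedLp f r w) : ∃ F, IsExtensionValue r w T f F := by
  obtain ⟨u, hu, -⟩ := exists_fastApprox hw.1 hr hrs.ne_top hf
  have hshift : FastApprox r w f fun n => u (n + 1) := by
    obtain ⟨hu0, c, hc, hu⟩ := hu
    refine ⟨fun n => hu0 _, c, hc, fun n => (hu _).trans ?_⟩
    gcongr c * ?_
    exact pow_le_pow_right_of_le_one' (by simp) n.le_succ
  have hlim : ∀ᵐ x, ∃ y, Tendsto (fun n => T (u n) x) atTop (𝓝 y) := by
    have h0 := FastApprox.sub hw.1 hf.1 hf.1 hshift hu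
    rw [sub_self] at h0
    have h1 : ∀ᵐ x, ∀ n, ‖T (u (n + 1)) x - T (u n) x‖ ≤ ‖T (u (n + 1) - u n) x‖ :=
      ae_all_iff.2 fun n => hsub _ _ (hu.1 _) (hu.1 _)
    filter_upwards [h1, ae_eventually_norm_le hw hr hrs hX hT h0] with x hx ⟨B, hB⟩
    refine cauchySeq_tendsto_of_complete (cauchySeq_of_summable_dist ?_)
    refine Summable.of_norm_bounded_eventually_nat (g := fun n => B * (1 / 2) ^ n)
      (summable_geometric_two.mul_left B) ?_
    filter_upwards [hB] with n hn
    rw [Real.norm_of_nonneg dist_nonneg, dist_comm, dist_eq_norm]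
    exact (hx n).trans hn
  obtain ⟨F, hFm, hF⟩ := exists_stronglyMeasurable_limit_of_tendsto_ae
    (fun n => hTm _ (hu.1 n)) hlim
  refine ⟨F, hFm.aestronglyMeasurable, fun z hz => ?_⟩
  have h0 := FastApprox.sub hw.1 hf.1 hf.1 hz hu
  rw [sub_self] at h0
  have h1 : ∀ᵐ x, ∀ n, ‖T (z n) x - T (u n) x‖ ≤ ‖T (z n - u n) x‖ :=
    ae_all_iff.2 fun n => hsub _ _ (hz.1 _) (hu.1 _)
  filter_upwards [h1, ae_eventually_norm_le hw hr hrs hX hT h0, hF] with x hx ⟨B, hB⟩ hFx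
  have hgeom : Tendsto (fun n : ℕ => B * (1 / 2 : ℝ) ^ n) atTop (𝓝 0) := by
    simpa using (tendsto_pow_atTop_nhds_zero_of_lt_one (by norm_num : (0 : ℝ) ≤ 1 / 2)
      (by norm_num)).const_mul B
  have hdiff : Tendsto (fun n => T (z n) x - T (u n) x) atTop (𝓝 0) := by
    refine squeeze_zero_norm' ?_ hgeom
    filter_upwards [hB] with n hn
    exact (hx n).trans hn
  simpa using hdiff.add hFx

theorem IsExtensionValue.norm_sub_le {T : ((Fin d → ℝ) → 𝕜) → ((Fin d → ℝ) → 𝕜)}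
    (hw : IsWeight w) (hr : 0 < r) (hrt : r ≠ ∞)
    (hsub : ∀ f g : (Fin d → ℝ) → 𝕜, BddCompactSupp f → BddCompactSupp g →
      ∀ᵐ x, ‖T f x - T g x‖ ≤ ‖T (f - g) x‖)
    {f g F G J : (Fin d → ℝ) → 𝕜} (hf : MemWeightedLp f r w) (hg : MemWeightedLp g r w)
    (hF : IsExtensionValue r w T f F) (hG : IsExtensionValue r w T g G)
    (hJ : IsExtensionValue r w T (f - g) J) : ∀ᵐ x, ‖F x - G x‖ ≤ ‖J x‖ := by
  obtain ⟨u, hu, -⟩ := exists_fastApprox hw hr hrt hf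
  obtain ⟨z, hz, -⟩ := exists_fastApprox hw hr hrt hg
  have h1 : ∀ᵐ x, ∀ n, ‖T (u n) x - T (z n) x‖ ≤ ‖T (u n - z n) x‖ :=
    ae_all_iff.2 fun n => hsub _ _ (hu.1 _) (hz.1 _)
  filter_upwards [h1, hF.2 u hu, hG.2 z hz, hJ.2 _ (FastApprox.sub hw hf.1 hg.1 hu hz)]
    with x hx hFx hGx hJx
  exact le_of_tendsto_of_tendsto' (hFx.sub hGx).norm hJx.norm hx

/-- The weak quasinorm is lower semicontinuous under convergence almost everywhere. -/
theorem weakLpNorm_le_of_tendsto {Ω F : Type*} [MeasurableSpace Ω] [NormedAddCommGroup F]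
    {μ : Measure Ω} {p : ℝ≥0∞} {f : Ω → F} {g : ℕ → Ω → F} {X : ℝ≥0∞}
    (hg : ∀ n, weakLpNorm (g n) p μ ≤ X)
    (h : ∀ᵐ x ∂μ, Tendsto (fun n => g n x) atTop (𝓝 (f x))) : weakLpNorm f p μ ≤ X := by
  refine iSup₂_le fun t ht => ?_
  set B : ℕ → Set Ω := fun m => {x | ∀ n, m ≤ n → (t : ℝ≥0∞) < ‖g n x‖ₑ} with hB
  have hBmono : Monotone B := fun m n hmn x hx k hk => hx k (hmn.trans hk)
  have hle : μ {x | (t : ℝ≥0∞) < ‖f x‖ₑ} ≤ μ (⋃ m, B m) := by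
    refine measure_mono_ae ?_
    filter_upwards [h] with x hx hxt
    have hxt : (t : ℝ≥0∞) < ‖f x‖ₑ := hxt
    obtain ⟨m, hm⟩ := eventually_atTop.1 (hx.enorm.eventually_const_lt hxt)
    exact Set.mem_iUnion.2 ⟨m, hm⟩
  refine le_trans (mul_le_mul_right (ENNReal.rpow_le_rpow hle ENNReal.toReal_nonneg) _) ?_
  refine le_of_tendsto' (ENNReal.Tendsto.const_mul
    (((ENNReal.continuous_rpow_const (y := (p⁻¹).toReal)).tendsto _).comp
      (tendsto_measure_iUnion_atTop hBmono)) (Or.inr ENNReal.coe_ne_top)) fun n => ?_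
  refine le_trans ?_ (hg n)
  refine le_iSup₂_of_le (f := fun (t : ℝ≥0) (_ : 0 < t) => (t : ℝ≥0∞) *
    μ {x | (t : ℝ≥0∞) < ‖g n x‖ₑ} ^ (p⁻¹).toReal) t ht ?_
  simp only [Function.comp_apply]
  gcongr
  exact fun x hx => hx n le_rfl

theorem IsExtensionValue.endpointWeakNorm_le {T : ((Fin d → ℝ) → 𝕜) → ((Fin d → ℝ) → 𝕜)}
    (hw : IsWeight w) (hr : 0 < r) (hrt : r ≠ ∞) {X : ℝ≥0∞}
    (hT : ∀ f, BddCompactSupp f → endpointWeakNorm r s w (T f) ≤ X * weightedLpNorm f r w)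
    {f F : (Fin d → ℝ) → 𝕜} (hf : MemWeightedLp f r w) (hF : IsExtensionValue r w T f F) :
    endpointWeakNorm r s w F ≤ X * weightedLpNorm f r w := by
  obtain ⟨u, hu, hle⟩ := exists_fastApprox hw hr hrt hf
  refine weakLpNorm_le_of_tendsto (g := fun n x =>
    rescaledWeight r s w x ^ (-(s⁻¹).toReal) • T (u n) x)
    (fun n => (hT _ (hu.1 n)).trans (by gcongr; exact hle n)) ?_
  refine weightMeasure_absolutelyContinuous.ae_le ?_
  filter_upwards [hF.2 u hu] with x hx
  exact hx.const_smul _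

theorem IsExtensionValue.ae_eq {T : ((Fin d → ℝ) → 𝕜) → ((Fin d → ℝ) → 𝕜)}
    {f F : (Fin d → ℝ) → 𝕜} (hf : BddCompactSupp f) (hF : IsExtensionValue r w T f F) :
    F =ᵐ[volume] T f := by
  have hconst : FastApprox r w f fun _ => f := by
    refine ⟨fun _ => hf, 0, by simp, fun n => ?_⟩
    rw [sub_self, weightedLpNorm]
    simp
  filter_upwards [hF.2 _ hconst] with x hx
  exact tendsto_nhds_unique hx tendsto_const_nhds

end Extension

theorem theoremC {d : ℕ} (hd : 0 < d) {𝕜 : Type*} [RCLike 𝕜] (r s q : ℝ≥0∞)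
    (hr : 0 < r) (hrs : r < s) (hq : 0 < q) (hqs : q < s) :
    ∃ C : ℝ≥0, ∀ (K : ℝ≥0) (T : ((Fin d → ℝ) → 𝕜) → ((Fin d → ℝ) → 𝕜)),
      SparseDominated r s q K T →
      ∀ w : (Fin d → ℝ) → ℝ, LimitedRangeWeight r r s w →
        -- the estimate for all bounded `f` with compact support
        (∀ f : (Fin d → ℝ) → 𝕜, BddCompactSupp f →
          endpointWeakNorm r s w (T f) ≤ C * K * weightFactor r s q w * weightedLpNorm f r w) ∧
        -- the estimate for all `f ∈ L^r_w`, for (sub)linear `T` and its extension `T'` to `L^r_w`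
        ((∀ f g : (Fin d → ℝ) → 𝕜, BddCompactSupp f → BddCompactSupp g →
            ∀ᵐ x, ‖T f x - T g x‖ ≤ ‖T (f - g) x‖) →
          ∃ T' : ((Fin d → ℝ) → 𝕜) → ((Fin d → ℝ) → 𝕜),
            (∀ f, BddCompactSupp f → T' f =ᵐ[volume] T f) ∧
            (∀ f, MemWeightedLp f r w → AEStronglyMeasurable (T' f) volume) ∧
            (∀ f g, MemWeightedLp f r w → MemWeightedLp g r w →
              ∀ᵐ x, ‖T' f x - T' g x‖ ≤ ‖T' (f - g) x‖) ∧
            ∀ f, MemWeightedLp f r w →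
              endpointWeakNorm r s w (T' f) ≤
                C * K * weightFactor r s q w * weightedLpNorm f r w) := by
  obtain ⟨C, hC⟩ := exists_endpointWeakNorm_le (𝕜 := 𝕜) hd hr hrs hq hqs
  refine ⟨C, fun K T hT w hw => ?_⟩
  have hest : ∀ f : (Fin d → ℝ) → 𝕜, BddCompactSupp f →
      endpointWeakNorm r s w (T f) ≤ C * K * weightFactor r s q w * weightedLpNorm f r w :=
    fun f hf => hC K T hT w hw f hf (hw.memWeightedLp hr hrs hf).2.ne
  refine ⟨hest, fun hsub => ?_⟩
  have hX : (C : ℝ≥0∞) * K * weightFactor r s q w ≠ ∞ :=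
    ENNReal.mul_ne_top (by simp [ENNReal.mul_eq_top]) (hw.weightFactor_ne_top hr hrs hq)
  have hex : ∀ f : (Fin d → ℝ) → 𝕜, ∃ F, MemWeightedLp f r w → IsExtensionValue r w T f F := by
    intro f
    by_cases hf : MemWeightedLp f r w
    · obtain ⟨F, hF⟩ :=
        exists_isExtensionValue hw hr hrs hX (fun f hf => (hT f hf).1) hest hsub hf
      exact ⟨F, fun _ => hF⟩
    · exact ⟨0, fun h => absurd h hf⟩
  choose T' hT' using hex
  refine ⟨T', fun f hf => (hT' f (hw.memWeightedLp hr hrs hf)).ae_eq hf,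
    fun f hf => (hT' f hf).1, fun f g hf hg => ?_,
    fun f hf => (hT' f hf).endpointWeakNorm_le hw.1 hr hrs.ne_top hest hf⟩
  have hfg : MemWeightedLp (f - g) r w :=
    ⟨hf.1.sub hg.1, (weightedLpNorm_sub_le hw.1 hf.1 hg.1).trans_lt
      (ENNReal.mul_lt_top (ENNReal.LpAddConst_lt_top r) (ENNReal.add_lt_top.2 ⟨hf.2, hg.2⟩))⟩
  exact (hT' f hf).norm_sub_le hw.1 hr hrs.ne_top hsub hf hg (hT' g hg) (hT' _ hfg)
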